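/- Let $(\Omega,\mathcal F,\mathbb P)$ be a probability space with an increasing sequence $(\mathcal F_n)_{n\ge 0}$ of purely atomic sub-$\sigma$-algebras of $\mathcal F$: each $\mathcal F_n$ is generated by a countable partition $\mathscr A_n$ of $\Omega$ into sets of positive probability (its atoms), $\mathcal F_0=\{\emptyset,\Omega\}$, and $\mathcal F=\sigma\left(\bigcup_n\mathcal F_n\right)$. Call $(\Omega,\mathcal F,(\mathcal F_n),\mathbb P)$ a filtered probability space. For $1<p\le 2$, a Banach space $X$ and a constant $C>0$ consider the upper $\ell^p$ estimate $$\|f\|_{L^p(\Omega,X)}\le C\left(\|\mathbb E f\|_X^p+\sum_{n=1}^\infty\left\|\mathbb E(f|\mathcal F_n)-\mathbb E(f|\mathcal F_{n-1})\right\|_{L^p(\Omega,X)}^p\right)^{1/p}\qquad\text{for all } f\in L^p(\Omega,\mathcal F,\mathbb P;X).\tag{$*$}$$ A Banach space $X$ is of martingale type $p$ if there is one constant $C$ such that $(*)$ holds on every filtered probability space. For every $n$ and every $A\in\mathscr A_n$ choose a child of $A$ (an atom $B\in\mathscr A_{n+1}$ with $B\subseteq A$) of largest probability, denoted $A^*$.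 Let $\mathscr E$ be the collection consisting of $\Omega$ and of all sets $B\ne A^*$ that are children of some $A\in\mathscr A_n$, $n\ge 0$. Its Carleson constant is $$[\![\mathscr E]\!]=\sup_{I\in\mathscr E}\frac1{\mathbb P(I)}\sum_{J\in\mathscr E,\,J\subseteq I}\mathbb P(J)\in[1,\infty].$$ Theorem. Let $1<p\le 2$ and fix a filtered probability space $(\Omega,\mathcal F,(\mathcal F_n),\mathbb P)$. Exactly one of the following two statements holds: (a) there exists $C>0$ such that $(*)$ holds for this filtered probability space with the constant $C$ for every Banach space $X$; (b) every Banach space $X$ for which $(*)$ holds for this filtered probability space with some constant $C>0$ is of martingale type $p$. Moreover, for any choice of the largest children $A^*$, (a) holds if and only if $[\![\mathscr E]\!]<\infty$, and (b) holds if and only if $[\![\mathscr E]\!]=\infty$. -/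

import Mathlib

open MeasureTheory
open scoped ENNReal NNReal

/-- A filtered probability space with purely atomic `σ`-algebras over the measurable space `(Ω, m)`
with measure `P` (which is assumed to be a probability measure wherever this is used):
an increasing sequence of sub-`σ`-algebras `seq n` of `m`, each generated by a countable partition
`atoms n` of `Ω` into sets of positive measure, which starts with the trivial `σ`-algebra (so that
the martingale differences `E(f | seq n) - E(f | seq (n - 1))`, `n ≥ 1`, start from `E f`)
and generates `m`. -/
structure AtomicFiltration {Ω : Type*} [m : MeasurableSpace Ω] (P : Measure Ω)
    extends Filtration ℕ m where
  /-- the atoms of the `n`-th `σ`-algebra -/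
  atoms : ℕ → Set (Set Ω)
  countable_atoms : ∀ n, (atoms n).Countable
  pairwiseDisjoint_atoms : ∀ n, (atoms n).PairwiseDisjoint id
  sUnion_atoms : ∀ n, ⋃₀ atoms n = Set.univ
  measure_atoms_pos : ∀ n, ∀ A ∈ atoms n, 0 < P A
  seq_eq_generateFrom : ∀ n, seq n = MeasurableSpace.generateFrom (atoms n)
  atoms_zero : atoms 0 = {Set.univ}
  iSup_seq : ⨆ n, seq n = m

namespace AtomicFiltration

variable {Ω : Type*} [m : MeasurableSpace Ω] {P : Measure Ω}

/-- The children of a level-`n` atom `A`: the atoms of level `n + 1` contained in `A`. -/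
def children (F : AtomicFiltration P) (n : ℕ) (A : Set Ω) : Set (Set Ω) :=
  {B | B ∈ F.atoms (n + 1) ∧ B ⊆ A}

/-- `star` picks, for every `n` and every atom `A` of level `n`, a child of `A` of largest measure
(ties being broken arbitrarily). -/
def IsLargestChildSelection (F : AtomicFiltration P) (star : ℕ → Set Ω → Set Ω) : Prop :=
  ∀ n, ∀ A ∈ F.atoms n, star n A ∈ F.children n A ∧ ∀ B ∈ F.children n A, P B ≤ P (star n A)

/-- The collection `𝓔` consisting of `Ω` and of all atoms which, as a child of an atom of the
preceding level, are not the selected largest child. -/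
def nonLargest (F : AtomicFiltration P) (star : ℕ → Set Ω → Set Ω) : Set (Set Ω) :=
  {Set.univ} ∪ {B | ∃ n, ∃ A ∈ F.atoms n, B ∈ F.children n A ∧ B ≠ star n A}

/-- The upper `ℓ^p` estimate with constant `C` for all `f ∈ L^p(Ω, m, P; X)`:
`‖f‖_p ≤ C (‖E f‖^p + ∑_{n ≥ 1} ‖E(f | F_n) - E(f | F_{n-1})‖_p^p)^{1/p}`,
an inequality in `[0, ∞]`. -/
def UpperEstimate (F : AtomicFiltration P) (p : ℝ) (X : Type*) [NormedAddCommGroup X]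
    [NormedSpace ℝ X] [CompleteSpace X] (C : ℝ≥0) : Prop :=
  ∀ f : Ω → X, MemLp f (ENNReal.ofReal p) P →
    eLpNorm f (ENNReal.ofReal p) P ≤
      (C : ℝ≥0∞) * (‖∫ ω, f ω ∂P‖ₑ ^ p +
        ∑' n : ℕ, eLpNorm (P[f | F.seq (n + 1)] - P[f | F.seq n]) (ENNReal.ofReal p) P ^ p)
          ^ (1 / p)

end AtomicFiltration

/-- The Carleson constant `sup_{I ∈ R} P(I)⁻¹ ∑_{J ∈ R, J ⊆ I} P(J)`, with values in `[0, ∞]`. -/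
noncomputable def carlesonConstant {Ω : Type*} [MeasurableSpace Ω] (P : Measure Ω)
    (R : Set (Set Ω)) : ℝ≥0∞ :=
  ⨆ I ∈ R, (P I)⁻¹ * ∑' J : {J : Set Ω // J ∈ R ∧ J ⊆ I}, P J.1

/-- `X` has martingale type `p`: the upper `ℓ^p` estimate holds with one constant on all filtered
probability spaces with purely atomic `σ`-algebras. -/
def HasMartingaleType.{w, v} (p : ℝ) (X : Type v) [NormedAddCommGroup X] [NormedSpace ℝ X]
    [CompleteSpace X] : Prop :=
  ∃ C : ℝ≥0, 0 < C ∧ ∀ (Ω : Type w) [MeasurableSpace Ω] (P : Measure Ω) [IsProbabilityMeasure P]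
    (F : AtomicFiltration P), F.UpperEstimate p X C

/-- On the given filtered probability space, the upper `ℓ^p` estimate holds with one constant for
all Banach spaces. -/
def EstimateForAll.{v, u} {Ω : Type u} [MeasurableSpace Ω] {P : Measure Ω}
    (F : AtomicFiltration P) (p : ℝ) : Prop :=
  ∃ C : ℝ≥0, 0 < C ∧ ∀ (X : Type v) [NormedAddCommGroup X] [NormedSpace ℝ X] [CompleteSpace X],
    F.UpperEstimate p X C

/-- Every Banach space for which the upper `ℓ^p` estimate holds (with some constant) on the given
filtered probability space has martingale type `p`. -/
def DeterminesMartingaleType.{w, v, u} {Ω : Type u} [MeasurableSpace Ω] {P : Measure Ω}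
    (F : AtomicFiltration P) (p : ℝ) : Prop :=
  ∀ (X : Type v) [NormedAddCommGroup X] [NormedSpace ℝ X] [CompleteSpace X],
    (∃ C : ℝ≥0, 0 < C ∧ F.UpperEstimate p X C) → HasMartingaleType.{w, v} p X

namespace AtomicFiltration

variable {Ω : Type*} [m : MeasurableSpace Ω] {P : Measure Ω}

/-- A selection of largest children exists. -/
theorem exists_isLargestChildSelection [IsProbabilityMeasure P] (F : AtomicFiltration P) :
    ∃ star, F.IsLargestChildSelection star := by
  have key : ∀ n, ∀ A ∈ F.atoms n, ∃ S ∈ F.children n A, ∀ B ∈ F.children n A, P B ≤ P S := by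
    intro n A hA
    have hmeas : ∀ k, ∀ B ∈ F.atoms k, MeasurableSet B := by
      intro k B hB
      refine F.le' k B ?_
      rw [F.seq_eq_generateFrom]
      exact MeasurableSpace.measurableSet_generateFrom hB
    have hdich : ∀ k, ∀ B ∈ F.atoms k, ∀ S, MeasurableSet[F.seq k] S → B ⊆ S ∨ Disjoint B S := by
      intro k B hB S hS
      rw [F.seq_eq_generateFrom] at hS
      induction S, hS using MeasurableSpace.generateFrom_induction with
      | hC t ht _ =>
        by_cases h : B = t
        · exact Or.inl h.le
        · exact Or.inr (F.pairwiseDisjoint_atoms k hB ht h)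
      | empty => exact Or.inr (Set.disjoint_empty B)
      | compl t _ ih =>
        rcases ih with ih | ih
        · exact Or.inr (Set.disjoint_compl_right_iff_subset.2 ih)
        · exact Or.inl (Set.subset_compl_iff_disjoint_right.2 ih)
      | iUnion s _ ih =>
        by_cases h : ∃ i, B ⊆ s i
        · obtain ⟨i, hi⟩ := h
          exact Or.inl (hi.trans (Set.subset_iUnion s i))
        · push Not at h
          refine Or.inr (Set.disjoint_iUnion_right.2 fun i => ?_)
          exact (ih i).resolve_left (h i)
    have hne : ∃ B₀, B₀ ∈ F.children n A := by
      obtain ⟨ω, hω⟩ := nonempty_of_measure_ne_zero (F.measure_atoms_pos n A hA).ne'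
      have h1 : ω ∈ ⋃₀ F.atoms (n + 1) := by rw [F.sUnion_atoms]; trivial
      obtain ⟨B, hB, hωB⟩ := h1
      have hAm : MeasurableSet[F.seq (n + 1)] A := by
        refine F.mono' (Nat.le_succ n) A ?_
        rw [F.seq_eq_generateFrom]
        exact MeasurableSpace.measurableSet_generateFrom hA
      refine ⟨B, hB, ?_⟩
      rcases hdich _ B hB A hAm with h | h
      · exact h
      · exact absurd hω (Set.disjoint_left.1 h hωB)
    obtain ⟨B₀, hB₀⟩ := hne
    have hfin : {B : F.atoms (n + 1) | P B₀ ≤ P B.1}.Finite := by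
      refine Measure.finite_const_le_meas_of_disjoint_iUnion P
        (F.measure_atoms_pos _ B₀ hB₀.1) (As := fun B : F.atoms (n + 1) => B.1)
        (fun B => hmeas _ _ B.2) ?_ (measure_ne_top P _)
      intro B C hBC
      exact F.pairwiseDisjoint_atoms _ B.2 C.2 (fun h => hBC (Subtype.ext h))
    have hfin' : {B | B ∈ F.children n A ∧ P B₀ ≤ P B}.Finite := by
      refine (hfin.image Subtype.val).subset ?_
      rintro B ⟨hB, hle⟩
      exact ⟨⟨B, hB.1⟩, hle, rfl⟩
    obtain ⟨S, hS, hmax⟩ := Set.exists_max_image _ P hfin' ⟨B₀, hB₀, le_rfl⟩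
    refine ⟨S, hS.1, fun B hB => ?_⟩
    rcases le_total (P B₀) (P B) with h | h
    · exact hmax B ⟨hB, h⟩
    · exact h.trans hS.2
  choose! star h1 h2 using key
  exact ⟨star, fun n A hA => ⟨h1 n A hA, h2 n A hA⟩⟩

end AtomicFiltration

universe u v w

/-! Both halves construct a potential (a Bellman function). By `upperEstimate_of_potential` it
suffices to find `W` on pairs (atom, vector) with `‖x‖ ^ p ≤ W`, with `W` at most a multiple of `‖x‖
^ p` at the root, and whose average grows in one step by at most a multiple of the `p`-th moment of
the increment.

Finite Carleson constant. Take `W = w(A) ‖x‖ ^ p`, where `w(A)` is `1` plus `4c` times the relative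
mass of the nonlargest proper descendants of `A`; for small `c` it stays in `[1, 2]`. Passing from
the average `x` over `A` to the values on the children costs, besides moments of the increment, only
a multiple of `c ‖x‖ ^ p P(A \ A*)`. On `A \ A*` this is plain convexity. On `A*` it holds because
the increment has mean zero, so its value there is balanced by its integral over `A \ A*`
(`measure_mul_enorm_rpow_le`). The weights lose exactly `4c P(A \ A*)` in this step
(`setLIntegral_weight`), which pays for it. No geometry of `X` enters.

Infinite Carleson constant. The exits of `A` are the nonlargest children along the chain `A`, `A*`,
`A**`, ... If no atom were rich of some depth, the masses of iterated exits would decay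
geometrically and the Carleson constant would be finite; so rich atoms of every depth exist, with
exits filling any prescribed proportion below one (`exists_isRich`). A rich atom has a cut `U` of
proportion between one third and two thirds (`exists_isCut`). Its centred indicator has energy at
most `2 P(A)`, because the cost telescopes along the chain (`IsCut.energy_le`), and it is constant
on every exit. It plays the role of one random sign, and nesting such functions in exits realizes
every finite dyadic martingale approximately (`exists_realizes`). The two values are taken with
probabilities `q` and `1 - q` instead of one half each; convexity in the starting point repairs this
once the spread is enlarged by the factor 3.

Consequently the estimate on this single space bounds the functional `val` of all dyadic trees. Its
supremum over trees is convex, comparable to `‖x‖ ^ p`, and satisfies a two-point inequality;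
reflection and Jensen's inequality turn that into the one-step inequality for arbitrary increments
(`integral_dyadicSup_le`). It is therefore a potential on every filtered space, which is martingale
type `p`.

The two alternatives exclude each other, since together they would give `ℓ¹` martingale type `p >
1`, contradicted by Rademacher sums of unit vectors. -/

open Filter Topology

/-! ### Atoms and their children -/

namespace AtomicFiltration

lemma eLpNorm_rpow_eq {Ω X : Type*} [MeasurableSpace Ω] [NormedAddCommGroup X] {P : Measure Ω}
    {p : ℝ} (hp : 0 < p) (f : Ω → X) :
    eLpNorm f (ENNReal.ofReal p) P ^ p = ∫⁻ ω, ‖f ω‖ₑ ^ p ∂P := by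
  rw [eLpNorm_eq_lintegral_rpow_enorm_toReal (by simpa using hp) ENNReal.ofReal_ne_top,
    ENNReal.toReal_ofReal hp.le, ← ENNReal.rpow_mul, one_div, inv_mul_cancel₀ hp.ne',
    ENNReal.rpow_one]

lemma integrable_of_memLp {Ω X : Type*} [MeasurableSpace Ω] [NormedAddCommGroup X]
    {P : Measure Ω} [IsProbabilityMeasure P] {f : Ω → X} {p : ℝ} (hp : 1 < p)
    (hf : MemLp f (ENNReal.ofReal p) P) :
    Integrable f P :=
  hf.integrable (by simpa using hp.le)

section Atoms

variable {Ω : Type*} [m : MeasurableSpace Ω] {P : Measure Ω} (F : AtomicFiltration P)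
variable {n k l : ℕ} {A B : Set Ω} {ω ω' : Ω}

lemma measurableSet_seq_of_mem_atoms (hA : A ∈ F.atoms n) : MeasurableSet[F.seq n] A := by
  rw [F.seq_eq_generateFrom]
  exact MeasurableSpace.measurableSet_generateFrom hA

lemma measurableSet_of_mem_atoms (hA : A ∈ F.atoms n) : MeasurableSet A :=
  F.le' n A (F.measurableSet_seq_of_mem_atoms hA)

lemma nonempty_of_mem_atoms (hA : A ∈ F.atoms n) : A.Nonempty :=
  nonempty_of_measure_ne_zero (F.measure_atoms_pos n A hA).ne'

lemma univ_mem_atoms_zero : Set.univ ∈ F.atoms 0 := by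
  rw [F.atoms_zero]; rfl

/-- An atom is contained in or disjoint from every set of its `σ`-algebra. -/
lemma subset_or_disjoint_of_measurableSet (hB : B ∈ F.atoms k) {S : Set Ω}
    (hS : MeasurableSet[F.seq k] S) : B ⊆ S ∨ Disjoint B S := by
  rw [F.seq_eq_generateFrom] at hS
  induction S, hS using MeasurableSpace.generateFrom_induction with
  | hC t ht _ =>
    by_cases h : B = t
    · exact Or.inl h.le
    · exact Or.inr (F.pairwiseDisjoint_atoms k hB ht h)
  | empty => exact Or.inr (Set.disjoint_empty B)
  | compl t _ ih =>
    rcases ih with ih | ih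
    · exact Or.inr (Set.disjoint_compl_right_iff_subset.2 ih)
    · exact Or.inl (Set.subset_compl_iff_disjoint_right.2 ih)
  | iUnion s _ ih =>
    by_cases h : ∃ i, B ⊆ s i
    · obtain ⟨i, hi⟩ := h
      exact Or.inl (hi.trans (Set.subset_iUnion s i))
    · push Not at h
      exact Or.inr (Set.disjoint_iUnion_right.2 fun i => (ih i).resolve_left (h i))

lemma subset_or_disjoint (hkl : k ≤ l) (hA : A ∈ F.atoms k) (hB : B ∈ F.atoms l) :
    B ⊆ A ∨ Disjoint B A :=
  F.subset_or_disjoint_of_measurableSet hB (F.mono' hkl A (F.measurableSet_seq_of_mem_atoms hA))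

lemma subset_of_mem_of_mem (hkl : k ≤ l) (hA : A ∈ F.atoms k) (hB : B ∈ F.atoms l)
    (h1 : ω ∈ A) (h2 : ω ∈ B) : B ⊆ A :=
  (F.subset_or_disjoint hkl hA hB).resolve_right fun h => Set.disjoint_left.1 h h2 h1

lemma eq_of_mem_of_mem (hA : A ∈ F.atoms n) (hB : B ∈ F.atoms n) (h1 : ω ∈ A) (h2 : ω ∈ B) :
    A = B :=
  (F.subset_of_mem_of_mem le_rfl hB hA h2 h1).antisymm (F.subset_of_mem_of_mem le_rfl hA hB h1 h2)

lemma exists_mem_atoms (n : ℕ) (ω : Ω) : ∃ A ∈ F.atoms n, ω ∈ A := by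
  have h : ω ∈ ⋃₀ F.atoms n := by rw [F.sUnion_atoms]; trivial
  exact h

/-- The atom of level `n` that contains `ω`. -/
noncomputable def atomAt (n : ℕ) (ω : Ω) : Set Ω := (F.exists_mem_atoms n ω).choose

lemma atomAt_mem (n : ℕ) (ω : Ω) : F.atomAt n ω ∈ F.atoms n :=
  (F.exists_mem_atoms n ω).choose_spec.1

lemma mem_atomAt (n : ℕ) (ω : Ω) : ω ∈ F.atomAt n ω :=
  (F.exists_mem_atoms n ω).choose_spec.2

lemma atomAt_eq (hA : A ∈ F.atoms n) (hω : ω ∈ A) : F.atomAt n ω = A :=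
  F.eq_of_mem_of_mem (F.atomAt_mem n ω) hA (F.mem_atomAt n ω) hω

lemma atomAt_subset (hkl : k ≤ l) (ω : Ω) : F.atomAt l ω ⊆ F.atomAt k ω :=
  F.subset_of_mem_of_mem hkl (F.atomAt_mem k ω) (F.atomAt_mem l ω) (F.mem_atomAt k ω)
    (F.mem_atomAt l ω)

lemma children_countable (n : ℕ) (A : Set Ω) : (F.children n A).Countable :=
  (F.countable_atoms (n + 1)).mono fun _ h => h.1

lemma children_pairwiseDisjoint (n : ℕ) (A : Set Ω) : (F.children n A).PairwiseDisjoint id :=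
  (F.pairwiseDisjoint_atoms (n + 1)).subset fun _ h => h.1

lemma atomAt_succ_mem_children (hA : A ∈ F.atoms n) (hω : ω ∈ A) :
    F.atomAt (n + 1) ω ∈ F.children n A :=
  ⟨F.atomAt_mem _ _, F.subset_of_mem_of_mem n.le_succ hA (F.atomAt_mem _ _) hω (F.mem_atomAt _ _)⟩

lemma biUnion_children (hA : A ∈ F.atoms n) : ⋃ B ∈ F.children n A, B = A := by
  refine Set.Subset.antisymm (Set.iUnion₂_subset fun B hB => hB.2) fun ω hω => ?_
  exact Set.mem_iUnion₂.2 ⟨_, F.atomAt_succ_mem_children hA hω, F.mem_atomAt _ _⟩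

lemma setLIntegral_eq_tsum_children (hA : A ∈ F.atoms n) (g : Ω → ℝ≥0∞) :
    ∫⁻ ω in A, g ω ∂P = ∑' B : F.children n A, ∫⁻ ω in B.1, g ω ∂P := by
  conv_lhs => rw [← F.biUnion_children hA]
  exact lintegral_biUnion (s := fun B : Set Ω => B) (F.children_countable n A)
    (fun B hB => F.measurableSet_of_mem_atoms hB.1) (F.children_pairwiseDisjoint n A) g

lemma measure_inter_eq_tsum_children (hA : A ∈ F.atoms n) (S : Set Ω) :
    P (A ∩ S) = ∑' B : F.children n A, P (B.1 ∩ S) := by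
  have h : ∀ B, MeasurableSet B → P (B ∩ S) = ∫⁻ ω in B, 1 ∂(P.restrict S) := fun B hB => by
    simp [Measure.restrict_apply hB]
  rw [h A (F.measurableSet_of_mem_atoms hA)]
  conv_lhs => rw [← F.biUnion_children hA]
  rw [lintegral_biUnion (s := fun B : Set Ω => B) (F.children_countable n A)
    (fun B hB => F.measurableSet_of_mem_atoms hB.1) (F.children_pairwiseDisjoint n A)]
  exact tsum_congr fun B => (h B.1 (F.measurableSet_of_mem_atoms B.2.1)).symm

lemma measure_eq_tsum_children (hA : A ∈ F.atoms n) : P A = ∑' B : F.children n A, P B.1 := by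
  simpa using F.measure_inter_eq_tsum_children hA Set.univ

lemma lintegral_eq_tsum_atoms (n : ℕ) (g : Ω → ℝ≥0∞) :
    ∫⁻ ω, g ω ∂P = ∑' A : F.atoms n, ∫⁻ ω in A.1, g ω ∂P := by
  rw [← lintegral_biUnion (s := fun B : Set Ω => B) (F.countable_atoms n)
    (fun B hB => F.measurableSet_of_mem_atoms hB) (F.pairwiseDisjoint_atoms n),
    ← Set.sUnion_eq_biUnion, F.sUnion_atoms, Measure.restrict_univ]

/-- The level set of `g` through `ω` belongs to the `σ`-algebra of level `n` and meets the atom, so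
it contains the atom. -/
lemma eq_of_stronglyMeasurable {Y : Type*} [TopologicalSpace Y] [TopologicalSpace.MetrizableSpace Y]
    {g : Ω → Y} (hg : StronglyMeasurable[F.seq n] g) (hA : A ∈ F.atoms n) (h1 : ω ∈ A)
    (h2 : ω' ∈ A) : g ω' = g ω := by
  have hS : MeasurableSet[F.seq n] {x | g x = g ω} :=
    hg.measurableSet_eq_fun stronglyMeasurable_const
  rcases F.subset_or_disjoint_of_measurableSet hA hS with h | h
  · exact h h2
  · exact absurd rfl (Set.disjoint_left.1 h h1)

end Atoms

/-! ### Conditional expectations, energy and the potential method -/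

section CondExp

variable {Ω : Type*} [m : MeasurableSpace Ω] {P : Measure Ω} [IsProbabilityMeasure P]
  (F : AtomicFiltration P) {X : Type*} [NormedAddCommGroup X] [NormedSpace ℝ X]
variable {n k l : ℕ} {A B : Set Ω} {ω ω' : Ω} {f g : Ω → X}

lemma measureReal_pos (hA : A ∈ F.atoms n) : 0 < P.real A :=
  ENNReal.toReal_pos (F.measure_atoms_pos n A hA).ne' (measure_ne_top P A)

variable [CompleteSpace X]

/-- The conditional expectation is everywhere the average over the atom. -/
lemma condExp_eq_setAverage (hf : Integrable f P) (hA : A ∈ F.atoms n) (hω : ω ∈ A) :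
    (P[f | F.seq n]) ω = ⨍ x in A, f x ∂P := by
  have h1 : ∫ x in A, (P[f | F.seq n]) x ∂P = ∫ x in A, f x ∂P :=
    setIntegral_condExp (F.le' n) hf (F.measurableSet_seq_of_mem_atoms hA)
  have h2 : ∫ x in A, (P[f | F.seq n]) x ∂P = ∫ x in A, (P[f | F.seq n]) ω ∂P :=
    setIntegral_congr_fun (F.measurableSet_of_mem_atoms hA) fun x hx =>
      F.eq_of_stronglyMeasurable stronglyMeasurable_condExp hA hω hx
  rw [setIntegral_const] at h2
  rw [setAverage_eq, ← h1, h2, smul_smul, inv_mul_cancel₀ (F.measureReal_pos hA).ne', one_smul]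

lemma condExp_eq_of_eq_on (hf : Integrable f P) (hg : Integrable g P) (hA : A ∈ F.atoms n)
    (hω : ω ∈ A) (h : ∀ x ∈ A, f x = g x) : (P[f | F.seq n]) ω = (P[g | F.seq n]) ω := by
  rw [F.condExp_eq_setAverage hf hA hω, F.condExp_eq_setAverage hg hA hω, setAverage_eq,
    setAverage_eq, setIntegral_congr_fun (F.measurableSet_of_mem_atoms hA) h]

lemma condExp_eq_const (hf : Integrable f P) (hA : A ∈ F.atoms n) (hω : ω ∈ A) {x : X}
    (h : ∀ ω ∈ A, f ω = x) : (P[f | F.seq n]) ω = x := by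
  rw [F.condExp_eq_of_eq_on hf (integrable_const x) hA hω h, condExp_const (F.le' n)]

lemma condExp_eq_zero (hf : Integrable f P) (hA : A ∈ F.atoms n) (hω : ω ∈ A)
    (h : ∫ x in A, f x ∂P = 0) : (P[f | F.seq n]) ω = 0 := by
  rw [F.condExp_eq_setAverage hf hA hω, setAverage_eq, h, smul_zero]

lemma condExp_add_apply (hf : Integrable f P) (hg : Integrable g P) (n : ℕ) (ω : Ω) :
    (P[f + g | F.seq n]) ω = (P[f | F.seq n]) ω + (P[g | F.seq n]) ω := by
  have hA := F.atomAt_mem n ω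
  have hω := F.mem_atomAt n ω
  rw [F.condExp_eq_setAverage hf hA hω, F.condExp_eq_setAverage hg hA hω,
    F.condExp_eq_setAverage (hf.add hg) hA hω]
  simp only [setAverage_eq, Pi.add_apply]
  rw [integral_add hf.integrableOn hg.integrableOn, smul_add]

lemma setAverage_condExp (hf : Integrable f P) (hA : A ∈ F.atoms n) (hkn : n ≤ k) :
    ⨍ x in A, (P[f | F.seq k]) x ∂P = ⨍ x in A, f x ∂P := by
  rw [setAverage_eq, setAverage_eq, setIntegral_condExp (F.le' k) hf
    (F.mono' hkn A (F.measurableSet_seq_of_mem_atoms hA))]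

lemma condExp_zero_eq (hf : Integrable f P) (ω : Ω) : (P[f | F.seq 0]) ω = ∫ x, f x ∂P := by
  rw [F.condExp_eq_setAverage hf F.univ_mem_atoms_zero (Set.mem_univ ω), setAverage_eq]
  simp

/-- Convergence in `L¹` of the closed martingale of a vector-valued function. -/
lemma tendsto_eLpNorm_condExp_sub (hf : Integrable f P) :
    Tendsto (fun n => eLpNorm (P[f | F.seq n] - f) 1 P) atTop (𝓝 0) := by
  let Q : (Ω → X) → Prop := fun g => Integrable g P ∧
    Tendsto (fun n => eLpNorm (P[g | F.seq n] - g) 1 P) atTop (𝓝 0)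
  have hind : ∀ (c : X) ⦃s : Set Ω⦄, MeasurableSet s → Q (s.indicator fun _ => c) := by
    intro c s hs
    have hc : Integrable (s.indicator fun _ => c) P := (integrable_const c).indicator hs
    refine ⟨hc, ?_⟩
    have hr : Integrable (s.indicator fun _ => (1 : ℝ)) P := (integrable_const 1).indicator hs
    -- For an indicator times a vector the martingale is scalar, so the real-valued convergence
    -- theorem applies; density of simple functions gives the rest.
    have hlim := hr.tendsto_eLpNorm_condExp (ℱ := F.toFiltration) (by
      have : (⨆ n, F.toFiltration n) = m := F.iSup_seq
      rw [this]
      exact stronglyMeasurable_const.indicator hs)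
    have hlim2 := ENNReal.Tendsto.const_mul (a := ‖c‖ₑ) hlim (Or.inr enorm_ne_top)
    rw [mul_zero] at hlim2
    refine tendsto_of_tendsto_of_tendsto_of_le_of_le tendsto_const_nhds hlim2
      (fun _ => zero_le) fun n => ?_
    refine eLpNorm_le_mul_eLpNorm_of_ae_le_mul'' (g := P[s.indicator fun _ => (1 : ℝ) | F.seq n] -
      s.indicator fun _ => (1 : ℝ)) 1 (integrable_condExp.sub hr).aestronglyMeasurable
      (ae_of_all _ fun ω => ?_)
    have hA := F.atomAt_mem n ω
    have hω := F.mem_atomAt n ω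
    have h1 : ∀ x, s.indicator (fun _ => c) x = s.indicator (fun _ => (1 : ℝ)) x • c := by
      intro x; by_cases hx : x ∈ s <;> simp [hx]
    have h2 : (P[s.indicator fun _ => c | F.seq n]) ω =
        (P[s.indicator fun _ => (1 : ℝ) | F.seq n]) ω • c := by
      rw [F.condExp_eq_setAverage hc hA hω, F.condExp_eq_setAverage hr hA hω]
      simp only [setAverage_eq, h1]
      rw [integral_smul_const, smul_assoc]
    simp only [Pi.sub_apply]
    have h3 : (P[s.indicator fun _ => c | F.seq n]) ω - s.indicator (fun _ => c) ω =
        ((P[s.indicator fun _ => (1 : ℝ) | F.seq n]) ω - s.indicator (fun _ => (1 : ℝ)) ω) • c := by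
      rw [h2, h1, sub_smul]
    exact (congrArg enorm h3).le.trans (by rw [enorm_smul, mul_comm])
  have hadd : ∀ f g, Q f → Q g → Q (f + g) := by
    rintro f g ⟨hf, hf'⟩ ⟨hg, hg'⟩
    refine ⟨hf.add hg, ?_⟩
    have h := hf'.add hg'
    rw [add_zero] at h
    refine tendsto_of_tendsto_of_tendsto_of_le_of_le tendsto_const_nhds h
      (fun _ => zero_le) fun n => ?_
    have h1 : P[f + g | F.seq n] - (f + g) = (P[f | F.seq n] - f) + (P[g | F.seq n] - g) := by
      ext ω
      simp only [Pi.sub_apply, Pi.add_apply, F.condExp_add_apply hf hg]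
      abel
    rw [h1]
    exact eLpNorm_add_le (integrable_condExp.sub hf).aestronglyMeasurable
      (integrable_condExp.sub hg).aestronglyMeasurable le_rfl
  refine ENNReal.tendsto_nhds_zero.2 fun ε hε => ?_
  have hε3 : ε / 3 ≠ 0 := (ENNReal.div_pos hε.ne' (by simp)).ne'
  obtain ⟨g, hfg, hg, hg'⟩ := (memLp_one_iff_integrable.2 hf).induction_dense (by simp) Q
    (fun c s hs _ ε _ => ⟨s.indicator fun _ => c, by simp, hind c hs⟩) hadd
    (fun f hf => hf.1.aestronglyMeasurable) hε3
  filter_upwards [ENNReal.tendsto_nhds_zero.1 hg' (ε / 3) (pos_iff_ne_zero.2 hε3)] with n hn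
  have h1 : P[f | F.seq n] - f =
      (P[f - g | F.seq n] + (P[g | F.seq n] - g)) + (g - f) := by
    ext ω
    have := F.condExp_add_apply (hf.sub hg) hg n ω
    rw [sub_add_cancel] at this
    simp only [Pi.sub_apply, Pi.add_apply, this]
    abel
  rw [h1]
  calc _ ≤ eLpNorm (P[f - g | F.seq n] + (P[g | F.seq n] - g)) 1 P + eLpNorm (g - f) 1 P :=
        eLpNorm_add_le (integrable_condExp.add (integrable_condExp.sub hg)).aestronglyMeasurable
          (hg.sub hf).aestronglyMeasurable le_rfl
    _ ≤ eLpNorm (P[f - g | F.seq n]) 1 P + eLpNorm (P[g | F.seq n] - g) 1 P +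
          eLpNorm (g - f) 1 P := by
        gcongr
        exact eLpNorm_add_le integrable_condExp.aestronglyMeasurable
          (integrable_condExp.sub hg).aestronglyMeasurable le_rfl
    _ ≤ ε / 3 + ε / 3 + ε / 3 := by
        gcongr
        · exact (eLpNorm_condExp_le_eLpNorm _ le_rfl).trans hfg
        · rwa [eLpNorm_sub_comm]
    _ = ε := ENNReal.add_thirds ε

/-- A bound for the moments of the closed martingale is a bound for the moment of its limit. -/
lemma lintegral_rpow_le_of_condExp {p : ℝ} (hf : Integrable f P) {b : ℝ≥0∞}
    (h : ∀ n, ∫⁻ ω, ‖(P[f | F.seq n]) ω‖ₑ ^ p ∂P ≤ b) : ∫⁻ ω, ‖f ω‖ₑ ^ p ∂P ≤ b := by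
  -- Convergence in `L¹` gives an almost everywhere convergent subsequence, to which Fatou's lemma
  -- applies.
  have hmeas := tendstoInMeasure_of_tendsto_eLpNorm (p := 1) one_ne_zero
    (fun n => (integrable_condExp (m := F.seq n) (f := f) (μ := P)).aestronglyMeasurable)
    hf.aestronglyMeasurable (F.tendsto_eLpNorm_condExp_sub hf)
  obtain ⟨ns, _, hns⟩ := hmeas.exists_seq_tendsto_ae
  calc ∫⁻ ω, ‖f ω‖ₑ ^ p ∂P
      = ∫⁻ ω, liminf (fun i => ‖(P[f | F.seq (ns i)]) ω‖ₑ ^ p) atTop ∂P := by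
        refine lintegral_congr_ae (hns.mono fun ω hω => ?_)
        exact (((ENNReal.continuous_rpow_const (y := p)).tendsto _).comp hω.enorm).liminf_eq.symm
    _ ≤ liminf (fun i => ∫⁻ ω, ‖(P[f | F.seq (ns i)]) ω‖ₑ ^ p ∂P) atTop :=
        lintegral_liminf_le' fun i =>
          (integrable_condExp.aestronglyMeasurable.enorm.pow_const p)
    _ ≤ b := liminf_le_of_le (by isBoundedDefault) fun c hc => by
        obtain ⟨i, hi⟩ := hc.exists
        exact hi.trans (h _)

/-- The `p`-energy of a function: the sum of the `p`-th moments of its martingale differences. -/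
noncomputable def energy (p : ℝ) (f : Ω → X) : ℝ≥0∞ :=
  ∑' n : ℕ, ∫⁻ ω, ‖(P[f | F.seq (n + 1)]) ω - (P[f | F.seq n]) ω‖ₑ ^ p ∂P

omit [IsProbabilityMeasure P] in
lemma upperEstimate_iff {p : ℝ} (hp : 1 < p) (C : ℝ≥0) : F.UpperEstimate p X C ↔
    ∀ f : Ω → X, MemLp f (ENNReal.ofReal p) P →
      ∫⁻ ω, ‖f ω‖ₑ ^ p ∂P ≤ (C : ℝ≥0∞) ^ p * (‖∫ ω, f ω ∂P‖ₑ ^ p + F.energy p f) := by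
  have hp0 : 0 < p := one_pos.trans hp
  refine forall₂_congr fun f _ => ?_
  simp only [eLpNorm_rpow_eq hp0, Pi.sub_apply]
  rw [← eLpNorm_rpow_eq hp0 f, ← ENNReal.rpow_le_rpow_iff hp0, ENNReal.mul_rpow_of_nonneg _ _ hp0.le,
    ← ENNReal.rpow_mul, one_div, inv_mul_cancel₀ hp0.ne', ENNReal.rpow_one]
  rfl

/-- If a nonnegative function `W` of atoms and vectors dominates `‖x‖ ^ p`, is controlled by it at
the root, and grows in one step by at most a multiple of the `p`-th moment of the increment, then
the upper `ℓ^p` estimate holds. -/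
theorem upperEstimate_of_potential {p : ℝ} (hp : 1 < p) {K : ℝ≥0} (W : ℕ → Set Ω → X → ℝ≥0∞)
    (hW : ∀ n, ∀ A ∈ F.atoms n, ∀ x, ‖x‖ₑ ^ p ≤ W n A x)
    (hW0 : ∀ x, W 0 Set.univ x ≤ K * ‖x‖ₑ ^ p)
    (hstep : ∀ n, ∀ A ∈ F.atoms n, ∀ g : Ω → X, MemLp g (ENNReal.ofReal p) P →
      StronglyMeasurable[F.seq (n + 1)] g →
      ∫⁻ ω in A, W (n + 1) (F.atomAt (n + 1) ω) (g ω) ∂P ≤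
        P A * W n A (⨍ ω in A, g ω ∂P) + K * ∫⁻ ω in A, ‖g ω - ⨍ ω in A, g ω ∂P‖ₑ ^ p ∂P) :
    F.UpperEstimate p X (K ^ (1 / p)) := by
  have hp0 : 0 < p := one_pos.trans hp
  rw [F.upperEstimate_iff hp]
  intro f hf
  have hfi := integrable_of_memLp hp hf
  have hK : ((K ^ (1 / p) : ℝ≥0) : ℝ≥0∞) ^ p = K := by
    rw [ENNReal.coe_rpow_of_nonneg _ (by positivity), ← ENNReal.rpow_mul, one_div,
      inv_mul_cancel₀ hp0.ne', ENNReal.rpow_one]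
  rw [hK]
  refine F.lintegral_rpow_le_of_condExp hfi fun n => ?_
  set d : ℕ → ℝ≥0∞ := fun n =>
    ∫⁻ ω, ‖(P[f | F.seq (n + 1)]) ω - (P[f | F.seq n]) ω‖ₑ ^ p ∂P with hd
  -- Summing `hstep` over the atoms of level `n` gives one step of a telescoping bound: the integral
  -- of the potential along the martingale grows by at most `K * d n`.
  have key : ∀ n, ∫⁻ ω, W n (F.atomAt n ω) ((P[f | F.seq n]) ω) ∂P ≤
      K * (‖∫ ω, f ω ∂P‖ₑ ^ p + ∑ i ∈ Finset.range n, d i) := by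
    intro n
    induction n with
    | zero =>
      have : ∀ ω, W 0 (F.atomAt 0 ω) ((P[f | F.seq 0]) ω) = W 0 Set.univ (∫ ω, f ω ∂P) := by
        intro ω
        rw [F.condExp_zero_eq hfi, F.atomAt_eq F.univ_mem_atoms_zero (Set.mem_univ ω)]
      simpa [this] using hW0 (∫ ω, f ω ∂P)
    | succ n ih =>
      rw [Finset.sum_range_succ, ← add_assoc, mul_add]
      refine le_trans ?_ (add_le_add_left ih _)
      rw [F.lintegral_eq_tsum_atoms n, F.lintegral_eq_tsum_atoms n, hd]
      dsimp only
      rw [F.lintegral_eq_tsum_atoms n, ← ENNReal.tsum_mul_left, ← ENNReal.tsum_add]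
      refine ENNReal.tsum_le_tsum fun A => ?_
      have hav := F.setAverage_condExp hfi A.2 n.le_succ
      refine (hstep n A A.2 (P[f | F.seq (n + 1)]) ?_ stronglyMeasurable_condExp).trans
        (add_le_add (le_of_eq ?_) (le_of_eq ?_))
      · refine ⟨integrable_condExp.aestronglyMeasurable, lt_of_le_of_lt ?_ hf.2⟩
        exact eLpNorm_condExp_le_eLpNorm f (by simpa using hp.le)
      · rw [hav, setLIntegral_congr_fun (g := fun _ => W n A.1 (⨍ ω in A.1, f ω ∂P))
          (F.measurableSet_of_mem_atoms A.2) fun ω hω => by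
            simp only [F.atomAt_eq A.2 hω, F.condExp_eq_setAverage hfi A.2 hω]]
        rw [setLIntegral_const, mul_comm]
      · rw [hav]
        congr 1
        exact setLIntegral_congr_fun (F.measurableSet_of_mem_atoms A.2) fun ω hω => by
          simp only [F.condExp_eq_setAverage hfi A.2 hω]
  calc ∫⁻ ω, ‖(P[f | F.seq n]) ω‖ₑ ^ p ∂P
      ≤ ∫⁻ ω, W n (F.atomAt n ω) ((P[f | F.seq n]) ω) ∂P :=
        lintegral_mono fun ω => hW n _ (F.atomAt_mem n ω) _
    _ ≤ K * (‖∫ ω, f ω ∂P‖ₑ ^ p + ∑ i ∈ Finset.range n, d i) := key n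
    _ ≤ _ := by
        gcongr
        exact ENNReal.sum_le_tsum _

end CondExp

end AtomicFiltration

/-! ### The nonlargest children, sorted by level -/

namespace AtomicFiltration

section NonLargest

variable {Ω : Type*} [m : MeasurableSpace Ω] {P : Measure Ω} (F : AtomicFiltration P)
  (star : ℕ → Set Ω → Set Ω)
variable {n k l : ℕ} {A B I J : Set Ω} {ω : Ω}

/-- The members of the collection `nonLargest` that appear at level `k`. -/
def nonLargestAt : ℕ → Set (Set Ω)
  | 0 => {Set.univ}
  | k + 1 => {B | ∃ A ∈ F.atoms k, B ∈ F.children k A ∧ B ≠ star k A}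

/-- The union of the members of the collection `nonLargest` that appear at level `k`. -/
def nonLargestUnion (k : ℕ) : Set Ω := ⋃₀ F.nonLargestAt star k

variable {star}

lemma mem_nonLargest_iff : B ∈ F.nonLargest star ↔ ∃ k, B ∈ F.nonLargestAt star k := by
  constructor
  · rintro (h | ⟨n, h⟩)
    · exact ⟨0, h⟩
    · exact ⟨n + 1, h⟩
  · rintro ⟨_ | n, h⟩
    · exact Or.inl h
    · exact Or.inr ⟨n, h⟩

lemma nonLargestAt_subset : F.nonLargestAt star k ⊆ F.atoms k := by
  rcases k with _ | k
  · exact (F.atoms_zero).ge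
  · rintro B ⟨A, _, hB, _⟩
    exact hB.1

lemma inter_nonLargestUnion_of_mem (hI : I ∈ F.nonLargestAt star n) :
    I ∩ F.nonLargestUnion star n = I :=
  Set.inter_eq_left.2 (Set.subset_sUnion_of_mem hI)

lemma eq_of_mem_children_of_mem_children (hA : A ∈ F.atoms n) (hI : I ∈ F.atoms n)
    (h1 : B ∈ F.children n A) (h2 : B ∈ F.children n I) : A = I := by
  obtain ⟨ω, hω⟩ := F.nonempty_of_mem_atoms h1.1
  exact F.eq_of_mem_of_mem hA hI (h1.2 hω) (h2.2 hω)

lemma mem_nonLargestAt_of_ne (hA : A ∈ F.atoms n) (hB : B ∈ F.children n A) (h : B ≠ star n A) :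
    B ∈ F.nonLargestAt star (n + 1) :=
  ⟨A, hA, hB, h⟩

variable (hstar : F.IsLargestChildSelection star)
include hstar

lemma star_inter_nonLargestUnion (hI : I ∈ F.atoms n) :
    star n I ∩ F.nonLargestUnion star (n + 1) = ∅ := by
  refine Set.eq_empty_of_forall_notMem fun ω hω => ?_
  obtain ⟨hω, J, ⟨A, hA, hJ, hne⟩, hωJ⟩ := hω
  have hs := (hstar n I hI).1
  obtain rfl := F.eq_of_mem_of_mem hs.1 hJ.1 hω hωJ
  exact hne (by rw [F.eq_of_mem_children_of_mem_children hI hA hs hJ])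

/-- A set may be an atom of several consecutive levels. If `J` is an atom of level `k < l`, then its
parent at level `l - 1` is `J` itself, so `J` is an only child there and must be the selected one.
Hence the level-free collection can be summed level by level without double counting. -/
lemma level_unique (hk : J ∈ F.nonLargestAt star k) (hl : J ∈ F.nonLargestAt star l) : k = l := by
  wlog hkl : k < l generalizing k l
  · rcases lt_trichotomy k l with h | h | h
    · exact this hk hl h
    · exact h
    · exact (this hl hk h).symm
  obtain _ | l := l
  · omega
  obtain ⟨A, hA, hJ, hne⟩ := hl
  obtain ⟨ω, hω⟩ := F.nonempty_of_mem_atoms hJ.1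
  obtain rfl : J = A := hJ.2.antisymm
    (F.subset_of_mem_of_mem (Nat.lt_succ_iff.1 hkl) (F.nonLargestAt_subset hk) hA hω (hJ.2 hω))
  have hs := (hstar l J hA).1
  obtain ⟨ω', hω'⟩ := F.nonempty_of_mem_atoms hs.1
  exact absurd (F.eq_of_mem_of_mem hJ.1 hs.1 (hs.2 hω') hω') hne

omit hstar

lemma measure_inter_nonLargestUnion (hI : I ∈ F.atoms n) (hnk : n ≤ k) :
    P (I ∩ F.nonLargestUnion star k) =
      ∑' J : {J : Set Ω // J ∈ F.nonLargestAt star k ∧ J ⊆ I}, P J.1 := by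
  have h : I ∩ F.nonLargestUnion star k = ⋃ J ∈ {J | J ∈ F.nonLargestAt star k ∧ J ⊆ I}, J := by
    ext ω
    simp only [Set.mem_inter_iff, Set.mem_iUnion, nonLargestUnion, Set.mem_sUnion,
      Set.mem_ofPred_eq, exists_prop]
    constructor
    · rintro ⟨hω, J, hJ, hωJ⟩
      exact ⟨J, ⟨hJ, F.subset_of_mem_of_mem hnk hI (F.nonLargestAt_subset hJ) hω hωJ⟩, hωJ⟩
    · rintro ⟨J, ⟨hJ, hJI⟩, hωJ⟩
      exact ⟨hJI hωJ, J, hJ, hωJ⟩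
  rw [h]
  exact measure_biUnion ((F.countable_atoms k).mono fun J hJ => F.nonLargestAt_subset hJ.1)
    ((F.pairwiseDisjoint_atoms k).subset fun J hJ => F.nonLargestAt_subset hJ.1)
    fun J hJ => F.measurableSet_of_mem_atoms (F.nonLargestAt_subset hJ.1)

lemma tsum_measure_inter_nonLargestUnion (hI : I ∈ F.atoms n) :
    ∑' k, P (I ∩ F.nonLargestUnion star (n + k)) =
      ∑' J : (Σ k : ℕ, {J : Set Ω // J ∈ F.nonLargestAt star (n + k) ∧ J ⊆ I}), P J.2.1 := by
  rw [ENNReal.tsum_sigma']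
  exact tsum_congr fun k => F.measure_inter_nonLargestUnion hI (Nat.le_add_right n k)

lemma tsum_nonLargest_le (hI : I ∈ F.nonLargestAt star n) :
    ∑' J : {J : Set Ω // J ∈ F.nonLargest star ∧ J ⊆ I}, P J.1 ≤
      ∑' k, P (I ∩ F.nonLargestUnion star (n + k)) := by
  rw [F.tsum_measure_inter_nonLargestUnion (F.nonLargestAt_subset hI)]
  have hex : ∀ J : {J : Set Ω // J ∈ F.nonLargest star ∧ J ⊆ I},
      ∃ k, J.1 ∈ F.nonLargestAt star (n + k) := by
    rintro ⟨J, hJ, hJI⟩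
    obtain ⟨k, hk⟩ := F.mem_nonLargest_iff.1 hJ
    rcases le_total n k with h | h
    -- A member contained in `I` but appearing at a level `k ≤ n` equals `I`, and is then counted at
    -- level `n`, that is, with index 0.
    · exact ⟨k - n, by rwa [Nat.add_sub_cancel' h]⟩
    · obtain ⟨ω, hω⟩ := F.nonempty_of_mem_atoms (F.nonLargestAt_subset hk)
      refine ⟨0, ?_⟩
      have : J = I := hJI.antisymm (F.subset_of_mem_of_mem h (F.nonLargestAt_subset hk)
        (F.nonLargestAt_subset hI) hω (hJI hω))
      exact this ▸ hI
  choose κ hκ using hex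
  refine ENNReal.tsum_comp_le_tsum_of_injective
    (f := fun J : {J : Set Ω // J ∈ F.nonLargest star ∧ J ⊆ I} =>
      (⟨κ J, J.1, hκ J, J.2.2⟩ :
        Σ k : ℕ, {J : Set Ω // J ∈ F.nonLargestAt star (n + k) ∧ J ⊆ I})) ?_ (fun J => P J.2.1)
  intro J J' h
  have := congrArg (fun S : Σ k : ℕ, {J : Set Ω // J ∈ F.nonLargestAt star (n + k) ∧ J ⊆ I} =>
    S.2.1) h
  exact Subtype.ext this

include hstar

lemma le_tsum_nonLargest (hI : I ∈ F.nonLargestAt star n) :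
    ∑' k, P (I ∩ F.nonLargestUnion star (n + k)) ≤
      ∑' J : {J : Set Ω // J ∈ F.nonLargest star ∧ J ⊆ I}, P J.1 := by
  rw [F.tsum_measure_inter_nonLargestUnion (F.nonLargestAt_subset hI)]
  refine ENNReal.tsum_comp_le_tsum_of_injective
    (f := fun J : (Σ k : ℕ, {J : Set Ω // J ∈ F.nonLargestAt star (n + k) ∧ J ⊆ I}) =>
      (⟨J.2.1, F.mem_nonLargest_iff.2 ⟨_, J.2.2.1⟩, J.2.2.2⟩ :
        {J : Set Ω // J ∈ F.nonLargest star ∧ J ⊆ I})) ?_ (fun J => P J.1)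
  rintro ⟨k, J, hJ, hJI⟩ ⟨k', J', hJ', hJI'⟩ h
  obtain rfl : J = J' := congrArg Subtype.val h
  have := F.level_unique hstar hJ hJ'
  obtain rfl : k = k' := by omega
  rfl

variable [IsProbabilityMeasure P]

lemma tsum_le_carlesonConstant_mul (hI : I ∈ F.nonLargestAt star n) :
    ∑' k, P (I ∩ F.nonLargestUnion star (n + k)) ≤
      carlesonConstant P (F.nonLargest star) * P I := by
  have h0 := (F.measure_atoms_pos n I (F.nonLargestAt_subset hI)).ne'
  refine (F.le_tsum_nonLargest hstar hI).trans ?_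
  rw [mul_comm, ← ENNReal.inv_mul_le_iff h0 (measure_ne_top P I)]
  exact le_iSup₂ (f := fun I (_ : I ∈ F.nonLargest star) => (P I)⁻¹ *
    ∑' J : {J : Set Ω // J ∈ F.nonLargest star ∧ J ⊆ I}, P J.1) I (F.mem_nonLargest_iff.2 ⟨n, hI⟩)

/-- Extends the Carleson bound from members of the collection to all atoms. The nonlargest children
are members themselves; the selected child contributes nothing at level `n + 1`, so the induction
continues in it with one level fewer. Truncating to `L` levels is what makes this induction
terminate. -/
lemma sum_le_carlesonConstant_mul (L : ℕ) (hI : I ∈ F.atoms n) :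
    ∑ k ∈ Finset.range L, P (I ∩ F.nonLargestUnion star (n + 1 + k)) ≤
      carlesonConstant P (F.nonLargest star) * P I := by
  induction L generalizing n I with
  | zero => simp
  | succ L ih =>
    simp only [F.measure_inter_eq_tsum_children hI]
    rw [F.measure_eq_tsum_children hI, ← ENNReal.tsum_mul_left,
      ← Summable.tsum_finsetSum fun _ _ => ENNReal.summable]
    refine ENNReal.tsum_le_tsum fun B => ?_
    by_cases hB : B.1 = star n I
    · rw [Finset.sum_range_succ', add_zero, hB, F.star_inter_nonLargestUnion hstar hI,
        measure_empty, add_zero, ← hB]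
      simpa only [Nat.add_assoc, Nat.add_comm 1] using ih B.2.1
    · exact (ENNReal.sum_le_tsum _).trans
        (F.tsum_le_carlesonConstant_mul hstar (F.mem_nonLargestAt_of_ne hI B.2 hB))

omit hstar [IsProbabilityMeasure P]

variable (star) in
/-- The total measure of the members of `nonLargest` that are proper descendants of the atom `I`
of level `n`. -/
noncomputable def descendantMass (n : ℕ) (I : Set Ω) : ℝ≥0∞ :=
  ∑' k, P (I ∩ F.nonLargestUnion star (n + 1 + k))

include hstar

lemma descendantMass_le [IsProbabilityMeasure P] (hI : I ∈ F.atoms n) : F.descendantMass star n I ≤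
    carlesonConstant P (F.nonLargest star) * P I :=
  ENNReal.tsum_le_of_sum_range_le fun L => F.sum_le_carlesonConstant_mul hstar L hI

lemma measure_inter_nonLargestUnion_succ (hI : I ∈ F.atoms n) :
    P (I ∩ F.nonLargestUnion star (n + 1)) = P (I \ star n I) := by
  congr 1
  ext ω
  constructor
  · rintro ⟨h1, h2⟩
    refine ⟨h1, fun h => ?_⟩
    have := F.star_inter_nonLargestUnion hstar hI
    exact (this ▸ ⟨h, h2⟩ : ω ∈ (∅ : Set Ω))
  · rintro ⟨h1, h2⟩
    refine ⟨h1, F.atomAt (n + 1) ω, F.mem_nonLargestAt_of_ne hI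
      (F.atomAt_succ_mem_children hI h1) fun h => h2 ?_, F.mem_atomAt _ _⟩
    rw [← h]
    exact F.mem_atomAt _ _

lemma descendantMass_eq (hI : I ∈ F.atoms n) : F.descendantMass star n I =
    P (I \ star n I) + ∑' B : F.children n I, F.descendantMass star (n + 1) B.1 := by
  rw [descendantMass, tsum_eq_zero_add' ENNReal.summable, add_zero,
    F.measure_inter_nonLargestUnion_succ hstar hI]
  congr 1
  simp only [F.measure_inter_eq_tsum_children hI, descendantMass]
  rw [ENNReal.tsum_comm]
  simp only [Nat.add_assoc, Nat.add_comm 1]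

end NonLargest

end AtomicFiltration

/-! ### Elementary inequalities for `p`-th powers -/

section RealInequalities

open Real

/-- Convexity of `t ^ p` with weights `1 / (1 + cu)` and `cu / (1 + cu)`. The first coefficient is
`(1 + cu) ^ (p - 1)`, at most `1 + cu` because `p ≤ 2`. -/
lemma add_rpow_le_of_weight {p c u s d : ℝ} (hp1 : 1 < p) (hp2 : p ≤ 2) (hc : 0 < c) (hc1 : c ≤ 1)
    (hu : 0 < u) (hu1 : u ≤ 1) (hs : 0 ≤ s) (hd : 0 ≤ d) :
    (s + d) ^ p ≤ (1 + c * u) * s ^ p + 2 / c * u ^ (1 - p) * d ^ p := by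
  have hcu : 0 < c * u := by positivity
  have hcu1 : c * u ≤ 1 := mul_le_one₀ hc1 hu.le hu1
  have h1 : 0 < 1 + c * u := by positivity
  have hx : (1 + c * u) * s ∈ Set.Ici (0 : ℝ) := Set.mem_Ici.2 (by positivity)
  have hy : (1 + c * u) / (c * u) * d ∈ Set.Ici (0 : ℝ) := Set.mem_Ici.2 (by positivity)
  have hα : 0 ≤ 1 / (1 + c * u) := by positivity
  have hβ : 0 ≤ c * u / (1 + c * u) := by positivity
  have hconv := (convexOn_rpow hp1.le).2 hx hy hα hβ (by field_simp)
  simp only [smul_eq_mul] at hconv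
  have e1 : 1 / (1 + c * u) * ((1 + c * u) * s) + c * u / (1 + c * u) * ((1 + c * u) / (c * u) * d)
      = s + d := by field_simp
  rw [e1, mul_rpow h1.le hs, mul_rpow (by positivity) hd] at hconv
  refine hconv.trans (add_le_add ?_ ?_)
  · rw [← mul_assoc]
    gcongr
    rw [one_div, inv_mul_le_iff₀ h1, ← sq, ← rpow_two]
    exact rpow_le_rpow_of_exponent_le (by linarith) hp2
  · rw [← mul_assoc]
    refine mul_le_mul_of_nonneg_right ?_ (by positivity)
    have e2 : c * u / (1 + c * u) * ((1 + c * u) / (c * u)) ^ p =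
        ((1 + c * u) / (c * u)) ^ (p - 1) := by
      rw [rpow_sub_one (by positivity)]
      field_simp
    rw [e2]
    calc ((1 + c * u) / (c * u)) ^ (p - 1) ≤ (2 / c * u⁻¹) ^ (p - 1) := by
          apply rpow_le_rpow (by positivity) _ (by linarith)
          rw [div_mul_eq_div_div, div_mul_eq_mul_div, mul_comm, ← div_eq_mul_inv] 
          rw [div_div, div_div, mul_comm u c]
          gcongr
          · linarith
      _ = (2 / c) ^ (p - 1) * u ^ (1 - p) := by
          rw [mul_rpow (by positivity) (by positivity), inv_rpow hu.le, ← rpow_neg hu.le, neg_sub]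
      _ ≤ 2 / c * u ^ (1 - p) := by
          gcongr
          calc (2 / c) ^ (p - 1) ≤ (2 / c) ^ (1 : ℝ) :=
                rpow_le_rpow_of_exponent_le (by rw [le_div_iff₀ hc]; linarith) (by linarith)
            _ = 2 / c := rpow_one _

/-- To be used with `a = P A*`, `b = P (A \ A*)`, `y` the size of the increment on `A*` and `D` its
`p`-th moment over `A`. The point is that the extra multiple of `s ^ p` carries the factor `b`, not
`a`. -/
lemma mul_add_rpow_le {p c a b s y D : ℝ} (hp1 : 1 < p) (hp2 : p ≤ 2) (hc : 0 < c) (hc1 : c ≤ 1)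
    (ha : 0 < a) (hb : 0 ≤ b) (hs : 0 ≤ s) (hy : 0 ≤ y) (hD : 0 ≤ D)
    (h1 : (a * y) ^ p ≤ D * b ^ (p - 1)) (h2 : a * y ^ p ≤ D) :
    a * (s + y) ^ p ≤ a * s ^ p + c * b * s ^ p + 4 / c * D := by
  rcases hb.eq_or_lt with rfl | hb
  · rw [zero_rpow (by linarith), mul_zero] at h1
    have h3 : a * y = 0 := by
      by_contra h
      exact absurd h1 (not_le.2 (rpow_pos_of_pos (lt_of_le_of_ne (by positivity) (Ne.symm h)) p))
    have hy0 : y = 0 := by simpa [ha.ne'] using h3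
    have : 0 ≤ 4 / c * D := by positivity
    simp only [hy0, add_zero]
    linarith
  have hab : 0 < a + b := by positivity
  -- This choice makes `a * u ≤ b`, so the loss is proportional to `b`; the price `u ^ (1 - p)` is
  -- absorbed by `h1` when `b ≤ a` and is at most 2 when `a ≤ b`, where `h2` suffices.
  set u := b / (a + b) with hu
  have hu0 : 0 < u := by positivity
  have hu1 : u ≤ 1 := by rw [hu, div_le_one hab]; linarith
  have hmain := add_rpow_le_of_weight hp1 hp2 hc hc1 hu0 hu1 hs hy
  have h2p : (2 : ℝ) ^ (p - 1) ≤ 2 := by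
    calc (2 : ℝ) ^ (p - 1) ≤ 2 ^ (1 : ℝ) :=
          rpow_le_rpow_of_exponent_le (by norm_num) (by linarith)
      _ = 2 := rpow_one _
  have hkey : a * (u ^ (1 - p) * y ^ p) ≤ 2 * D := by
    rcases le_total b a with hba | hba
    · have e : a * (u ^ (1 - p) * y ^ p) =
          (a * y) ^ p * b ^ (1 - p) * ((a + b) / a) ^ (p - 1) := by
        rw [hu, div_rpow hb.le hab.le, div_rpow hab.le ha.le, mul_rpow ha.le hy,
          rpow_sub_one ha.ne', show 1 - p = -(p - 1) by ring, rpow_neg hab.le]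
        field_simp
      rw [e]
      calc (a * y) ^ p * b ^ (1 - p) * ((a + b) / a) ^ (p - 1)
          ≤ D * b ^ (p - 1) * b ^ (1 - p) * 2 ^ (p - 1) := by
            gcongr
            rw [div_le_iff₀ ha]; linarith
        _ = D * 2 ^ (p - 1) := by
            rw [mul_assoc D, ← rpow_add hb]; simp
        _ ≤ 2 * D := by nlinarith
    · have : u ^ (1 - p) ≤ 2 := by
        calc u ^ (1 - p) ≤ (1 / 2) ^ (1 - p) :=
              rpow_le_rpow_of_nonpos (by norm_num)
                (by rw [hu, div_le_div_iff₀ (by norm_num) hab]; linarith) (by linarith)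
          _ = 2 ^ (p - 1) := by
              rw [one_div, inv_rpow (by norm_num), ← rpow_neg (by norm_num), neg_sub]
          _ ≤ 2 := h2p
      calc a * (u ^ (1 - p) * y ^ p) ≤ a * (2 * y ^ p) := by gcongr
        _ ≤ 2 * D := by linarith
  have hau : a * u ≤ b := by
    rw [hu, mul_div_assoc', div_le_iff₀ hab]; nlinarith
  calc a * (s + y) ^ p ≤ a * ((1 + c * u) * s ^ p + 2 / c * u ^ (1 - p) * y ^ p) := by gcongr
    _ = a * s ^ p + c * (a * u) * s ^ p + 2 / c * (a * (u ^ (1 - p) * y ^ p)) := by ring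
    _ ≤ a * s ^ p + c * b * s ^ p + 2 / c * (2 * D) := by gcongr
    _ = _ := by ring

end RealInequalities

lemma enorm_rpow_eq_ofReal {X : Type*} [NormedAddCommGroup X] (x : X) {p : ℝ} (hp : 0 ≤ p) :
    ‖x‖ₑ ^ p = ENNReal.ofReal (‖x‖ ^ p) := by
  rw [← ofReal_norm, ENNReal.ofReal_rpow_of_nonneg (norm_nonneg x) hp]

lemma enorm_add_rpow_le {X : Type*} [NormedAddCommGroup X] {p : ℝ} (hp1 : 1 < p) (hp2 : p ≤ 2)
    {c : ℝ≥0} (hc : 0 < c) (hc1 : c ≤ 1) (x y : X) :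
    ‖x + y‖ₑ ^ p ≤ (1 + c) * ‖x‖ₑ ^ p + (2 / c : ℝ≥0) * ‖y‖ₑ ^ p := by
  have hp0 : 0 ≤ p := by linarith
  have h := add_rpow_le_of_weight hp1 hp2 (c := c) (by exact_mod_cast hc) (by exact_mod_cast hc1)
    one_pos le_rfl (norm_nonneg x) (norm_nonneg y)
  rw [mul_one, Real.one_rpow, mul_one] at h
  have h2 : ‖x + y‖ ^ p ≤ (1 + c) * ‖x‖ ^ p + 2 / c * ‖y‖ ^ p :=
    (Real.rpow_le_rpow (norm_nonneg _) (norm_add_le x y) hp0).trans h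
  have h3 := ENNReal.ofReal_le_ofReal h2
  rw [ENNReal.ofReal_add (by positivity) (by positivity), ENNReal.ofReal_mul (by positivity),
    ENNReal.ofReal_mul (by positivity)] at h3
  simp only [enorm_rpow_eq_ofReal _ hp0]
  convert h3 using 4
  · rw [ENNReal.ofReal_add zero_le_one (NNReal.coe_nonneg c), ENNReal.ofReal_one,
      ENNReal.ofReal_coe_nnreal]
  · rw [← ENNReal.ofReal_coe_nnreal]
    simp

/-- Hölder's inequality against the constant function. -/
lemma lintegral_rpow_le_mul_measure_univ {α : Type*} [MeasurableSpace α] (μ : Measure α) {p : ℝ}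
    (hp : 1 < p) {h : α → ℝ≥0∞} (hh : AEMeasurable h μ) :
    (∫⁻ x, h x ∂μ) ^ p ≤ (∫⁻ x, h x ^ p ∂μ) * μ Set.univ ^ (p - 1) := by
  have hp0 : 0 < p := by linarith
  have hq := Real.HolderConjugate.conjExponent hp
  have h1 := ENNReal.lintegral_mul_le_Lp_mul_Lq μ hq hh (aemeasurable_const (b := (1 : ℝ≥0∞)))
  simp only [Pi.mul_apply, mul_one, ENNReal.one_rpow, lintegral_one] at h1
  refine (ENNReal.rpow_le_rpow h1 hp0.le).trans_eq ?_
  rw [ENNReal.mul_rpow_of_nonneg _ _ hp0.le, ← ENNReal.rpow_mul, ← ENNReal.rpow_mul, one_div,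
    inv_mul_cancel₀ hp0.ne', ENNReal.rpow_one]
  congr 2
  rw [Real.conjExponent]
  field_simp

/-! ### Finite Carleson constant: the weighted potential -/

namespace AtomicFiltration

variable {Ω : Type*} [m : MeasurableSpace Ω] {P : Measure Ω} [IsProbabilityMeasure P]
  (F : AtomicFiltration P) {star : ℕ → Set Ω → Set Ω} {X : Type*} [NormedAddCommGroup X]
  [NormedSpace ℝ X] {n : ℕ} {A : Set Ω}

/-- The value on one child `S` of an atom `A`, in terms of the average over `A` and the `p`-th
moment of the deviation from it. -/
lemma measure_mul_enorm_rpow_le [CompleteSpace X] {p : ℝ} (hp1 : 1 < p) (hp2 : p ≤ 2)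
    {c : ℝ≥0} (hc : 0 < c) (hc1 : c ≤ 1) {A S : Set Ω}
    (hS : MeasurableSet S) (hSA : S ⊆ A) (hSpos : 0 < P S) {g : Ω → X}
    (hg : Integrable g P) {z : X} (hz : ∀ ω ∈ S, g ω = z) :
    P S * ‖z‖ₑ ^ p ≤ P S * ‖⨍ ω in A, g ω ∂P‖ₑ ^ p + c * P (A \ S) * ‖⨍ ω in A, g ω ∂P‖ₑ ^ p +
      (4 / c : ℝ≥0) * ∫⁻ ω in A, ‖g ω - ⨍ ω in A, g ω ∂P‖ₑ ^ p ∂P := by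
  have hp0 : 0 < p := by linarith
  set x := ⨍ ω in A, g ω ∂P with hx
  set D := ∫⁻ ω in A, ‖g ω - x‖ₑ ^ p ∂P with hD
  by_cases hDtop : D = ∞
  · rw [hDtop, ENNReal.mul_top (by simpa using hc.ne')]
    simp
  have hPA : P A ≠ 0 := (hSpos.trans_le (measure_mono hSA)).ne'
  have hfint : Integrable (fun ω => g ω - x) P := hg.sub (integrable_const x)
  have hzero : ∫ ω in A, (g ω - x) ∂P = 0 := by
    rw [integral_sub hg.integrableOn (integrable_const x).integrableOn, setIntegral_const, hx,
      setAverage_eq, smul_smul, mul_inv_cancel₀, one_smul, sub_self]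
    exact (ENNReal.toReal_pos hPA (measure_ne_top _ _)).ne'
  -- Mean zero moves the deviation on `S` to its complement in `A`, where Hölder's inequality gains
  -- the factor `P (A \ S) ^ (p - 1)`.
  have hsplit : ∫ ω in S, (g ω - x) ∂P = -∫ ω in A \ S, (g ω - x) ∂P := by
    rw [setIntegral_sdiff hS hfint.integrableOn hSA, hzero, zero_sub, neg_neg]
  have hSval : ∫ ω in S, (g ω - x) ∂P = P.real S • (z - x) := by
    rw [setIntegral_congr_fun (g := fun _ => z - x) hS fun ω hω => by simp only [hz ω hω],
      setIntegral_const]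
  have hay : P S * ‖z - x‖ₑ ≤ ∫⁻ ω in A \ S, ‖g ω - x‖ₑ ∂P := by
    have h1 : ‖P.real S • (z - x)‖ₑ = P S * ‖z - x‖ₑ := by
      rw [enorm_smul, Real.enorm_eq_ofReal measureReal_nonneg, ofReal_measureReal]
    rw [← h1, ← hSval, hsplit, enorm_neg]
    exact enorm_integral_le_lintegral_enorm _
  have h1 : (P S * ‖z - x‖ₑ) ^ p ≤ D * P (A \ S) ^ (p - 1) := by
    refine (ENNReal.rpow_le_rpow hay hp0.le).trans ?_
    refine (lintegral_rpow_le_mul_measure_univ _ hp1 hfint.aestronglyMeasurable.enorm.restrict).trans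
      ?_
    rw [Measure.restrict_apply_univ]
    gcongr
    exact lintegral_mono_set Set.sdiff_subset
  have h2 : P S * ‖z - x‖ₑ ^ p ≤ D := by
    have : ∫⁻ ω in S, ‖g ω - x‖ₑ ^ p ∂P = P S * ‖z - x‖ₑ ^ p := by
      rw [setLIntegral_congr_fun (g := fun _ => ‖z - x‖ₑ ^ p) hS fun ω hω => by
        simp only [hz ω hω], setLIntegral_const, mul_comm]
    rw [← this]
    exact lintegral_mono_set hSA
  have hr1 := ENNReal.toReal_mono (ENNReal.mul_ne_top hDtop
    (ENNReal.rpow_ne_top_of_nonneg (by linarith) (measure_ne_top P _))) h1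
  have hr2 := ENNReal.toReal_mono hDtop h2
  simp only [ENNReal.toReal_mul, ← ENNReal.toReal_rpow, toReal_enorm] at hr1 hr2
  have hmain := mul_add_rpow_le hp1 hp2 (c := c) (by exact_mod_cast hc) (by exact_mod_cast hc1)
    (ENNReal.toReal_pos hSpos.ne' (measure_ne_top P S)) ENNReal.toReal_nonneg (norm_nonneg x)
    (norm_nonneg _) ENNReal.toReal_nonneg hr1 hr2
  have hzx : ‖z‖ ^ p ≤ (‖x‖ + ‖z - x‖) ^ p := by
    refine Real.rpow_le_rpow (norm_nonneg _) ?_ hp0.le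
    simpa using norm_add_le x (z - x)
  have hfin := ENNReal.ofReal_le_ofReal
    ((mul_le_mul_of_nonneg_left hzx ENNReal.toReal_nonneg).trans hmain)
  rw [ENNReal.ofReal_add (by positivity) (by positivity),
    ENNReal.ofReal_add (by positivity) (by positivity), ENNReal.ofReal_mul (by positivity),
    ENNReal.ofReal_mul (by positivity), ENNReal.ofReal_mul (by positivity),
    ENNReal.ofReal_mul (by positivity), ENNReal.ofReal_mul (by positivity),
    ENNReal.ofReal_toReal hDtop, ENNReal.ofReal_toReal (measure_ne_top P _),
    ENNReal.ofReal_toReal (measure_ne_top P _), ENNReal.ofReal_coe_nnreal,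
    ← enorm_rpow_eq_ofReal _ hp0.le, ← enorm_rpow_eq_ofReal _ hp0.le] at hfin
  convert hfin using 3
  rw [← ENNReal.ofReal_coe_nnreal]
  simp

variable (star) in
/-- The weight of an atom: an affine function of its relative mass of nonlargest descendants. -/
noncomputable def weight (c : ℝ≥0) (n : ℕ) (A : Set Ω) : ℝ≥0∞ :=
  1 + 4 * c * ((P A)⁻¹ * F.descendantMass star n A)

lemma measure_mul_weight (c : ℝ≥0) (hA : A ∈ F.atoms n) :
    P A * F.weight star c n A = P A + 4 * c * F.descendantMass star n A := by
  rw [weight, mul_add, mul_one, mul_left_comm, ← mul_assoc (P A),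
    ENNReal.mul_inv_cancel (F.measure_atoms_pos n A hA).ne' (measure_ne_top P A), one_mul]

variable (hstar : F.IsLargestChildSelection star)
include hstar

lemma weight_le_two {c : ℝ≥0} (hc : 4 * c * carlesonConstant P (F.nonLargest star) ≤ 1)
    (hA : A ∈ F.atoms n) : F.weight star c n A ≤ 2 := by
  rw [weight, ← one_add_one_eq_two]
  gcongr
  refine le_trans ?_ hc
  gcongr
  rw [ENNReal.inv_mul_le_iff (F.measure_atoms_pos n A hA).ne' (measure_ne_top P A), mul_comm]
  exact F.descendantMass_le hstar hA

/-- The proper descendants of `A` that are not proper descendants of one of its children are its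
nonlargest children, of total mass `P (A \ star n A)`. This exact drop in weight is the budget for
the errors in the one-step inequality. -/
lemma setLIntegral_weight (c : ℝ≥0) (hA : A ∈ F.atoms n) :
    (∫⁻ ω in A, F.weight star c (n + 1) (F.atomAt (n + 1) ω) ∂P) + 4 * c * P (A \ star n A) =
      P A * F.weight star c n A := by
  have h : ∀ B : F.children n A,
      ∫⁻ ω in B.1, F.weight star c (n + 1) (F.atomAt (n + 1) ω) ∂P =
        P B.1 + 4 * c * F.descendantMass star (n + 1) B.1 := by
    intro B
    rw [← F.measure_mul_weight c B.2.1, setLIntegral_congr_fun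
      (g := fun _ => F.weight star c (n + 1) B.1) (F.measurableSet_of_mem_atoms B.2.1)
      fun ω hω => by simp only [F.atomAt_eq B.2.1 hω], setLIntegral_const, mul_comm]
  rw [F.setLIntegral_eq_tsum_children hA, F.measure_mul_weight c hA, F.descendantMass_eq hstar hA,
    tsum_congr h, ENNReal.tsum_add, ENNReal.tsum_mul_left, ← F.measure_eq_tsum_children hA]
  ring

/-- If the collection of nonlargest children satisfies the Carleson condition, then the upper
`ℓ^p` estimate holds with one constant for all Banach spaces. -/
theorem estimateForAll_of_carlesonConstant_lt_top {p : ℝ} (hp1 : 1 < p) (hp2 : p ≤ 2)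
    (hfin : carlesonConstant P (F.nonLargest star) < ∞) : EstimateForAll F p := by
  have hp0 : 0 < p := by linarith
  set Λ : ℝ≥0 := (carlesonConstant P (F.nonLargest star)).toNNReal with hΛ
  have hΛ' : carlesonConstant P (F.nonLargest star) = Λ := (ENNReal.coe_toNNReal hfin.ne).symm
  -- Small enough that `4 * c * Λ ≤ 1`, which keeps all weights between 1 and 2.
  set c : ℝ≥0 := 1 / (4 * (Λ + 1)) with hc
  have hc0 : 0 < c := by positivity
  have hc1 : c ≤ 1 := by
    rw [hc, div_le_one (by positivity)]
    calc (1 : ℝ≥0) ≤ 4 * 1 := by norm_num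
      _ ≤ 4 * (Λ + 1) := by gcongr; exact le_add_self
  have hcΛ : 4 * c * carlesonConstant P (F.nonLargest star) ≤ 1 := by
    rw [hΛ']
    norm_cast
    rw [hc, mul_one_div, div_mul_eq_mul_div, div_le_one (by positivity)]
    gcongr
    exact le_self_add
  have hK0 : 0 < 12 / c := by positivity
  refine ⟨(12 / c) ^ (1 / p), by positivity, fun X _ _ _ => ?_⟩
  refine F.upperEstimate_of_potential hp1 (fun n A x => F.weight star c n A * ‖x‖ₑ ^ p) ?_ ?_ ?_
  · intro n A hA x
    exact le_mul_of_one_le_left' le_self_add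
  · intro x
    gcongr
    refine (F.weight_le_two hstar hcΛ F.univ_mem_atoms_zero).trans ?_
    norm_cast
    rw [le_div_iff₀ hc0]
    calc 2 * c ≤ 2 * 1 := by gcongr
      _ ≤ 12 := by norm_num
  · intro n A hA g hg hgm
    have hgi := integrable_of_memLp hp1 hg
    have hS := (hstar n A hA).1
    have hSm := F.measurableSet_of_mem_atoms hS.1
    set S := star n A
    obtain ⟨ω₀, hω₀⟩ := F.nonempty_of_mem_atoms hS.1
    have hgS : ∀ ω ∈ S, g ω = g ω₀ := fun ω hω => F.eq_of_stronglyMeasurable hgm hS.1 hω₀ hω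
    have hstarineq := measure_mul_enorm_rpow_le (X := X) (P := P) hp1 hp2 hc0 hc1 hSm hS.2
      (F.measure_atoms_pos _ _ hS.1) hgi hgS
    have hwt := F.setLIntegral_weight hstar c hA
    set x := ⨍ ω in A, g ω ∂P
    set D := ∫⁻ ω in A, ‖g ω - x‖ₑ ^ p ∂P
    set wt : Ω → ℝ≥0∞ := fun ω => F.weight star c (n + 1) (F.atomAt (n + 1) ω) with hwtdef
    have hwt2 : ∀ ω, wt ω ≤ 2 := fun ω => F.weight_le_two hstar hcΛ (F.atomAt_mem _ _)
    have hxtop : ‖x‖ₑ ^ p ≠ ∞ := ENNReal.rpow_ne_top_of_nonneg hp0.le enorm_ne_top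
    have hmeas : Measurable fun ω => ‖g ω - x‖ₑ ^ p :=
      (((hgm.mono (F.le' _)).sub stronglyMeasurable_const).enorm).pow_const p
    have hdiff : ∫⁻ ω in A \ S, wt ω * ‖g ω‖ₑ ^ p ∂P ≤
        (∫⁻ ω in A \ S, wt ω ∂P) * ‖x‖ₑ ^ p + (2 * c * ‖x‖ₑ ^ p * P (A \ S) +
          (4 / c : ℝ≥0) * D) := by
      calc ∫⁻ ω in A \ S, wt ω * ‖g ω‖ₑ ^ p ∂P
          ≤ ∫⁻ ω in A \ S, (wt ω * ‖x‖ₑ ^ p + (2 * c * ‖x‖ₑ ^ p +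
              (4 / c : ℝ≥0) * ‖g ω - x‖ₑ ^ p)) ∂P := by
            refine lintegral_mono fun ω => ?_
            have h := enorm_add_rpow_le hp1 hp2 hc0 hc1 x (g ω - x)
            rw [add_sub_cancel] at h
            calc wt ω * ‖g ω‖ₑ ^ p
                ≤ wt ω * ((1 + c) * ‖x‖ₑ ^ p + (2 / c : ℝ≥0) * ‖g ω - x‖ₑ ^ p) := by gcongr
              _ = wt ω * ‖x‖ₑ ^ p + (wt ω * (c * ‖x‖ₑ ^ p) +
                  wt ω * ((2 / c : ℝ≥0) * ‖g ω - x‖ₑ ^ p)) := by ring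
              _ ≤ wt ω * ‖x‖ₑ ^ p + (2 * (c * ‖x‖ₑ ^ p) +
                  2 * ((2 / c : ℝ≥0) * ‖g ω - x‖ₑ ^ p)) := by
                  gcongr <;> exact hwt2 ω
              _ = _ := by
                  rw [← mul_assoc, ← mul_assoc]
                  congr 3
                  norm_cast
                  rw [← mul_div_assoc]; norm_num
        _ = (∫⁻ ω in A \ S, wt ω ∂P) * ‖x‖ₑ ^ p + (2 * c * ‖x‖ₑ ^ p * P (A \ S) +
              (4 / c : ℝ≥0) * ∫⁻ ω in A \ S, ‖g ω - x‖ₑ ^ p ∂P) := by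
            have hm : Measurable fun ω => 2 * c * ‖x‖ₑ ^ p + (4 / c : ℝ≥0) * ‖g ω - x‖ₑ ^ p :=
              measurable_const.add (hmeas.const_mul _)
            rw [lintegral_add_right _ hm,
              lintegral_mul_const' _ _ hxtop, lintegral_add_left measurable_const,
              lintegral_const_mul _ hmeas, setLIntegral_const]
        _ ≤ _ := by
            gcongr
            exact lintegral_mono_set Set.sdiff_subset
    -- The error is charged to `P (A \ S)` although the integral is over `S`. Together with the
    -- equal error in `hdiff` it amounts to `4 * c * ‖x‖ₑ ^ p * P (A \ S)`, exactly the drop in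
    -- `hwt`; the moment terms add up to `12 / c`.
    have hSint : ∫⁻ ω in S, wt ω * ‖g ω‖ₑ ^ p ∂P ≤ (∫⁻ ω in S, wt ω ∂P) * ‖x‖ₑ ^ p +
        (2 * c * ‖x‖ₑ ^ p * P (A \ S) + (8 / c : ℝ≥0) * D) := by
      have hw : ∀ ω ∈ S, wt ω = wt ω₀ := fun ω hω => by
        simp only [hwtdef, F.atomAt_eq hS.1 hω, F.atomAt_eq hS.1 hω₀]
      rw [setLIntegral_congr_fun (g := fun _ => wt ω₀ * ‖g ω₀‖ₑ ^ p) hSm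
        fun ω hω => by simp only [hw ω hω, hgS ω hω], setLIntegral_const,
        setLIntegral_congr_fun (g := fun _ => wt ω₀) hSm hw, setLIntegral_const]
      calc wt ω₀ * ‖g ω₀‖ₑ ^ p * P S = wt ω₀ * (P S * ‖g ω₀‖ₑ ^ p) := by ring
        _ ≤ wt ω₀ * (P S * ‖x‖ₑ ^ p + c * P (A \ S) * ‖x‖ₑ ^ p + (4 / c : ℝ≥0) * D) := by gcongr
        _ = wt ω₀ * P S * ‖x‖ₑ ^ p + (wt ω₀ * (c * P (A \ S) * ‖x‖ₑ ^ p) +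
              wt ω₀ * ((4 / c : ℝ≥0) * D)) := by ring
        _ ≤ wt ω₀ * P S * ‖x‖ₑ ^ p + (2 * (c * P (A \ S) * ‖x‖ₑ ^ p) +
              2 * ((4 / c : ℝ≥0) * D)) := by gcongr <;> exact hwt2 ω₀
        _ = _ := by
            rw [← mul_assoc 2 (↑(4 / c) : ℝ≥0∞)]
            have : (2 : ℝ≥0∞) * (4 / c : ℝ≥0) = (8 / c : ℝ≥0) := by
              norm_cast
              rw [← mul_div_assoc]; norm_num
            rw [this]
            ring
    have hsplit : ∀ h : Ω → ℝ≥0∞, ∫⁻ ω in A, h ω ∂P =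
        ∫⁻ ω in S, h ω ∂P + ∫⁻ ω in A \ S, h ω ∂P := by
      intro h
      rw [← lintegral_inter_add_sdiff h A hSm, Set.inter_eq_right.2 hS.2]
    rw [hsplit]
    refine (add_le_add hSint hdiff).trans_eq ?_
    have h12 : (12 / c : ℝ≥0) = (8 / c : ℝ≥0) + (4 / c : ℝ≥0) := by
      rw [← add_div]; norm_num
    rw [← mul_assoc (P A), ← hwt, hsplit, h12]
    push_cast
    ring

end AtomicFiltration

/-! ### Exits and the existence of rich atoms -/

namespace AtomicFiltration

variable {Ω : Type*} [m : MeasurableSpace Ω] {P : Measure Ω} (F : AtomicFiltration P)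
  (star : ℕ → Set Ω → Set Ω)

/-- The exits of an atom `A` of level `n`, as pairs of a level and an atom of that level: the
nonlargest children of the members of the chain `A`, `A*`, `A**`, ... of selected children. -/
inductive IsExit : ℕ → Set Ω → ℕ × Set Ω → Prop
  | child {n : ℕ} {A B : Set Ω} (hB : B ∈ F.children n A) (hne : B ≠ star n A) :
      IsExit n A (n + 1, B)
  | later {n : ℕ} {A : Set Ω} {e : ℕ × Set Ω} (he : IsExit (n + 1) (star n A) e) : IsExit n A e

/-- The measure of the `i`-th generation of exits of an atom. -/
noncomputable def exitMass : ℕ → ℕ → Set Ω → ℝ≥0∞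
  | 0, _, A => P A
  | i + 1, n, A => ∑' e : {e : ℕ × Set Ω // F.IsExit star n A e}, exitMass i e.1.1 e.1.2

/-- An atom is rich of depth `N` if exits that are rich of depth `N - 1` fill it up to the
proportion `θ`. -/
def IsRich (θ : ℝ≥0) : ℕ → ℕ → Set Ω → Prop
  | 0, _, _ => True
  | N + 1, n, A => ∃ T : Finset (ℕ × Set Ω),
      (∀ e ∈ T, F.IsExit star n A e ∧ IsRich θ N e.1 e.2) ∧ θ * P A ≤ ∑ e ∈ T, P e.2

variable {F star} {n : ℕ} {A B : Set Ω} {e e' : ℕ × Set Ω}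

lemma isExit_iff : F.IsExit star n A e ↔
    (∃ B ∈ F.children n A, B ≠ star n A ∧ e = (n + 1, B)) ∨ F.IsExit star (n + 1) (star n A) e := by
  constructor
  · rintro (⟨hB, hne⟩ | he)
    · exact Or.inl ⟨_, hB, hne, rfl⟩
    · exact Or.inr he
  · rintro (⟨B, hB, hne, rfl⟩ | he)
    · exact .child hB hne
    · exact .later he

lemma IsExit.mem_atoms (he : F.IsExit star n A e) : e.2 ∈ F.atoms e.1 := by
  induction he with
  | child hB _ => exact hB.1
  | later _ ih => exact ih

lemma IsExit.lt_level (he : F.IsExit star n A e) : n < e.1 := by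
  induction he with
  | child _ _ => exact Nat.lt_succ_self _
  | later _ ih => exact (Nat.lt_succ_self _).trans ih

/-- Leaving the chain through a nonlargest child uses up one generation, whereas moving on to the
selected child uses up none. -/
lemma exitMass_succ_eq (i n : ℕ) (A : Set Ω) : F.exitMass star (i + 1) n A =
    ∑' B : {B : Set Ω // B ∈ F.children n A ∧ B ≠ star n A}, F.exitMass star i (n + 1) B.1 +
      F.exitMass star (i + 1) (n + 1) (star n A) := by
  have h : {e | F.IsExit star n A e} =
      (fun B => (n + 1, B)) '' {B | B ∈ F.children n A ∧ B ≠ star n A} ∪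
        {e | F.IsExit star (n + 1) (star n A) e} := by
    ext e
    constructor
    · intro he
      rcases isExit_iff.1 he with ⟨B, hB, hne, rfl⟩ | h
      · exact Or.inl ⟨B, ⟨hB, hne⟩, rfl⟩
      · exact Or.inr h
    · rintro (⟨B, ⟨hB, hne⟩, rfl⟩ | h)
      · exact .child hB hne
      · exact .later h
  have hd : Disjoint ((fun B => (n + 1, B)) '' {B | B ∈ F.children n A ∧ B ≠ star n A})
        {e | F.IsExit star (n + 1) (star n A) e} := by
    rw [Set.disjoint_left]
    rintro _ ⟨B, _, rfl⟩ he
    exact absurd he.lt_level (lt_irrefl _)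
  change ∑' e : {e | F.IsExit star n A e}, (fun e : ℕ × Set Ω => F.exitMass star i e.1 e.2) e.1 = _
  rw [h, ENNReal.summable.tsum_union_disjoint
    (f := fun e : ℕ × Set Ω => F.exitMass star i e.1 e.2) hd ENNReal.summable]
  congr 1
  rw [tsum_image (fun e : ℕ × Set Ω => F.exitMass star i e.1 e.2)
    (Function.Injective.injOn fun B C h => (Prod.ext_iff.1 h).2)]
  rfl

section Star

variable (hstar : F.IsLargestChildSelection star)
include hstar

lemma IsExit.subset (he : F.IsExit star n A e) (hA : A ∈ F.atoms n) : e.2 ⊆ A := by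
  induction he with
  | child hB _ => exact hB.2
  | later _ ih =>
    have hs := (hstar _ _ hA).1
    exact (ih hs.1).trans hs.2

lemma IsExit.disjoint (he : F.IsExit star n A e) (he' : F.IsExit star n A e') (hA : A ∈ F.atoms n)
    (hne : e ≠ e') : Disjoint e.2 e'.2 := by
  have aux : ∀ {n A B e}, A ∈ F.atoms n → B ∈ F.children n A → B ≠ star n A →
      F.IsExit star (n + 1) (star n A) e → Disjoint B e.2 := by
    intro n A B e hA hB hne he
    have hs := (hstar n A hA).1
    exact (F.pairwiseDisjoint_atoms (n + 1) hB.1 hs.1 hne).mono_right (he.subset hstar hs.1)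
  induction he with
  | @child n A B hB hB' =>
    rcases isExit_iff.1 he' with ⟨C, hC, _, rfl⟩ | h
    · exact F.pairwiseDisjoint_atoms (n + 1) hB.1 hC.1 fun h => hne (by rw [h])
    · exact aux hA hB hB' h
  | @later n A e he ih =>
    rcases isExit_iff.1 he' with ⟨C, hC, hC', rfl⟩ | h
    · exact (aux hA hC hC' he).symm
    · exact ih h (hstar n A hA).1.1 hne

lemma tsum_children_eq (hA : A ∈ F.atoms n) (g : Set Ω → ℝ≥0∞) :
    ∑' B : F.children n A, g B.1 =
      ∑' B : {B : Set Ω // B ∈ F.children n A ∧ B ≠ star n A}, g B.1 + g (star n A) := by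
  have h : F.children n A = {B | B ∈ F.children n A ∧ B ≠ star n A} ∪ {star n A} := by
    ext B
    constructor
    · intro hB
      by_cases h : B = star n A
      · exact Or.inr h
      · exact Or.inl ⟨hB, h⟩
    · rintro (h | h)
      · exact h.1
      · rw [Set.mem_singleton_iff.1 h]; exact (hstar n A hA).1
  conv_lhs => rw [h]
  rw [ENNReal.summable.tsum_union_disjoint (f := g) (Set.disjoint_singleton_right.2 fun h => h.2 rfl)
    ENNReal.summable, tsum_singleton (star n A) g]
  rfl

lemma tsum_exit_le (hA : A ∈ F.atoms n) :
    ∑' e : {e : ℕ × Set Ω // F.IsExit star n A e}, P e.1.2 ≤ P A := by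
  refine (tsum_meas_le_meas_iUnion_of_disjoint P
    (fun e : {e : ℕ × Set Ω // F.IsExit star n A e} =>
      F.measurableSet_of_mem_atoms e.2.mem_atoms)
    fun e e' hne => e.2.disjoint hstar e'.2 hA fun h => hne (Subtype.ext h)).trans
    (measure_mono (Set.iUnion_subset fun e => e.2.subset hstar hA))

lemma exitMass_le (i : ℕ) (hA : A ∈ F.atoms n) : F.exitMass star i n A ≤ P A := by
  induction i generalizing n A with
  | zero => exact le_rfl
  | succ i ih =>
    exact (ENNReal.tsum_le_tsum fun e => ih e.2.mem_atoms).trans (tsum_exit_le hstar hA)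

/-- Over the exits that are not rich of depth `i` a factor `η` is gained by induction, and the rich
ones fill at most the proportion `θ`. This gives the new factor `η + (1 - η) * θ < 1`. -/
lemma exists_exitMass_le_of_not_isRich {θ : ℝ≥0} (hθ : θ < 1) (i : ℕ) : ∃ η : ℝ≥0, η < 1 ∧
    ∀ n, ∀ A ∈ F.atoms n, ¬ F.IsRich star θ i n A → F.exitMass star i n A ≤ η * P A := by
  classical
  induction i with
  | zero => exact ⟨0, one_pos, fun n A _ h => absurd trivial h⟩
  | succ i ih =>
    obtain ⟨η, hη, h⟩ := ih
    refine ⟨η + (1 - η) * θ, ?_, fun n A hA hnot => ?_⟩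
    · calc η + (1 - η) * θ < η + (1 - η) * 1 := by
            gcongr
            exact tsub_pos_of_lt hη
        _ = 1 := by rw [mul_one, add_tsub_cancel_of_le hη.le]
    have hone : (η : ℝ≥0∞) + (1 - η : ℝ≥0) = 1 := by
      norm_cast
      exact add_tsub_cancel_of_le hη.le
    have hrich : ∑' e : {e : ℕ × Set Ω // F.IsExit star n A e},
        (if F.IsRich star θ i e.1.1 e.1.2 then P e.1.2 else 0) ≤ θ * P A := by
      rw [ENNReal.tsum_eq_iSup_sum]
      refine iSup_le fun s => ?_
      by_contra hlt
      refine hnot ⟨(s.filter fun e => F.IsRich star θ i e.1.1 e.1.2).map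
        (Function.Embedding.subtype _), ?_, ?_⟩
      · intro e he
        simp only [Finset.mem_map, Finset.mem_filter] at he
        obtain ⟨e', ⟨_, h1⟩, rfl⟩ := he
        exact ⟨e'.2, h1⟩
      · rw [Finset.sum_map, Finset.sum_filter]
        exact (not_le.1 hlt).le
    calc F.exitMass star (i + 1) n A
        ≤ ∑' e : {e : ℕ × Set Ω // F.IsExit star n A e}, (η * P e.1.2 + (1 - η : ℝ≥0) *
            (if F.IsRich star θ i e.1.1 e.1.2 then P e.1.2 else 0)) := by
          refine ENNReal.tsum_le_tsum fun e => ?_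
          have hmem := e.2.mem_atoms
          split_ifs with he
          · rw [← add_mul, hone, one_mul]
            exact exitMass_le hstar i hmem
          · rw [mul_zero, add_zero]
            exact h _ _ hmem he
      _ = η * ∑' e : {e : ℕ × Set Ω // F.IsExit star n A e}, P e.1.2 + (1 - η : ℝ≥0) *
            ∑' e : {e : ℕ × Set Ω // F.IsExit star n A e},
              (if F.IsRich star θ i e.1.1 e.1.2 then P e.1.2 else 0) := by
          rw [ENNReal.tsum_add, ENNReal.tsum_mul_left, ENNReal.tsum_mul_left]
      _ ≤ η * P A + (1 - η : ℝ≥0) * (θ * P A) := by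
          gcongr
          exact tsum_exit_le hstar hA
      _ = _ := by push_cast; ring

variable [IsProbabilityMeasure P]

/-- A nonlargest descendant at most `L` levels below `A` lies in one of the first `L` generations of
iterated exits. The induction goes through the children: the generation shifts for a nonlargest
child, and for the selected child its own mass, which is no exit of `A`, is cancelled. -/
lemma measure_add_sum_le_sum_exitMass (L : ℕ) (hA : A ∈ F.atoms n) :
    P A + ∑ k ∈ Finset.range L, P (A ∩ F.nonLargestUnion star (n + 1 + k)) ≤
      ∑ i ∈ Finset.range (L + 1), F.exitMass star i n A := by
  induction L generalizing n A with
  | zero => simp [exitMass]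
  | succ L ih =>
    have hs := (hstar n A hA).1
    have hstep : ∀ B, ∑ k ∈ Finset.range (L + 1), P (B ∩ F.nonLargestUnion star (n + 1 + k)) =
        P (B ∩ F.nonLargestUnion star (n + 1)) +
          ∑ k ∈ Finset.range L, P (B ∩ F.nonLargestUnion star (n + 1 + 1 + k)) := by
      intro B
      rw [Finset.sum_range_succ', add_zero, add_comm]
      simp only [Nat.add_assoc, Nat.add_comm 1]
    rw [Finset.sum_range_succ' _ (L + 1), add_comm]
    refine add_le_add ?_ le_rfl
    calc ∑ k ∈ Finset.range (L + 1), P (A ∩ F.nonLargestUnion star (n + 1 + k))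
        = ∑' B : F.children n A,
            ∑ k ∈ Finset.range (L + 1), P (B.1 ∩ F.nonLargestUnion star (n + 1 + k)) := by
          simp only [F.measure_inter_eq_tsum_children hA]
          rw [Summable.tsum_finsetSum fun _ _ => ENNReal.summable]
      _ = ∑' B : {B : Set Ω // B ∈ F.children n A ∧ B ≠ star n A},
            ∑ k ∈ Finset.range (L + 1), P (B.1 ∩ F.nonLargestUnion star (n + 1 + k)) +
          ∑ k ∈ Finset.range (L + 1), P (star n A ∩ F.nonLargestUnion star (n + 1 + k)) :=
          tsum_children_eq hstar hA fun B =>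
            ∑ k ∈ Finset.range (L + 1), P (B ∩ F.nonLargestUnion star (n + 1 + k))
      _ ≤ ∑' B : {B : Set Ω // B ∈ F.children n A ∧ B ≠ star n A},
            ∑ i ∈ Finset.range (L + 1), F.exitMass star i (n + 1) B.1 +
          ∑ i ∈ Finset.range (L + 1), F.exitMass star (i + 1) (n + 1) (star n A) := by
          refine add_le_add (ENNReal.tsum_le_tsum fun B => ?_) ?_
          · rw [hstep, F.inter_nonLargestUnion_of_mem (F.mem_nonLargestAt_of_ne hA B.2.1 B.2.2)]
            exact ih B.2.1.1
          · rw [hstep, F.star_inter_nonLargestUnion hstar hA, measure_empty, zero_add,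
              Finset.sum_range_succ]
            have h := ih hs.1
            rw [Finset.sum_range_succ', add_comm] at h
            exact (ENNReal.le_of_add_le_add_right (measure_ne_top P (star n A)) h).trans le_self_add
      _ = ∑ i ∈ Finset.range (L + 1), F.exitMass star (i + 1) n A := by
          rw [Summable.tsum_finsetSum fun _ _ => ENNReal.summable, ← Finset.sum_add_distrib]
          exact Finset.sum_congr rfl fun i _ => (exitMass_succ_eq i n A).symm

/-- An infinite Carleson constant forces the existence of rich atoms of every depth. -/
theorem exists_isRich (hinf : carlesonConstant P (F.nonLargest star) = ∞) {θ : ℝ≥0} (hθ : θ < 1)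
    (N : ℕ) : ∃ n, ∃ A ∈ F.atoms n, F.IsRich star θ N n A := by
  by_contra! hnot
  obtain ⟨η, hη, hN⟩ := exists_exitMass_le_of_not_isRich (F := F) hstar hθ N
  -- Without rich atoms, any `N` consecutive generations lose the factor `η`.
  have hshift : ∀ i n, ∀ A ∈ F.atoms n,
      F.exitMass star (i + N) n A ≤ η * F.exitMass star i n A := by
    intro i
    induction i with
    | zero =>
      intro n A hA
      rw [zero_add]
      exact hN n A hA (hnot n A hA)
    | succ i ih =>
      intro n A hA
      rw [Nat.succ_add, exitMass, exitMass, ← ENNReal.tsum_mul_left]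
      exact ENNReal.tsum_le_tsum fun e => ih _ _ e.2.mem_atoms
  have hsum : ∀ L n, ∀ A ∈ F.atoms n,
      ∑ i ∈ Finset.range L, F.exitMass star i n A ≤ (N / (1 - η) : ℝ≥0) * P A := by
    intro L n A hA
    set s := ∑ i ∈ Finset.range L, F.exitMass star i n A with hs
    have hsum_top : s ≠ ∞ := ENNReal.sum_ne_top.2 fun i _ =>
      ((exitMass_le hstar i hA).trans_lt (measure_lt_top P A)).ne
    -- The sum reappears on the right with the factor `η < 1`; it is finite, so it can be absorbed.
    have h1 : s ≤ N * P A + η * s := by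
      calc s ≤ ∑ i ∈ Finset.range (N + L), F.exitMass star i n A :=
            Finset.sum_le_sum_of_subset (Finset.range_mono (Nat.le_add_left L N))
        _ = ∑ i ∈ Finset.range N, F.exitMass star i n A +
            ∑ i ∈ Finset.range L, F.exitMass star (N + i) n A := Finset.sum_range_add _ _ _
        _ ≤ ∑ i ∈ Finset.range N, P A + ∑ i ∈ Finset.range L, η * F.exitMass star i n A := by
            gcongr with i _ i _
            · exact exitMass_le hstar i hA
            · rw [add_comm]; exact hshift i n A hA
        _ = N * P A + η * s := by simp [← Finset.mul_sum, hs]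
    have h2 := ENNReal.toReal_mono (by finiteness) h1
    rw [ENNReal.toReal_add (by finiteness) (by finiteness), ENNReal.toReal_mul,
      ENNReal.toReal_mul, ENNReal.toReal_natCast, ENNReal.coe_toReal] at h2
    have hη' : (0 : ℝ) < 1 - η := sub_pos.2 (by exact_mod_cast hη)
    rw [← ENNReal.toReal_le_toReal hsum_top (by finiteness), ENNReal.toReal_mul, ENNReal.coe_toReal,
      NNReal.coe_div, NNReal.coe_sub hη.le, NNReal.coe_one, div_mul_eq_mul_div, le_div_iff₀ hη']
    push_cast
    linarith
  have hle : carlesonConstant P (F.nonLargest star) ≤ (N / (1 - η) : ℝ≥0) := by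
    refine iSup₂_le fun I hI => ?_
    obtain ⟨n, hIn⟩ := F.mem_nonLargest_iff.1 hI
    have hIa := F.nonLargestAt_subset hIn
    rw [ENNReal.inv_mul_le_iff (F.measure_atoms_pos n I hIa).ne' (measure_ne_top P I), mul_comm]
    refine (F.tsum_nonLargest_le hIn).trans ?_
    rw [tsum_eq_zero_add' ENNReal.summable, add_zero, F.inter_nonLargestUnion_of_mem hIn]
    have : ∀ L, P I + ∑ k ∈ Finset.range L, P (I ∩ F.nonLargestUnion star (n + (k + 1))) ≤
        (N / (1 - η) : ℝ≥0) * P I := by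
      intro L
      have h := (measure_add_sum_le_sum_exitMass hstar L hIa).trans (hsum (L + 1) n I hIa)
      simpa only [Nat.add_assoc, Nat.add_comm 1] using h
    rw [ENNReal.tsum_eq_iSup_nat, ENNReal.add_iSup]
    exact iSup_le this
  rw [hinf] at hle
  exact absurd hle (by simp)

end Star

end AtomicFiltration

/-- Adding terms of size at most `a` one at a time, the first partial sum to reach `a` overshoots by
at most one term. -/
lemma Finset.exists_subset_sum_mem_Icc {ι : Type*} (s : Finset ι) (f : ι → ℝ≥0∞) (a : ℝ≥0∞)
    (hf : ∀ i ∈ s, f i ≤ a) (hs : a ≤ ∑ i ∈ s, f i) :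
    ∃ t ⊆ s, a ≤ ∑ i ∈ t, f i ∧ ∑ i ∈ t, f i ≤ 2 * a := by
  classical
  induction s using Finset.induction_on with
  | empty => exact ⟨∅, subset_rfl, hs, by simp⟩
  | insert i s hi ih =>
    by_cases h : a ≤ ∑ i ∈ s, f i
    · obtain ⟨t, ht, h1⟩ := ih (fun j hj => hf j (Finset.mem_insert_of_mem hj)) h
      exact ⟨t, ht.trans (Finset.subset_insert i s), h1⟩
    · refine ⟨insert i s, subset_rfl, hs, ?_⟩
      rw [Finset.sum_insert hi, two_mul]
      exact add_le_add (hf i (Finset.mem_insert_self i s)) (not_le.1 h).le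

/-! ### Additivity of the energy -/

namespace AtomicFiltration

section Energy

variable {Ω : Type*} [m : MeasurableSpace Ω] {P : Measure Ω} [IsProbabilityMeasure P]
  (F : AtomicFiltration P) {X : Type*} [NormedAddCommGroup X] [NormedSpace ℝ X] [CompleteSpace X]
variable {n k l : ℕ} {A B J : Set Ω} {ω : Ω} {f g s : Ω → X} {p : ℝ}

lemma condExp_eq_zero_of_level_le (hJ : J ∈ F.atoms l) (hf : Integrable f P)
    (hsupp : ∀ ω ∉ J, f ω = 0) (h0 : ∫ ω, f ω ∂P = 0) (hkl : k ≤ l) (ω : Ω) :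
    (P[f | F.seq k]) ω = 0 := by
  refine F.condExp_eq_zero hf (F.atomAt_mem k ω) (F.mem_atomAt k ω) ?_
  rcases F.subset_or_disjoint hkl (F.atomAt_mem k ω) hJ with h | h
  · rw [setIntegral_eq_integral_of_forall_compl_eq_zero fun x hx => hsupp x fun hxJ => hx (h hxJ)]
    exact h0
  · refine setIntegral_eq_zero_of_forall_eq_zero fun x hx => hsupp x fun hxJ => ?_
    exact Set.disjoint_left.1 h hxJ hx

lemma condExp_eq_zero_of_notMem (hJ : J ∈ F.atoms l) (hf : Integrable f P)
    (hsupp : ∀ ω ∉ J, f ω = 0) (hlk : l ≤ k) (hω : ω ∉ J) : (P[f | F.seq k]) ω = 0 := by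
  refine F.condExp_eq_const hf (F.atomAt_mem k ω) (F.mem_atomAt k ω) fun x hx => hsupp x fun hxJ => ?_
  exact hω (F.subset_of_mem_of_mem hlk hJ (F.atomAt_mem k ω) hxJ hx (F.mem_atomAt k ω))

/-- Energies add up when a mean zero function supported on an atom is added to a function that is
constant on this atom. -/
lemma energy_add_le (hJ : J ∈ F.atoms l) (hs : Integrable s P) {z : X}
    (hsJ : ∀ ω ∈ J, s ω = z) (hf : Integrable f P) (hsupp : ∀ ω ∉ J, f ω = 0)
    (h0 : ∫ ω, f ω ∂P = 0) : F.energy p (s + f) ≤ F.energy p s + F.energy p f := by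
  rw [energy, energy, energy, ← ENNReal.tsum_add]
  refine ENNReal.tsum_le_tsum fun k => ?_
  have hmeas : Measurable fun ω => ‖(P[s | F.seq (k + 1)]) ω - (P[s | F.seq k]) ω‖ₑ ^ p :=
    (((stronglyMeasurable_condExp.mono (F.le' _)).sub
      (stronglyMeasurable_condExp.mono (F.le' _))).enorm).pow_const p
  rw [← lintegral_add_left hmeas]
  refine lintegral_mono fun ω => ?_
  simp only [F.condExp_add_apply hs hf]
  -- At each point and level at most one of the two increments is nonzero: inside `J` and from level
  -- `l` on the martingale of `s` is constant, and everywhere else that of `f` vanishes.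
  by_cases h : l ≤ k ∧ ω ∈ J
  · have hconst : ∀ j, l ≤ j → (P[s | F.seq j]) ω = z := fun j hj =>
      F.condExp_eq_const hs (F.atomAt_mem j ω) (F.mem_atomAt j ω) fun x hx => hsJ x
        (F.subset_of_mem_of_mem hj hJ (F.atomAt_mem j ω) h.2 (F.mem_atomAt j ω) hx)
    rw [hconst k h.1, hconst (k + 1) (h.1.trans k.le_succ), add_sub_add_left_eq_sub]
    exact le_add_self
  · have hzero : (P[f | F.seq k]) ω = 0 ∧ (P[f | F.seq (k + 1)]) ω = 0 := by
      rcases lt_or_ge k l with hk | hk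
      · exact ⟨F.condExp_eq_zero_of_level_le hJ hf hsupp h0 hk.le ω,
          F.condExp_eq_zero_of_level_le hJ hf hsupp h0 hk ω⟩
      · have hω : ω ∉ J := fun hω => h ⟨hk, hω⟩
        exact ⟨F.condExp_eq_zero_of_notMem hJ hf hsupp hk hω,
          F.condExp_eq_zero_of_notMem hJ hf hsupp (hk.trans k.le_succ) hω⟩
    rw [hzero.1, hzero.2, add_zero, add_zero]
    exact le_self_add

lemma energy_add_sum_le (T : Finset (ℕ × Set Ω)) (f : ℕ × Set Ω → Ω → X)
    (hT : ∀ e ∈ T, e.2 ∈ F.atoms e.1) (hd : (T : Set (ℕ × Set Ω)).PairwiseDisjoint Prod.snd)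
    (hs : Integrable s P) (hsT : ∀ e ∈ T, ∃ z, ∀ ω ∈ e.2, s ω = z)
    (hf : ∀ e ∈ T, Integrable (f e) P) (hsupp : ∀ e ∈ T, ∀ ω ∉ e.2, f e ω = 0)
    (h0 : ∀ e ∈ T, ∫ ω, f e ω ∂P = 0) :
    F.energy p (s + ∑ e ∈ T, f e) ≤ F.energy p s + ∑ e ∈ T, F.energy p (f e) := by
  classical
  induction T using Finset.induction_on with
  | empty => simp
  | insert e T he ih =>
    rw [Finset.sum_insert he, Finset.sum_insert he, add_comm (f e), ← add_assoc]
    have hmem : ∀ e' ∈ T, e' ∈ insert e T := fun e' => Finset.mem_insert_of_mem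
    have hself := Finset.mem_insert_self e T
    obtain ⟨z, hz⟩ := hsT e hself
    refine (F.energy_add_le (hT e hself) (z := z)
      (hs.add (integrable_finsetSum' _ fun e' he' => hf e' (hmem e' he'))) ?_ (hf e hself)
      (hsupp e hself) (h0 e hself)).trans ?_
    · intro ω hω
      rw [Pi.add_apply, Finset.sum_apply, hz ω hω, Finset.sum_eq_zero, add_zero]
      intro e' he'
      refine hsupp e' (hmem e' he') ω fun hω' => ?_
      have hne : e' ≠ e := fun h => he (h ▸ he')
      exact Set.disjoint_left.1 (hd (by exact_mod_cast hmem e' he') (by exact_mod_cast hself) hne)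
        hω' hω
    · rw [add_comm (F.energy p (f e)), ← add_assoc]
      gcongr
      exact ih (fun e' he' => hT e' (hmem e' he')) (hd.subset (by exact_mod_cast hmem))
        (fun e' he' => hsT e' (hmem e' he')) (fun e' he' => hf e' (hmem e' he'))
        (fun e' he' => hsupp e' (hmem e' he')) fun i hi => h0 i (hmem i hi)

/-- The energy of a mean zero function that lives on an atom and is constant on its children. -/
lemma energy_le_of_const_on_children (hp : 0 < p) (hA : A ∈ F.atoms n) (hf : Integrable f P)
    (hsupp : ∀ ω ∉ A, f ω = 0) (h0 : ∫ ω, f ω ∂P = 0)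
    (hconst : ∀ B ∈ F.children n A, ∃ z, ∀ ω ∈ B, f ω = z) :
    F.energy p f ≤ ∫⁻ ω, ‖f ω‖ₑ ^ p ∂P := by
  have hlow : ∀ k ≤ n, ∀ ω, (P[f | F.seq k]) ω = 0 := fun k hk ω =>
    F.condExp_eq_zero_of_level_le hA hf hsupp h0 hk ω
  have hhigh : ∀ k, n < k → ∀ ω, (P[f | F.seq k]) ω = f ω := by
    intro k hk ω
    by_cases hω : ω ∈ A
    · obtain ⟨z, hz⟩ := hconst _ (F.atomAt_succ_mem_children hA hω)
      rw [hz ω (F.mem_atomAt _ ω)]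
      exact F.condExp_eq_const hf (F.atomAt_mem k ω) (F.mem_atomAt k ω) fun x hx =>
        hz x (F.atomAt_subset hk ω hx)
    · rw [hsupp ω hω]
      exact F.condExp_eq_zero_of_notMem hA hf hsupp hk.le hω
  rw [energy, tsum_eq_single n]
  · simp [hlow n le_rfl, hhigh (n + 1) n.lt_succ_self]
  · intro k hk
    rcases lt_or_gt_of_ne hk with h | h
    · simp [hlow k h.le, hlow (k + 1) h, hp]
    · simp [hhigh k h, hhigh (k + 1) (h.trans k.lt_succ_self), hp]

lemma energy_smul_const_le (hp : 0 < p) {h : Ω → ℝ} (hh : Integrable h P) (y : X) :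
    F.energy p (fun ω => h ω • y) ≤ ‖y‖ₑ ^ p * F.energy p h := by
  have hcond : ∀ k ω, (P[fun ω => h ω • y | F.seq k]) ω = (P[h | F.seq k]) ω • y := by
    intro k ω
    rw [F.condExp_eq_setAverage (hh.smul_const y) (F.atomAt_mem k ω) (F.mem_atomAt k ω),
      F.condExp_eq_setAverage hh (F.atomAt_mem k ω) (F.mem_atomAt k ω), setAverage_eq,
      setAverage_eq, integral_smul_const, smul_assoc]
  simp only [energy, hcond, ← sub_smul]
  rw [← ENNReal.tsum_mul_left]
  refine ENNReal.tsum_le_tsum fun k => ?_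
  rw [← lintegral_const_mul' _ _ (ENNReal.rpow_ne_top_of_nonneg hp.le enorm_ne_top)]
  refine lintegral_mono fun ω => ?_
  rw [enorm_smul, ENNReal.mul_rpow_of_nonneg _ _ hp.le, mul_comm]

end Energy

/-! ### Cuts of an atom -/

section Cut

variable {Ω : Type*} [m : MeasurableSpace Ω] {P : Measure Ω} (F : AtomicFiltration P)
  (star : ℕ → Set Ω → Set Ω)

/-- A cut of an atom `A`: a union of children of a member of the chain `A`, `A*`, `A**`, ... -/
inductive IsCut : ℕ → Set Ω → Set Ω → Prop
  | children {n : ℕ} {A : Set Ω} {C : Set (Set Ω)} (hC : C ⊆ F.children n A) : IsCut n A (⋃₀ C)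
  | later {n : ℕ} {A U : Set Ω} (hU : IsCut (n + 1) (star n A) U) : IsCut n A U

/-- The `j`-th member of the chain `A`, `A*`, `A**`, ... -/
def starChain : ℕ → ℕ → Set Ω → Set Ω
  | 0, _, A => A
  | j + 1, n, A => starChain j (n + 1) (star n A)

variable {F star} {n : ℕ} {A U : Set Ω} {e : ℕ × Set Ω}

lemma sUnion_children_inter {C : Set (Set Ω)} (hC : C ⊆ F.children n A) {B : Set Ω}
    (hB : B ∈ F.atoms (n + 1)) : B ⊆ ⋃₀ C ∨ Disjoint B (⋃₀ C) := by
  by_cases h : B ∈ C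
  · exact Or.inl (Set.subset_sUnion_of_mem h)
  · exact Or.inr (Set.disjoint_sUnion_right.2 fun B' hB' =>
      F.pairwiseDisjoint_atoms (n + 1) hB (hC hB').1 fun h' => h (h' ▸ hB'))

lemma IsCut.measurableSet (hU : F.IsCut star n A U) : MeasurableSet U := by
  induction hU with
  | children hC =>
    exact MeasurableSet.sUnion ((F.children_countable _ _).mono hC)
      fun B hB => F.measurableSet_of_mem_atoms (hC hB).1
  | later _ ih => exact ih

variable (hstar : F.IsLargestChildSelection star)
include hstar

lemma IsCut.subset (hU : F.IsCut star n A U) (hA : A ∈ F.atoms n) : U ⊆ A := by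
  induction hU with
  | children hC => exact Set.sUnion_subset fun B hB => (hC hB).2
  | later _ ih =>
    have hs := (hstar _ _ hA).1
    exact (ih hs.1).trans hs.2

/-- This is why cuts are formed from whole children of a single member of the chain: the cut
function becomes constant on every exit, so martingales can be continued independently on the exits.
-/
lemma IsCut.subset_or_disjoint (hU : F.IsCut star n A U) (hA : A ∈ F.atoms n)
    (he : F.IsExit star n A e) : e.2 ⊆ U ∨ Disjoint e.2 U := by
  induction hU with
  | @children n A C hC =>
    have hs := (hstar n A hA).1
    rcases isExit_iff.1 he with ⟨B, hB, _, rfl⟩ | h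
    · exact sUnion_children_inter hC hB.1
    · have hsub := h.subset hstar hs.1
      exact (sUnion_children_inter hC hs.1).imp hsub.trans fun h => h.mono_left hsub
  | @later n A U hU ih =>
    have hs := (hstar n A hA).1
    rcases isExit_iff.1 he with ⟨B, hB, hne, rfl⟩ | h
    · exact Or.inr ((F.pairwiseDisjoint_atoms (n + 1) hB.1 hs.1 hne).mono_right
        (hU.subset hstar hs.1))
    · exact ih hs.1 h

lemma starChain_subset (j : ℕ) (hA : A ∈ F.atoms n) : starChain star j n A ⊆ A := by
  induction j generalizing n A with
  | zero => exact subset_rfl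
  | succ j ih =>
    have hs := (hstar n A hA).1
    exact (ih hs.1).trans hs.2

/-- Past the level of an exit the chain has already left it. Exits of large total mass therefore
force the chain to become small. -/
lemma IsExit.disjoint_starChain (he : F.IsExit star n A e) (hA : A ∈ F.atoms n) {j : ℕ}
    (hj : e.1 ≤ n + j) : Disjoint e.2 (starChain star j n A) := by
  induction he generalizing j with
  | @child n A B hB hne =>
    have hs := (hstar n A hA).1
    obtain _ | j := j
    · simp at hj
    · exact (F.pairwiseDisjoint_atoms (n + 1) hB.1 hs.1 hne).mono_right
        (starChain_subset hstar j hs.1)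
  | @later n A e he ih =>
    have hlt := he.lt_level
    obtain _ | j := j
    · omega
    · exact ih (hstar n A hA).1.1 (by omega)

/-- Descend while the selected child has measure above `2 * a`. When this stops, either that child
has measure at least `a` and is itself the cut, or every child is smaller than `a`, the selected one
being largest, and a greedy union of children works. -/
lemma exists_isCut_of_starChain {a : ℝ≥0∞} (j : ℕ) (hA : A ∈ F.atoms n) (hA2 : 2 * a < P A)
    (hj : P (starChain star j n A) ≤ 2 * a) :
    ∃ U, F.IsCut star n A U ∧ a ≤ P U ∧ P U ≤ 2 * a := by
  induction j generalizing n A with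
  | zero => exact absurd hA2 (not_lt.2 hj)
  | succ j ih =>
    have hs := (hstar n A hA).1
    rcases lt_or_ge (2 * a) (P (star n A)) with h | h
    · obtain ⟨U, hU, h1⟩ := ih hs.1 h hj
      exact ⟨U, .later hU, h1⟩
    rcases le_or_gt a (P (star n A)) with h' | h'
    · refine ⟨⋃₀ {star n A}, .children (Set.singleton_subset_iff.2 hs), ?_⟩
      simpa using ⟨h', h⟩
    · rw [F.measure_eq_tsum_children hA, ENNReal.tsum_eq_iSup_sum] at hA2
      obtain ⟨s, hs2⟩ := lt_iSup_iff.1 hA2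
      obtain ⟨t, _, h1, h2⟩ := s.exists_subset_sum_mem_Icc (fun B => P B.1) a
        (fun B _ => ((hstar n A hA).2 B.1 B.2).trans h'.le)
        (le_trans (by rw [two_mul]; exact le_self_add) hs2.le)
      have hmeas : P (⋃₀ (Subtype.val '' (t : Set (F.children n A)))) = ∑ B ∈ t, P B.1 := by
        rw [Set.sUnion_image]
        exact measure_biUnion_finset (fun B _ C _ hne => F.children_pairwiseDisjoint n A B.2 C.2
          fun h => hne (Subtype.ext h)) fun B _ => F.measurableSet_of_mem_atoms B.2.1
      refine ⟨_, .children (C := Subtype.val '' (t : Set (F.children n A))) ?_, ?_⟩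
      · rintro _ ⟨B, _, rfl⟩
        exact B.2
      · rw [hmeas]
        exact ⟨h1, h2⟩

variable [IsProbabilityMeasure P]

/-- An atom that is filled up to a third by finitely many exits has a cut of proportion between one
third and two thirds. -/
lemma exists_isCut (hA : A ∈ F.atoms n) {T : Finset (ℕ × Set Ω)}
    (hT : ∀ e ∈ T, F.IsExit star n A e) (hmass : P A ≤ 3 * ∑ e ∈ T, P e.2) :
    ∃ U, F.IsCut star n A U ∧ P A ≤ 3 * P U ∧ 3 * P U ≤ 2 * P A := by
  have h3 : (3 : ℝ≥0∞) * (P A / 3) = P A := ENNReal.mul_div_cancel (by simp) (by simp)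
  set a := P A / 3 with ha
  have hatop : a ≠ ∞ := by finiteness
  have ha0 : a ≠ 0 := by
    intro h
    rw [h, mul_zero] at h3
    exact (F.measure_atoms_pos n A hA).ne h3
  have hTa : a ≤ ∑ e ∈ T, P e.2 := by
    rw [← h3] at hmass
    exact (ENNReal.mul_le_mul_iff_right (by simp) (by simp)).1 hmass
  -- Beyond the deepest exit in `T` the chain is disjoint from all of them, so it has at most two
  -- thirds of the mass of `A`.
  set j := T.sup Prod.fst with hj
  have hchain : P (starChain star j n A) + ∑ e ∈ T, P e.2 ≤ P A := by
    rw [← measure_biUnion_finset (f := Prod.snd)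
      (fun e he e' he' hne => (hT e he).disjoint hstar (hT e' he') hA hne)
      fun e he => F.measurableSet_of_mem_atoms (hT e he).mem_atoms, ← measure_union]
    · exact measure_mono (Set.union_subset (starChain_subset hstar j hA)
        (Set.iUnion₂_subset fun e he => (hT e he).subset hstar hA))
    · refine Set.disjoint_iUnion₂_right.2 fun e he => ?_
      exact ((hT e he).disjoint_starChain hstar hA
        ((Finset.le_sup (f := Prod.fst) he).trans (Nat.le_add_left _ _))).symm
    · exact Finset.measurableSet_biUnion _ fun e he =>
        F.measurableSet_of_mem_atoms (hT e he).mem_atoms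
  have h2a : P (starChain star j n A) ≤ 2 * a := by
    have h : P (starChain star j n A) + a ≤ 2 * a + a := by
      calc _ ≤ P (starChain star j n A) + ∑ e ∈ T, P e.2 := by gcongr
        _ ≤ P A := hchain
        _ = 2 * a + a := by rw [← h3]; ring
    exact ENNReal.le_of_add_le_add_right hatop h
  have hlt : 2 * a < P A := by
    rw [← h3]
    exact (ENNReal.mul_lt_mul_iff_left ha0 hatop).2 (by norm_num)
  obtain ⟨U, hU, h1, h2⟩ := exists_isCut_of_starChain hstar j hA hlt h2a
  refine ⟨U, hU, ?_, ?_⟩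
  · rw [← h3]; gcongr
  · rw [← h3, mul_left_comm]; gcongr

end Cut

end AtomicFiltration

/-! ### The energy of cut functions -/

namespace AtomicFiltration

section CutFunction

variable {Ω : Type*} [m : MeasurableSpace Ω] (P : Measure Ω)

/-- The mean zero function `1_U - (P U / P A) 1_A`. -/
noncomputable def cutFunction (A U : Set Ω) (ω : Ω) : ℝ :=
  U.indicator (fun _ => 1) ω - P.real U / P.real A * A.indicator (fun _ => 1) ω

variable {P} {A U : Set Ω} {ω : Ω}

lemma cutFunction_of_mem (hUA : U ⊆ A) (hω : ω ∈ U) :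
    cutFunction P A U ω = 1 - P.real U / P.real A := by
  simp [cutFunction, hω, hUA hω]

lemma cutFunction_of_notMem (hA : ω ∈ A) (hω : ω ∉ U) :
    cutFunction P A U ω = -(P.real U / P.real A) := by
  simp [cutFunction, hω, hA]

lemma cutFunction_eq_zero (hUA : U ⊆ A) (hω : ω ∉ A) : cutFunction P A U ω = 0 := by
  have hU : ω ∉ U := fun h => hω (hUA h)
  simp [cutFunction, hω, hU]

lemma measurable_cutFunction (hA : MeasurableSet A) (hU : MeasurableSet U) :
    Measurable (cutFunction P A U) :=
  (measurable_const.indicator hU).sub ((measurable_const.indicator hA).const_mul _)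

lemma lintegral_enorm_rpow_le_of_bounded {p : ℝ} (hp : 1 ≤ p) {f : Ω → ℝ} {A : Set Ω}
    (hA : MeasurableSet A) (hsupp : ∀ ω ∉ A, f ω = 0) (hf : ∀ ω, |f ω| ≤ 1) :
    ∫⁻ ω, ‖f ω‖ₑ ^ p ∂P ≤ P A := by
  have hp0 : 0 < p := by linarith
  rw [← lintegral_indicator_one hA]
  refine lintegral_mono fun ω => ?_
  by_cases hω : ω ∈ A
  · rw [Set.indicator_of_mem hω, Pi.one_apply]
    refine ENNReal.rpow_le_one ?_ hp0.le
    rw [Real.enorm_eq_ofReal_abs]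
    exact ENNReal.ofReal_le_one.2 (hf ω)
  · simp [hsupp ω hω, hp0]

variable [IsProbabilityMeasure P]

lemma abs_cutFunction_le (hUA : U ⊆ A) (ω : Ω) : |cutFunction P A U ω| ≤ 1 := by
  have h0 : 0 ≤ P.real U / P.real A := by positivity
  have h1 : P.real U / P.real A ≤ 1 := div_le_one_of_le₀ (measureReal_mono hUA) (by positivity)
  by_cases hA : ω ∈ A
  · by_cases hU : ω ∈ U
    · rw [cutFunction_of_mem hUA hU, abs_le]
      constructor <;> linarith
    · rw [cutFunction_of_notMem hA hU, abs_le]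
      constructor <;> linarith
  · simp [cutFunction_eq_zero hUA hA]

lemma integrable_cutFunction (hA : MeasurableSet A) (hU : MeasurableSet U) :
    Integrable (cutFunction P A U) P :=
  ((integrable_const 1).indicator hU).sub (((integrable_const 1).indicator hA).const_mul _)

lemma integral_cutFunction (hA : MeasurableSet A) (hU : MeasurableSet U) (hA0 : P.real A ≠ 0) :
    ∫ ω, cutFunction P A U ω ∂P = 0 := by
  unfold cutFunction
  rw [integral_sub ((integrable_const 1).indicator hU)
    (((integrable_const 1).indicator hA).const_mul _), integral_const_mul,
    integral_indicator_const _ hU, integral_indicator_const _ hA]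
  simp [hA0]

variable {F : AtomicFiltration P} {star : ℕ → Set Ω → Set Ω} {n : ℕ}

/-- The function has mean zero and takes the value `b - a` on the selected child and `-a` on the
rest of `A`. As `t ^ p ≤ t` on `[0, 1]`, its `p`-th moment is at most twice `a * P (A \ star n A)`.
Charging the removed part instead of `P A` is what lets the bound telescope. -/
lemma energy_starCut_le {p : ℝ} (hp : 1 ≤ p) (hstar : F.IsLargestChildSelection star)
    (hA : A ∈ F.atoms n) {a b : ℝ} (ha : 0 ≤ a) (hb : b ≤ 1) (hab : a ≤ b)
    (heq : b * P.real (star n A) = a * P.real A) :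
    F.energy p (fun ω => b * (star n A).indicator (fun _ => (1 : ℝ)) ω -
      a * A.indicator (fun _ => (1 : ℝ)) ω) ≤ 2 * P (A \ star n A) := by
  have hp0 : 0 < p := by linarith
  have hs := (hstar n A hA).1
  have hAm := F.measurableSet_of_mem_atoms hA
  have hSm := F.measurableSet_of_mem_atoms hs.1
  set S := star n A
  have hiS : Integrable (fun ω => b * S.indicator (fun _ => (1 : ℝ)) ω) P :=
    ((integrable_const 1).indicator hSm).const_mul _
  have hiA : Integrable (fun ω => a * A.indicator (fun _ => (1 : ℝ)) ω) P :=
    ((integrable_const 1).indicator hAm).const_mul _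
  set f : Ω → ℝ := fun ω => b * S.indicator (fun _ => (1 : ℝ)) ω -
    a * A.indicator (fun _ => (1 : ℝ)) ω with hf
  have hfS : ∀ ω ∈ S, f ω = b - a := fun ω hω => by simp [hf, hω, hs.2 hω]
  have hfA : ∀ ω ∈ A \ S, f ω = -a := fun ω hω => by simp [hf, hω.1, hω.2]
  have hf0 : ∀ ω ∉ A, f ω = 0 := fun ω hω => by
    have hS : ω ∉ S := fun h => hω (hs.2 h)
    simp [hf, hω, hS]
  refine (F.energy_le_of_const_on_children hp0 hA (hiS.sub hiA) hf0 ?_ ?_).trans ?_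
  · change ∫ ω, (b * S.indicator (fun _ => (1 : ℝ)) ω - a * A.indicator (fun _ => (1 : ℝ)) ω) ∂P = 0
    rw [integral_sub hiS hiA, integral_const_mul, integral_const_mul,
      integral_indicator_const _ hSm, integral_indicator_const _ hAm]
    simp only [smul_eq_mul, mul_one]
    rw [heq, sub_self]
  · intro B hB
    by_cases h : B = S
    · exact ⟨b - a, fun ω hω => hfS ω (h ▸ hω)⟩
    · exact ⟨-a, fun ω hω => hfA ω ⟨hB.2 hω, fun hω' =>
        Set.disjoint_left.1 (F.pairwiseDisjoint_atoms _ hB.1 hs.1 h) hω hω'⟩⟩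
  · have hbound : ∀ ω, ‖f ω‖ₑ ^ p ≤ S.indicator (fun _ => ENNReal.ofReal (b - a)) ω +
        (A \ S).indicator (fun _ => ENNReal.ofReal a) ω := by
      have haux : ∀ t : ℝ, 0 ≤ t → t ≤ 1 → ENNReal.ofReal t ^ p ≤ ENNReal.ofReal t := by
        intro t ht ht1
        rw [ENNReal.ofReal_rpow_of_nonneg ht hp0.le]
        refine ENNReal.ofReal_le_ofReal ?_
        simpa using Real.rpow_le_rpow_of_exponent_ge' ht ht1 zero_le_one hp
      intro ω
      by_cases hωA : ω ∈ A
      · by_cases hωS : ω ∈ S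
        · rw [hfS ω hωS, Real.enorm_eq_ofReal (by linarith)]
          simpa [hωS] using haux (b - a) (by linarith) (by linarith)
        · rw [hfA ω ⟨hωA, hωS⟩, enorm_neg, Real.enorm_eq_ofReal ha]
          simpa [hωS, hωA] using haux a ha (by linarith)
      · simp [hf0 ω hωA, hp0]
    refine (lintegral_mono hbound).trans ?_
    rw [lintegral_add_left (measurable_const.indicator hSm), lintegral_indicator_const hSm,
      lintegral_indicator_const (hAm.diff hSm)]
    have hd : P.real (A \ S) = P.real A - P.real S := measureReal_sdiff hs.2 hSm
    have h1 : ENNReal.ofReal (b - a) * P S = ENNReal.ofReal a * P (A \ S) := by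
      rw [← ofReal_measureReal (μ := P) (s := S), ← ofReal_measureReal (μ := P) (s := A \ S),
        ← ENNReal.ofReal_mul (by linarith), ← ENNReal.ofReal_mul ha, hd]
      congr 1
      linarith
    rw [h1, ← two_mul, ← mul_assoc]
    gcongr
    calc 2 * ENNReal.ofReal a ≤ 2 * 1 := by
          gcongr
          exact ENNReal.ofReal_le_one.2 (by linarith)
      _ = 2 := mul_one 2

/-- The energy of the cut function of a cut is controlled by the measure of the atom. -/
lemma IsCut.energy_le {p : ℝ} (hp : 1 ≤ p) (hstar : F.IsLargestChildSelection star)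
    (hU : F.IsCut star n A U) (hA : A ∈ F.atoms n) :
    F.energy p (cutFunction P A U) ≤ 2 * P A := by
  have hp0 : 0 < p := by linarith
  induction hU with
  | @children n A C hC =>
    have hcut : F.IsCut star n A (⋃₀ C) := .children hC
    have hAm := F.measurableSet_of_mem_atoms hA
    have hUA := hcut.subset hstar hA
    refine (F.energy_le_of_const_on_children hp0 hA
      (integrable_cutFunction hAm hcut.measurableSet) (fun ω hω => cutFunction_eq_zero hUA hω)
      (integral_cutFunction hAm hcut.measurableSet (F.measureReal_pos hA).ne') ?_).trans ?_
    · intro B hB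
      rcases sUnion_children_inter hC hB.1 with h | h
      · exact ⟨_, fun ω hω => cutFunction_of_mem hUA (h hω)⟩
      · exact ⟨_, fun ω hω => cutFunction_of_notMem (hB.2 hω) (Set.disjoint_left.1 h hω)⟩
    · refine (lintegral_enorm_rpow_le_of_bounded hp hAm
        (fun ω hω => cutFunction_eq_zero hUA hω) (abs_cutFunction_le hUA)).trans ?_
      rw [two_mul]
      exact le_self_add
  | @later n A U hU ih =>
    have hs := (hstar n A hA).1
    have hAm := F.measurableSet_of_mem_atoms hA
    have hSm := F.measurableSet_of_mem_atoms hs.1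
    have hUS := hU.subset hstar hs.1
    have hApos := F.measureReal_pos hA
    have hSpos := F.measureReal_pos hs.1
    set S := star n A
    -- The cut function of `A` is that of `star n A` plus a one-step function; the costs `2 * P (A \
    -- S)` and `2 * P S` add up to `2 * P A` with no dependence on the length of the chain.
    have hdec : cutFunction P A U =
        (fun ω => P.real U / P.real S * S.indicator (fun _ => (1 : ℝ)) ω -
          P.real U / P.real A * A.indicator (fun _ => (1 : ℝ)) ω) + cutFunction P S U := by
      ext ω
      simp only [cutFunction, Pi.add_apply]
      ring
    rw [hdec]
    have hiS : Integrable (fun ω => P.real U / P.real S * S.indicator (fun _ => (1 : ℝ)) ω) P :=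
      ((integrable_const 1).indicator hSm).const_mul _
    have hiA : Integrable (fun ω => P.real U / P.real A * A.indicator (fun _ => (1 : ℝ)) ω) P :=
      ((integrable_const 1).indicator hAm).const_mul _
    refine (F.energy_add_le hs.1 (hiS.sub hiA) (z := P.real U / P.real S - P.real U / P.real A)
      (fun ω hω => by simp [hω, hs.2 hω]) (integrable_cutFunction hSm hU.measurableSet)
      (fun ω hω => cutFunction_eq_zero hUS hω)
      (integral_cutFunction hSm hU.measurableSet hSpos.ne')).trans ?_
    calc _ ≤ 2 * P (A \ S) + 2 * P S := by
          refine add_le_add (energy_starCut_le hp hstar hA (by positivity) ?_ ?_ ?_) (ih hs.1)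
          · exact div_le_one_of_le₀ (measureReal_mono hUS) hSpos.le
          · exact div_le_div_of_nonneg_left measureReal_nonneg hSpos (measureReal_mono hs.2)
          · change P.real U / P.real S * P.real S = P.real U / P.real A * P.real A
            rw [div_mul_cancel₀ _ hSpos.ne', div_mul_cancel₀ _ hApos.ne']
      _ = 2 * P A := by
          rw [← mul_add, ← measure_sdiff_add_inter A hSm, Set.inter_eq_right.2 hs.2]

end CutFunction

end AtomicFiltration

/-! ### Dyadic martingales and their functionals -/

/-- A finite dyadic martingale with values in `X` and mean zero, as a binary tree of increments. -/
inductive DyadicTree (X : Type*)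
  | leaf : DyadicTree X
  | node (y : X) (l r : DyadicTree X) : DyadicTree X

namespace DyadicTree

variable {X : Type*} [NormedAddCommGroup X]

/-- The number of steps of a dyadic martingale. -/
def depth {X : Type*} : DyadicTree X → ℕ
  | leaf => 0
  | node _ l r => max l.depth r.depth + 1

/-- The `p`-th moment of the dyadic martingale started at `x`, minus `κ` times the sum of the `p`-th
moments of its increments. -/
noncomputable def val (p κ : ℝ) : DyadicTree X → X → ℝ
  | leaf, x => ‖x‖ ^ p
  | node y l r, x => (l.val p κ (x + y) + r.val p κ (x - y)) / 2 - κ * ‖y‖ ^ p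

variable {p κ : ℝ}

/-- Local boundedness makes the part of a rich atom that is missed by its exits negligible when `θ`
is close to 1. -/
lemma exists_abs_val_le (hp : 0 ≤ p) (t : DyadicTree X) (R : ℝ) :
    ∃ b : ℝ, 0 ≤ b ∧ ∀ x : X, ‖x‖ ≤ R → |t.val p κ x| ≤ b := by
  induction t generalizing R with
  | leaf =>
    refine ⟨|R| ^ p, by positivity, fun x hx => ?_⟩
    rw [val, abs_of_nonneg (by positivity)]
    exact Real.rpow_le_rpow (norm_nonneg x) (hx.trans (le_abs_self R)) hp
  | node y l r hl hr =>
    obtain ⟨b, hb0, hb⟩ := hl (R + ‖y‖)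
    obtain ⟨c, hc0, hc⟩ := hr (R + ‖y‖)
    refine ⟨b + c + |κ| * ‖y‖ ^ p, by positivity, fun x hx => ?_⟩
    have h1 := hb (x + y) ((norm_add_le x y).trans (by linarith))
    have h2 := hc (x - y) ((norm_sub_le x y).trans (by linarith))
    rw [val]
    refine (abs_sub _ _).trans (add_le_add ?_ ?_)
    · rw [abs_div, abs_two]
      have := abs_add_le (l.val p κ (x + y)) (r.val p κ (x - y))
      linarith
    · rw [abs_mul, abs_of_nonneg (a := ‖y‖ ^ p) (by positivity)]

variable [NormedSpace ℝ X]

/-- The penalty does not depend on the starting point, so convexity of `‖x‖ ^ p` passes from the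
leaves to the root. -/
lemma convexOn_val (hp : 1 ≤ p) (t : DyadicTree X) : ConvexOn ℝ Set.univ (t.val p κ) := by
  induction t with
  | leaf =>
    refine ⟨convex_univ, fun x _ y _ a b ha hb hab => ?_⟩
    simp only [val]
    calc ‖a • x + b • y‖ ^ p ≤ (a • ‖x‖ + b • ‖y‖) ^ p := by
          refine Real.rpow_le_rpow (norm_nonneg _) ((norm_add_le _ _).trans_eq ?_) (by linarith)
          rw [norm_smul, norm_smul, Real.norm_of_nonneg ha, Real.norm_of_nonneg hb]
          rfl
      _ ≤ a • ‖x‖ ^ p + b • ‖y‖ ^ p :=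
          (convexOn_rpow hp).2 (norm_nonneg x) (norm_nonneg y) ha hb hab
  | node z l r hl hr =>
    refine ⟨convex_univ, fun x _ y _ a b ha hb hab => ?_⟩
    have h1 := hl.2 (Set.mem_univ (x + z)) (Set.mem_univ (y + z)) ha hb hab
    have h2 := hr.2 (Set.mem_univ (x - z)) (Set.mem_univ (y - z)) ha hb hab
    have e : z = a • z + b • z := by rw [← add_smul, hab, one_smul]
    have e1 : a • (x + z) + b • (y + z) = a • x + b • y + z := by
      conv_rhs => rw [e]
      module
    have e2 : a • (x - z) + b • (y - z) = a • x + b • y - z := by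
      conv_rhs => rw [e]
      module
    rw [e1] at h1
    rw [e2] at h2
    simp only [val, smul_eq_mul] at *
    have e3 : κ * ‖z‖ ^ p = a * (κ * ‖z‖ ^ p) + b * (κ * ‖z‖ ^ p) := by
      rw [← add_mul, hab, one_mul]
    linarith

end DyadicTree

/-- A convex function at the two points of a mean zero law dominates its mean over the symmetric
two-point law of a smaller spread. -/
lemma ConvexOn.half_add_le_of_mem_Icc {X : Type*} [AddCommGroup X] [Module ℝ X] {g : X → ℝ}
    (hg : ConvexOn ℝ Set.univ g) (x y : X) {q : ℝ} (hq1 : 1 / 3 ≤ q) (hq2 : q ≤ 2 / 3) :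
    (g (x + y) + g (x - y)) / 2 ≤
      q * g (x + (1 - q) • (3 : ℝ) • y) + (1 - q) * g (x + (-q) • (3 : ℝ) • y) := by
  have key : ∀ a b : ℝ, 0 ≤ a → 0 ≤ b → a + b = 1 →
      g (a • (x + (1 - q) • (3 : ℝ) • y) + b • (x + (-q) • (3 : ℝ) • y)) ≤
        a • g (x + (1 - q) • (3 : ℝ) • y) + b • g (x + (-q) • (3 : ℝ) • y) :=
    fun a b ha hb hab => hg.2 (Set.mem_univ _) (Set.mem_univ _) ha hb hab
  -- The points `x + y` and `x - y` lie on the segment between the two points of the law; this is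
  -- where the spread 3 and the range of `q` are needed. The weights of the first endpoint average
  -- to `q`.
  have h1 := key (q + 1 / 3) (2 / 3 - q) (by linarith) (by linarith) (by ring)
  have h2 := key (q - 1 / 3) (4 / 3 - q) (by linarith) (by linarith) (by ring)
  have e1 : (q + 1 / 3) • (x + (1 - q) • (3 : ℝ) • y) + (2 / 3 - q) • (x + (-q) • (3 : ℝ) • y) =
      x + y := by module
  have e2 : (q - 1 / 3) • (x + (1 - q) • (3 : ℝ) • y) + (4 / 3 - q) • (x + (-q) • (3 : ℝ) • y) =
      x - y := by module
  rw [e1] at h1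
  rw [e2] at h2
  simp only [smul_eq_mul] at h1 h2
  linarith

/-! ### Realizing dyadic martingales on rich atoms -/

namespace AtomicFiltration

variable {Ω : Type*} [m : MeasurableSpace Ω] {P : Measure Ω} {F : AtomicFiltration P}
  {star : ℕ → Set Ω → Set Ω} {n : ℕ} {A : Set Ω}

lemma IsRich.of_succ {θ : ℝ≥0} {N : ℕ} (h : F.IsRich star θ (N + 1) n A) :
    F.IsRich star θ N n A := by
  induction N generalizing n A with
  | zero => trivial
  | succ N ih =>
    obtain ⟨T, hT, hmass⟩ := h
    exact ⟨T, fun e he => ⟨(hT e he).1, ih (hT e he).2⟩, hmass⟩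

lemma IsRich.mono_depth {θ : ℝ≥0} {M N : ℕ} (hMN : M ≤ N) (h : F.IsRich star θ N n A) :
    F.IsRich star θ M n A := by
  induction hMN with
  | refl => exact h
  | step _ ih => exact ih h.of_succ

lemma IsRich.mono {θ θ' : ℝ≥0} (hθ : θ ≤ θ') {N : ℕ} (h : F.IsRich star θ' N n A) :
    F.IsRich star θ N n A := by
  induction N generalizing n A with
  | zero => trivial
  | succ N ih =>
    obtain ⟨T, hT, hmass⟩ := h
    exact ⟨T, fun e he => ⟨(hT e he).1, ih (hT e he).2⟩, le_trans (by gcongr) hmass⟩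

variable {X : Type*} [NormedAddCommGroup X] [NormedSpace ℝ X] {p κ : ℝ}

/-- A bounded mean zero function on the atom `A`, with energy at most `ε`, for which the `p`-th
moment of `x + f` over `A` exceeds `κ ε + v`. -/
structure Realizes (F : AtomicFiltration P) (p κ : ℝ) (A : Set Ω) (x : X) (v : ℝ) (f : Ω → X)
    (ε : ℝ) : Prop where
  stronglyMeasurable : StronglyMeasurable f
  bounded : ∃ b, ∀ ω, ‖f ω‖ ≤ b
  eq_zero : ∀ ω ∉ A, f ω = 0
  integral_eq_zero : ∫ ω, f ω ∂P = 0
  nonneg : 0 ≤ ε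
  energy_le : F.energy p f ≤ ENNReal.ofReal ε
  le : κ * ε + v ≤ ∫ ω in A, ‖x + f ω‖ ^ p ∂P

lemma Realizes.mono {x : X} {v w ε : ℝ} {f : Ω → X} (h : F.Realizes p κ A x v f ε) (hw : w ≤ v) :
    F.Realizes p κ A x w f ε where
  __ := h
  le := le_trans (by linarith) h.le

variable [IsProbabilityMeasure P]

lemma integrable_norm_add_rpow {X : Type*} [NormedAddCommGroup X] {p : ℝ}
    (hp : 0 ≤ p) {f : Ω → X} (hf : StronglyMeasurable f) {b : ℝ}
    (hb : ∀ ω, ‖f ω‖ ≤ b) (x : X) : Integrable (fun ω => ‖x + f ω‖ ^ p) P := by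
  refine Integrable.of_bound (C := (‖x‖ + b) ^ p)
    (((stronglyMeasurable_const.add hf).norm.measurable.pow_const p).aestronglyMeasurable)
    (ae_of_all _ fun ω => ?_)
  rw [Real.norm_of_nonneg (by positivity)]
  refine Real.rpow_le_rpow (norm_nonneg _) ((norm_add_le _ _).trans ?_) hp
  gcongr
  exact hb ω

lemma Realizes.integrable {p κ v ε : ℝ} {x : X} {f : Ω → X} (h : F.Realizes p κ A x v f ε) :
    Integrable f P := by
  obtain ⟨b, hb⟩ := h.bounded
  exact Integrable.of_bound h.stronglyMeasurable.aestronglyMeasurable b (ae_of_all _ hb)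

lemma realizes_zero (hp : 0 < p) (x : X) :
    F.Realizes p κ A x (‖x‖ ^ p * P.real A) (0 : Ω → X) 0 where
  stronglyMeasurable := stronglyMeasurable_zero
  bounded := ⟨0, by simp⟩
  eq_zero := by simp
  integral_eq_zero := by simp
  nonneg := le_rfl
  energy_le := by simp [energy, condExp_zero, hp]
  le := by simp [mul_comm]

variable [CompleteSpace X]

/-- Gluing realizations on finitely many exits to a multiple of a cut function. -/
lemma realizes_glue (hp1 : 1 ≤ p) (hstar : F.IsLargestChildSelection star)
    (hA : A ∈ F.atoms n) {U : Set Ω} (hU : F.IsCut star n A U) {T : Finset (ℕ × Set Ω)}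
    (hT : ∀ e ∈ T, F.IsExit star n A e) (x y : X) (z : ℕ × Set Ω → ℝ)
    (hz : ∀ e ∈ T, ∀ ω ∈ e.2, cutFunction P A U ω = z e) (f : ℕ × Set Ω → Ω → X)
    (ε v : ℕ × Set Ω → ℝ)
    (hf : ∀ e ∈ T, F.Realizes p κ e.2 (x + z e • y) (v e) (f e) (ε e)) :
    F.Realizes p κ A x (∑ e ∈ T, v e - κ * (2 * ‖y‖ ^ p * P.real A))
      ((fun ω => cutFunction P A U ω • y) + ∑ e ∈ T, f e)
      (2 * ‖y‖ ^ p * P.real A + ∑ e ∈ T, ε e) := by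
  have hp0 : 0 < p := by linarith
  have hAm := F.measurableSet_of_mem_atoms hA
  have hUA := hU.subset hstar hA
  have hUm := hU.measurableSet
  have hcut := integrable_cutFunction (P := P) hAm hUm
  have hTm : ∀ e ∈ T, MeasurableSet e.2 := fun e he =>
    F.measurableSet_of_mem_atoms (hT e he).mem_atoms
  have hTA : ∀ e ∈ T, e.2 ⊆ A := fun e he => (hT e he).subset hstar hA
  have hd : (T : Set (ℕ × Set Ω)).PairwiseDisjoint Prod.snd := fun e he e' he' hne =>
    (hT e he).disjoint hstar (hT e' he') hA hne
  have hmeas : StronglyMeasurable ((fun ω => cutFunction P A U ω • y) + ∑ e ∈ T, f e) :=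
    ((measurable_cutFunction hAm hUm).stronglyMeasurable.smul_const y).add
      (Finset.stronglyMeasurable_sum T fun e he => (hf e he).stronglyMeasurable)
  have hb : ∃ b, ∀ ω, ‖((fun ω => cutFunction P A U ω • y) + ∑ e ∈ T, f e) ω‖ ≤ b := by
    choose! b hb using fun e he => (hf e he).bounded
    refine ⟨‖y‖ + ∑ e ∈ T, b e, fun ω => ?_⟩
    rw [Pi.add_apply, Finset.sum_apply]
    refine (norm_add_le _ _).trans (add_le_add ?_ ?_)
    · rw [norm_smul]
      exact mul_le_of_le_one_left (norm_nonneg y) (abs_cutFunction_le hUA ω)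
    · exact (norm_sum_le _ _).trans (Finset.sum_le_sum fun e he => hb e he ω)
  have hε : ∀ e ∈ T, 0 ≤ ε e := fun e he => (hf e he).nonneg
  -- On an exit the cut function is constant and only the realization belonging to that exit
  -- contributes.
  have hval : ∀ e ∈ T, ∀ ω ∈ e.2,
      x + ((fun ω => cutFunction P A U ω • y) + ∑ e ∈ T, f e) ω = x + z e • y + f e ω := by
    intro e he ω hω
    rw [Pi.add_apply, Finset.sum_apply, hz e he ω hω, Finset.sum_eq_single_of_mem e he, add_assoc]
    intro e' he' hne
    exact (hf e' he').eq_zero ω fun hω' => Set.disjoint_left.1 (hd he' he hne) hω' hω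
  refine ⟨hmeas, hb, ?_, ?_, ?_, ?_, ?_⟩
  · intro ω hω
    rw [Pi.add_apply, Finset.sum_apply, cutFunction_eq_zero hUA hω, zero_smul, zero_add]
    exact Finset.sum_eq_zero fun e he => (hf e he).eq_zero ω fun h => hω (hTA e he h)
  · simp only [Pi.add_apply, Finset.sum_apply]
    rw [integral_add (hcut.smul_const y) (integrable_finsetSum _ fun e he => (hf e he).integrable),
      integral_smul_const, integral_cutFunction hAm hUm (F.measureReal_pos hA).ne', zero_smul,
      zero_add, integral_finsetSum _ fun e he => (hf e he).integrable]
    exact Finset.sum_eq_zero fun e he => (hf e he).integral_eq_zero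
  · exact add_nonneg (by positivity) (Finset.sum_nonneg hε)
  · refine (F.energy_add_sum_le T f (fun e he => (hT e he).mem_atoms) hd (hcut.smul_const y)
      (fun e he => ⟨z e • y, fun ω hω => by rw [hz e he ω hω]⟩)
      (fun e he => (hf e he).integrable) (fun e he => (hf e he).eq_zero)
      fun e he => (hf e he).integral_eq_zero).trans ?_
    rw [ENNReal.ofReal_add (by positivity) (Finset.sum_nonneg hε), ENNReal.ofReal_sum_of_nonneg hε]
    refine add_le_add ?_ (Finset.sum_le_sum fun e he => (hf e he).energy_le)
    refine (F.energy_smul_const_le hp0 hcut y).trans ?_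
    rw [ENNReal.ofReal_mul (by positivity), ENNReal.ofReal_mul (by positivity),
      ← enorm_rpow_eq_ofReal _ hp0.le, ofReal_measureReal, mul_comm (ENNReal.ofReal 2), mul_assoc]
    gcongr
    simpa using hU.energy_le hp1 hstar hA
  · obtain ⟨b, hb⟩ := hb
    have hfint := integrable_norm_add_rpow (P := P) hp0.le hmeas hb x
    calc κ * (2 * ‖y‖ ^ p * P.real A + ∑ e ∈ T, ε e) +
          (∑ e ∈ T, v e - κ * (2 * ‖y‖ ^ p * P.real A))
        = ∑ e ∈ T, (κ * ε e + v e) := by rw [Finset.sum_add_distrib, ← Finset.mul_sum]; ring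
      _ ≤ ∑ e ∈ T, ∫ ω in e.2,
            ‖x + ((fun ω => cutFunction P A U ω • y) + ∑ e ∈ T, f e) ω‖ ^ p ∂P := by
          refine Finset.sum_le_sum fun e he => (hf e he).le.trans_eq ?_
          exact setIntegral_congr_fun (hTm e he) fun ω hω => by rw [hval e he ω hω]
      _ = ∫ ω in ⋃ e ∈ T, e.2,
            ‖x + ((fun ω => cutFunction P A U ω • y) + ∑ e ∈ T, f e) ω‖ ^ p ∂P :=
          (integral_biUnion_finset T hTm hd fun e _ => hfint.integrableOn).symm
      -- The part of `A` not covered by the exits is dropped, the integrand being nonnegative.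
      _ ≤ _ := setIntegral_mono_set hfint.integrableOn (ae_of_all _ fun ω => by positivity)
          (LE.le.eventuallyLE (Set.iUnion₂_subset hTA))

end AtomicFiltration

namespace AtomicFiltration

variable {Ω : Type*} [m : MeasurableSpace Ω] {P : Measure Ω} [IsProbabilityMeasure P]
  {F : AtomicFiltration P} {star : ℕ → Set Ω → Set Ω}
  {X : Type*} [NormedAddCommGroup X] [NormedSpace ℝ X] [CompleteSpace X] {p κ : ℝ}

/-- Every dyadic martingale can be realized approximately on every sufficiently rich atom. -/
theorem exists_realizes (hp1 : 1 ≤ p) (hp2 : p ≤ 2) (hκ : 0 ≤ κ)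
    (hstar : F.IsLargestChildSelection star) (t : DyadicTree X) (R : ℝ) {δ : ℝ} (hδ : 0 < δ) :
    ∃ θ : ℝ≥0, θ < 1 ∧ ∀ n, ∀ A ∈ F.atoms n, F.IsRich star θ t.depth n A → ∀ x : X, ‖x‖ ≤ R →
      ∃ f ε, F.Realizes p κ A x ((t.val p (18 * κ) x - δ) * P.real A) f ε := by
  have hp0 : 0 < p := by linarith
  induction t generalizing R δ with
  | leaf =>
    refine ⟨0, one_pos, fun n A _ _ x _ => ⟨0, 0, (realizes_zero hp0 x).mono ?_⟩⟩
    refine mul_le_mul_of_nonneg_right ?_ measureReal_nonneg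
    rw [DyadicTree.val]
    linarith
  | node y l r hl hr =>
    obtain ⟨θl, hθl, hl⟩ := hl (R + 3 * ‖y‖) (half_pos hδ)
    obtain ⟨θr, hθr, hr⟩ := hr (R + 3 * ‖y‖) (half_pos hδ)
    obtain ⟨bl, hbl0, hbl⟩ := l.exists_abs_val_le (κ := 18 * κ) hp0.le (R + 3 * ‖y‖)
    obtain ⟨br, hbr0, hbr⟩ := r.exists_abs_val_le (κ := 18 * κ) hp0.le (R + 3 * ‖y‖)
    -- The law of the cut sits at points other than `x ± y`, so left and right subtrees have no
    -- fixed place. Each exit uses the better of the two, and the maximum is still convex.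
    set ψ : X → ℝ := l.val p (18 * κ) ⊔ r.val p (18 * κ) with hψ
    have hψconv : ConvexOn ℝ Set.univ ψ := (l.convexOn_val hp1).sup (r.convexOn_val hp1)
    set b := bl + br with hb
    have hb0 : 0 ≤ b := add_nonneg hbl0 hbr0
    have hψb : ∀ x, ‖x‖ ≤ R + 3 * ‖y‖ → ψ x ≤ b := fun x hx => by
      refine sup_le ?_ ?_
      · linarith [le_abs_self (l.val p (18 * κ) x), hbl x hx]
      · linarith [le_abs_self (r.val p (18 * κ) x), hbr x hx]
    -- Uncovered mass costs at most `(1 - θ) * b ≤ δ / 2` relative to `P A`; the other half of `δ`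
    -- is spent on the realizations in the exits.
    set θ₀ : ℝ≥0 := (1 - δ / (2 * (b + 1))).toNNReal with hθ₀
    have hθ₀1 : θ₀ < 1 := by
      rw [hθ₀, Real.toNNReal_lt_one]
      have : 0 < δ / (2 * (b + 1)) := by positivity
      linarith
    -- The lower bound `1 / 3` guarantees the existence of a cut.
    refine ⟨θl ⊔ θr ⊔ θ₀ ⊔ 1 / 3, by
      refine max_lt (max_lt (max_lt hθl hθr) hθ₀1) ?_
      rw [div_lt_one (by norm_num)]; norm_num, fun n A hA hrich x hx => ?_⟩
    set θ : ℝ≥0 := θl ⊔ θr ⊔ θ₀ ⊔ 1 / 3 with hθ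
    have hlθ : θl ≤ θ := le_sup_of_le_left (le_sup_of_le_left le_sup_left)
    have hrθ : θr ≤ θ := le_sup_of_le_left (le_sup_of_le_left le_sup_right)
    have h0θ : θ₀ ≤ θ := le_sup_of_le_left le_sup_right
    have h3θ : 1 / 3 ≤ θ := le_sup_right
    obtain ⟨T, hT, hmass⟩ := hrich
    have hTe : ∀ e ∈ T, F.IsExit star n A e := fun e he => (hT e he).1
    have hApos := F.measureReal_pos hA
    obtain ⟨U, hU, hU1, hU2⟩ := exists_isCut hstar hA hTe (by
      calc P A = 3 * ((1 / 3 : ℝ≥0) * P A) := by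
            rw [← mul_assoc]
            have : (3 : ℝ≥0∞) * (1 / 3 : ℝ≥0) = 1 := by
              norm_cast
              norm_num
            rw [this, one_mul]
        _ ≤ 3 * (θ * P A) := by gcongr
        _ ≤ _ := by gcongr)
    have hUA := hU.subset hstar hA
    have hUm := hU.measurableSet
    have hU1' := ENNReal.toReal_mono (by finiteness) hU1
    have hU2' := ENNReal.toReal_mono (by finiteness) hU2
    simp only [ENNReal.toReal_mul, ENNReal.toReal_ofNat] at hU1' hU2'
    change P.real A ≤ 3 * P.real U at hU1'
    change 3 * P.real U ≤ 2 * P.real A at hU2'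
    set q := P.real U / P.real A with hq
    have hqA : q * P.real A = P.real U := div_mul_cancel₀ _ hApos.ne'
    have hq1 : 1 / 3 ≤ q := by rw [hq, div_le_div_iff₀ (by norm_num) hApos]; linarith
    have hq2 : q ≤ 2 / 3 := by rw [hq, div_le_div_iff₀ hApos (by norm_num)]; linarith
    classical
    set z : ℕ × Set Ω → ℝ := fun e => if e.2 ⊆ U then 1 - q else -q with hz
    have hz1 : ∀ e, |z e| ≤ 1 := by
      intro e
      simp only [hz]
      split_ifs <;> rw [abs_le] <;> constructor <;> linarith
    have hzcut : ∀ e ∈ T, ∀ ω ∈ e.2, cutFunction P A U ω = z e := by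
      intro e he ω hω
      by_cases h : e.2 ⊆ U
      · simp only [hz, h, if_true]
        exact cutFunction_of_mem hUA (h hω)
      · simp only [hz, h, if_false]
        have hdis := (hU.subset_or_disjoint hstar hA (hTe e he)).resolve_left h
        exact cutFunction_of_notMem ((hTe e he).subset hstar hA hω) (Set.disjoint_left.1 hdis hω)
    set y' : X := (3 : ℝ) • y with hy'
    have hny' : ‖y'‖ = 3 * ‖y‖ := by rw [hy', norm_smul]; norm_num
    have hxe : ∀ c : ℝ, |c| ≤ 1 → ‖x + c • y'‖ ≤ R + 3 * ‖y‖ := by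
      intro c hc
      refine (norm_add_le _ _).trans (add_le_add hx ?_)
      rw [norm_smul, hny']
      exact mul_le_of_le_one_left (by positivity) hc
    have hex : ∀ e ∈ T, ∃ f ε, F.Realizes p κ e.2 (x + z e • y')
        ((ψ (x + z e • y') - δ / 2) * P.real e.2) f ε := by
      intro e he
      have hmem := (hTe e he).mem_atoms
      have hrl : F.IsRich star θl l.depth e.1 e.2 :=
        ((hT e he).2.mono hlθ).mono_depth (le_max_left _ _)
      have hrr : F.IsRich star θr r.depth e.1 e.2 :=
        ((hT e he).2.mono hrθ).mono_depth (le_max_right _ _)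
      rcases le_total (l.val p (18 * κ) (x + z e • y')) (r.val p (18 * κ) (x + z e • y')) with h | h
      · rw [hψ, Pi.sup_apply, sup_eq_right.2 h]
        exact hr _ _ hmem hrr _ (hxe _ (hz1 e))
      · rw [hψ, Pi.sup_apply, sup_eq_left.2 h]
        exact hl _ _ hmem hrl _ (hxe _ (hz1 e))
    choose! f ε hf using hex
    refine ⟨_, _, (realizes_glue hp1 hstar hA hU hTe x y' z hzcut f ε _ hf).mono ?_⟩
    have hTm : ∀ e ∈ T, MeasurableSet e.2 := fun e he =>
      F.measurableSet_of_mem_atoms (hTe e he).mem_atoms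
    have hsub : ∀ S ⊆ T, ∀ V : Set Ω, (∀ e ∈ S, e.2 ⊆ V) → ∑ e ∈ S, P.real e.2 ≤ P.real V := by
      intro S hS V hV
      rw [← measureReal_biUnion_finset (f := Prod.snd)
        (fun e he e' he' hne => (hTe e (hS he)).disjoint hstar (hTe e' (hS he')) hA hne)
        fun e he => hTm e (hS he)]
      exact measureReal_mono (Set.iUnion₂_subset hV)
    set T₁ := T.filter fun e => e.2 ⊆ U with hT₁
    set T₂ := T.filter fun e => ¬ e.2 ⊆ U with hT₂
    have hsplit : ∀ g : ℕ × Set Ω → ℝ, ∑ e ∈ T, g e = ∑ e ∈ T₁, g e + ∑ e ∈ T₂, g e := fun g =>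
      (Finset.sum_filter_add_sum_filter_not T _ g).symm
    have ht₁ : ∑ e ∈ T₁, P.real e.2 ≤ P.real U :=
      hsub T₁ (Finset.filter_subset _ _) U fun e he => (Finset.mem_filter.1 he).2
    have ht₂ : ∑ e ∈ T₂, P.real e.2 ≤ P.real A - P.real U := by
      rw [← measureReal_sdiff hUA hUm]
      refine hsub T₂ (Finset.filter_subset _ _) _ fun e he => ?_
      obtain ⟨he, h⟩ := Finset.mem_filter.1 he
      have hdis := (hU.subset_or_disjoint hstar hA (hTe e he)).resolve_left h
      exact fun ω hω => ⟨(hTe e he).subset hstar hA hω, Set.disjoint_left.1 hdis hω⟩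
    have hθmass : θ * P.real A ≤ ∑ e ∈ T₁, P.real e.2 + ∑ e ∈ T₂, P.real e.2 := by
      rw [← hsplit]
      have h := ENNReal.toReal_mono (ENNReal.sum_ne_top.2 fun e _ => measure_ne_top P e.2) hmass
      rwa [ENNReal.toReal_mul, ENNReal.toReal_sum fun e _ => measure_ne_top P e.2] at h
    set t₁ := ∑ e ∈ T₁, P.real e.2
    set t₂ := ∑ e ∈ T₂, P.real e.2
    set ψ₁ := ψ (x + (1 - q) • y') with hψ₁
    set ψ₂ := ψ (x + (-q) • y') with hψ₂
    have hsum : ∑ e ∈ T, (ψ (x + z e • y') - δ / 2) * P.real e.2 =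
        (ψ₁ - δ / 2) * t₁ + (ψ₂ - δ / 2) * t₂ := by
      rw [hsplit, Finset.mul_sum, Finset.mul_sum]
      congr 1
      · refine Finset.sum_congr rfl fun e he => ?_
        simp only [hz, (Finset.mem_filter.1 he).2, if_true, hψ₁]
      · refine Finset.sum_congr rfl fun e he => ?_
        simp only [hz, (Finset.mem_filter.1 he).2, if_false, hψ₂]
    have hψ₁b : ψ₁ ≤ b := hψb _ (hxe _ (by rw [abs_le]; constructor <;> linarith))
    have hψ₂b : ψ₂ ≤ b := hψb _ (hxe _ (by rw [abs_le]; constructor <;> linarith))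
    have hconv := hψconv.half_add_le_of_mem_Icc x y hq1 hq2
    have hvl : l.val p (18 * κ) (x + y) ≤ ψ (x + y) := le_sup_left
    have hvr : r.val p (18 * κ) (x - y) ≤ ψ (x - y) := le_sup_right
    have hθb : (1 - (θ : ℝ)) * b ≤ δ / 2 := by
      have h1 : 1 - δ / (2 * (b + 1)) ≤ θ := (Real.le_coe_toNNReal _).trans (by exact_mod_cast h0θ)
      calc (1 - (θ : ℝ)) * b ≤ δ / (2 * (b + 1)) * b := by
            gcongr
            linarith
        _ ≤ δ / (2 * (b + 1)) * (b + 1) := by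
            gcongr
            linarith
        _ = δ / 2 := by field_simp
    have hy'p : ‖y'‖ ^ p ≤ 9 * ‖y‖ ^ p := by
      rw [hny', Real.mul_rpow (by norm_num) (norm_nonneg y)]
      gcongr
      calc (3 : ℝ) ^ p ≤ 3 ^ (2 : ℝ) := Real.rpow_le_rpow_of_exponent_le (by norm_num) hp2
        _ = 9 := by norm_num
    rw [hsum, DyadicTree.val]
    have h1 : ((l.val p (18 * κ) (x + y) + r.val p (18 * κ) (x - y)) / 2) * P.real A ≤
        ψ₁ * P.real U + ψ₂ * (P.real A - P.real U) := by
      calc _ ≤ (q * ψ₁ + (1 - q) * ψ₂) * P.real A := by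
            gcongr
            linarith
        _ = ψ₁ * (q * P.real A) + ψ₂ * (P.real A - q * P.real A) := by ring
        _ = _ := by rw [hqA]
    have h2 : ψ₁ * P.real U + ψ₂ * (P.real A - P.real U) - (ψ₁ * t₁ + ψ₂ * t₂) ≤
        δ / 2 * P.real A := by
      calc _ = ψ₁ * (P.real U - t₁) + ψ₂ * (P.real A - P.real U - t₂) := by ring
        _ ≤ b * (P.real U - t₁) + b * (P.real A - P.real U - t₂) := by
            gcongr
        _ = b * (P.real A - (t₁ + t₂)) := by ring
        _ ≤ b * (P.real A - θ * P.real A) := by gcongr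
        _ = (1 - θ) * b * P.real A := by ring
        _ ≤ _ := by gcongr
    have h3 : δ / 2 * (t₁ + t₂) ≤ δ / 2 * P.real A := by
      gcongr
      linarith
    -- The constant 18 is the factor 2 from the energy of the cut times `3 ^ p ≤ 9` from the
    -- enlarged spread.
    have h4 : κ * (2 * ‖y'‖ ^ p * P.real A) ≤ 18 * κ * ‖y‖ ^ p * P.real A := by
      calc κ * (2 * ‖y'‖ ^ p * P.real A) ≤ κ * (2 * (9 * ‖y‖ ^ p) * P.real A) := by gcongr
        _ = _ := by ring
    linarith

/-- On a filtered space with infinite Carleson constant, the upper estimate bounds the functionals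
of all dyadic martingales. -/
theorem val_le_of_upperEstimate (hp1 : 1 < p) (hp2 : p ≤ 2) (hstar : F.IsLargestChildSelection star)
    (hinf : carlesonConstant P (F.nonLargest star) = ∞) {C : ℝ≥0} (hC : F.UpperEstimate p X C)
    (t : DyadicTree X) (x : X) : t.val p (18 * (2 * (C : ℝ) ^ p)) x ≤ 2 * ‖x‖ ^ p := by
  have hp0 : 0 < p := by linarith
  refine le_of_forall_pos_le_add fun δ hδ => ?_
  have hκ : 0 ≤ 2 * (C : ℝ) ^ p := by positivity
  obtain ⟨θ, hθ, h⟩ := exists_realizes hp1.le hp2 hκ hstar t ‖x‖ hδ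
  obtain ⟨n, A, hA, hrich⟩ := exists_isRich hstar hinf hθ t.depth
  obtain ⟨f, ε, hf⟩ := h n A hA hrich x le_rfl
  obtain ⟨b, hb⟩ := hf.bounded
  have hApos := F.measureReal_pos hA
  have hfint := integrable_norm_add_rpow (P := P) hp0.le hf.stronglyMeasurable hb
  have hmem : MemLp f (ENNReal.ofReal p) P :=
    MemLp.of_bound hf.stronglyMeasurable.aestronglyMeasurable b (ae_of_all _ hb)
  have hf0 : Integrable (fun ω => ‖f ω‖ ^ p) P := by simpa using hfint 0
  -- The estimate is applied to the mean zero function `f`, and `x` is restored by `‖x + f‖ ^ p ≤ 2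
  -- * ‖x‖ ^ p + 2 * ‖f‖ ^ p`. With `κ = 2 * C ^ p` the energy terms then cancel.
  have hup := (F.upperEstimate_iff hp1 C).1 hC f hmem
  rw [hf.integral_eq_zero, enorm_zero, ENNReal.zero_rpow_of_pos hp0, zero_add] at hup
  have hfp : ∫ ω, ‖f ω‖ ^ p ∂P ≤ (C : ℝ) ^ p * ε := by
    have h1 : ENNReal.ofReal (∫ ω, ‖f ω‖ ^ p ∂P) ≤ ENNReal.ofReal ((C : ℝ) ^ p * ε) := by
      rw [ofReal_integral_eq_lintegral_ofReal hf0 (ae_of_all _ fun ω => by positivity),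
        ENNReal.ofReal_mul (by positivity), ← ENNReal.ofReal_rpow_of_nonneg C.coe_nonneg hp0.le,
        ENNReal.ofReal_coe_nnreal]
      simp only [← enorm_rpow_eq_ofReal _ hp0.le]
      refine hup.trans ?_
      gcongr
      exact hf.energy_le
    exact (ENNReal.ofReal_le_ofReal_iff (mul_nonneg (by positivity) hf.nonneg)).1 h1
  have hle : ∫ ω in A, ‖x + f ω‖ ^ p ∂P ≤ 2 * ‖x‖ ^ p * P.real A + 2 * ((C : ℝ) ^ p * ε) := by
    calc ∫ ω in A, ‖x + f ω‖ ^ p ∂P ≤ ∫ ω in A, (2 * ‖x‖ ^ p + 2 * ‖f ω‖ ^ p) ∂P := by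
          refine setIntegral_mono (hfint x).integrableOn
            (((integrable_const _).add (hf0.const_mul 2)).integrableOn) fun ω => ?_
          have := add_rpow_le_of_weight hp1 hp2 one_pos le_rfl one_pos le_rfl (norm_nonneg x)
            (norm_nonneg (f ω))
          simp only [mul_one, Real.one_rpow, div_one] at this
          refine (Real.rpow_le_rpow (norm_nonneg _) (norm_add_le _ _) hp0.le).trans ?_
          linarith
      _ = 2 * ‖x‖ ^ p * P.real A + 2 * ∫ ω in A, ‖f ω‖ ^ p ∂P := by
          rw [integral_add (integrable_const _).integrableOn (hf0.const_mul 2).integrableOn,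
            setIntegral_const, integral_const_mul, smul_eq_mul, mul_comm]
      _ ≤ 2 * ‖x‖ ^ p * P.real A + 2 * ∫ ω, ‖f ω‖ ^ p ∂P := by
          exact add_le_add le_rfl (mul_le_mul_of_nonneg_left
            (setIntegral_le_integral hf0 (ae_of_all _ fun ω => by positivity)) zero_le_two)
      _ ≤ _ := by gcongr
  have hfin := hf.le.trans hle
  have : (t.val p (18 * (2 * (C : ℝ) ^ p)) x - δ) * P.real A ≤ 2 * ‖x‖ ^ p * P.real A := by
    linarith
  linarith [le_of_mul_le_mul_right this hApos]

end AtomicFiltration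

/-! ### From dyadic martingales to all martingales -/

/-- The supremum of the functionals of all dyadic martingales. -/
noncomputable def dyadicSup {X : Type*} [NormedAddCommGroup X] (p κ : ℝ) (x : X) : ℝ :=
  ⨆ t : DyadicTree X, t.val p κ x

section DyadicSup

variable {X : Type*} [NormedAddCommGroup X] {p κ M : ℝ}

instance : Nonempty (DyadicTree X) := ⟨.leaf⟩

variable (hval : ∀ (t : DyadicTree X) (x : X), t.val p κ x ≤ M * ‖x‖ ^ p)
include hval

lemma val_le_dyadicSup (t : DyadicTree X) (x : X) : t.val p κ x ≤ dyadicSup p κ x :=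
  le_ciSup (f := fun t : DyadicTree X => t.val p κ x)
    ⟨M * ‖x‖ ^ p, by rintro _ ⟨t, rfl⟩; exact hval t x⟩ t

lemma norm_rpow_le_dyadicSup (x : X) : ‖x‖ ^ p ≤ dyadicSup p κ x :=
  val_le_dyadicSup hval .leaf x

lemma dyadicSup_le (x : X) : dyadicSup p κ x ≤ M * ‖x‖ ^ p :=
  ciSup_le fun t => hval t x

/-- Near-optimal trees for `x + y` and `x - y`, joined under a root with increment `y`, compete in
the supremum at `x`. -/
lemma dyadicSup_add_dyadicSup_le (x y : X) :
    dyadicSup p κ (x + y) + dyadicSup p κ (x - y) ≤ 2 * dyadicSup p κ x + 2 * κ * ‖y‖ ^ p := by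
  have h : ∀ t t' : DyadicTree X, t.val p κ (x + y) + t'.val p κ (x - y) ≤
      2 * dyadicSup p κ x + 2 * κ * ‖y‖ ^ p := by
    intro t t'
    have h := val_le_dyadicSup hval (.node y t t') x
    rw [DyadicTree.val] at h
    linarith
  have h1 : ∀ t' : DyadicTree X, dyadicSup p κ (x + y) ≤
      2 * dyadicSup p κ x + 2 * κ * ‖y‖ ^ p - t'.val p κ (x - y) := fun t' =>
    ciSup_le fun t => by linarith [h t t']
  have h2 : dyadicSup p κ (x - y) ≤
      2 * dyadicSup p κ x + 2 * κ * ‖y‖ ^ p - dyadicSup p κ (x + y) :=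
    ciSup_le fun t' => by linarith [h1 t']
  linarith

variable [NormedSpace ℝ X]

lemma convexOn_dyadicSup (hp : 1 ≤ p) : ConvexOn ℝ Set.univ (dyadicSup p κ : X → ℝ) := by
  refine ⟨convex_univ, fun x _ y _ a b ha hb hab => ciSup_le fun t => ?_⟩
  refine ((t.convexOn_val hp).2 (Set.mem_univ x) (Set.mem_univ y) ha hb hab).trans ?_
  exact add_le_add (mul_le_mul_of_nonneg_left (val_le_dyadicSup hval t x) ha)
    (mul_le_mul_of_nonneg_left (val_le_dyadicSup hval t y) hb)

/-- A convex function that is bounded above near one point is continuous. Continuity supplies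
measurability and the hypothesis of Jensen's inequality. -/
lemma continuous_dyadicSup (hp : 1 ≤ p) (hM : 0 ≤ M) : Continuous (dyadicSup p κ : X → ℝ) := by
  have htfae := (convexOn_dyadicSup hval hp).continuousOn_tfae isOpen_univ Set.univ_nonempty
  have h : ContinuousOn (dyadicSup p κ : X → ℝ) Set.univ := by
    refine (htfae.out 1 3).2 ?_
    refine ⟨0, Set.mem_univ _, M, Filter.eventually_map.2 ?_⟩
    filter_upwards [Metric.ball_mem_nhds (0 : X) one_pos] with x hx
    refine (dyadicSup_le hval x).trans (mul_le_of_le_one_right hM ?_)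
    exact Real.rpow_le_one (norm_nonneg x) (mem_ball_zero_iff.1 hx).le (by linarith)
  exact continuousOn_univ.1 h

variable [CompleteSpace X]

/-- One step of a martingale: Jensen's inequality turns the two-point inequality into an inequality
for all mean zero increments. -/
lemma integral_dyadicSup_le {Ω : Type*} [MeasurableSpace Ω] (μ : Measure Ω)
    [IsProbabilityMeasure μ] (hp : 1 ≤ p) (hM : 0 ≤ M) {g : Ω → X}
    (hg : MemLp g (ENNReal.ofReal p) μ) :
    Integrable (fun ω => dyadicSup p κ (g ω)) μ ∧
    ∫ ω, dyadicSup p κ (g ω) ∂μ ≤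
      dyadicSup p κ (∫ ω, g ω ∂μ) + 2 * κ * ∫ ω, ‖g ω - ∫ ω, g ω ∂μ‖ ^ p ∂μ := by
  have hp0 : 0 < p := by linarith
  have hcont := continuous_dyadicSup hval hp hM
  have hgi : Integrable g μ := hg.integrable (by simpa using hp)
  have hp' : ENNReal.ofReal p ≠ 0 := by simpa using hp0
  set x := ∫ ω, g ω ∂μ with hx
  have hfint : ∀ f : Ω → X, MemLp f (ENNReal.ofReal p) μ →
      Integrable (fun ω => ‖f ω‖ ^ p) μ := by
    intro f hf
    have := hf.integrable_norm_rpow hp' ENNReal.ofReal_ne_top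
    rwa [ENNReal.toReal_ofReal hp0.le] at this
  have hsup : ∀ f : Ω → X, MemLp f (ENNReal.ofReal p) μ →
      Integrable (fun ω => dyadicSup p κ (f ω)) μ := by
    intro f hf
    refine ((hfint f hf).const_mul M).mono' (hcont.comp_aestronglyMeasurable hf.1)
      (ae_of_all _ fun ω => ?_)
    rw [Real.norm_of_nonneg ((by positivity : 0 ≤ ‖f ω‖ ^ p).trans
      (norm_rpow_le_dyadicSup hval (f ω)))]
    exact dyadicSup_le hval (f ω)
  refine ⟨hsup g hg, ?_⟩
  -- The reflection of `g` in its mean. The two-point inequality with increment `g ω - x` bounds the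
  -- sum for `g` and `r`, and Jensen's inequality, `r` also having mean `x`, removes one copy of the
  -- value at `x`.
  set r : Ω → X := fun ω => x - (g ω - x) with hr
  have hd : MemLp (fun ω => g ω - x) (ENNReal.ofReal p) μ := hg.sub (memLp_const x)
  have hrm : MemLp r (ENNReal.ofReal p) μ := (memLp_const x).sub hd
  have hrint : ∫ ω, r ω ∂μ = x := by
    simp only [hr]
    have hgx : Integrable (fun ω => g ω - x) μ := hgi.sub (integrable_const x)
    rw [integral_sub (integrable_const x) hgx, integral_sub hgi (integrable_const x)]
    simp [hx]
  have hjensen : dyadicSup p κ x ≤ ∫ ω, dyadicSup p κ (r ω) ∂μ := by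
    have := (convexOn_dyadicSup hval hp).map_integral_le hcont.continuousOn isClosed_univ
      (ae_of_all μ fun ω => Set.mem_univ (r ω)) (hrm.integrable (by simpa using hp)) (hsup r hrm)
    rwa [hrint] at this
  have hmid : ∫ ω, (dyadicSup p κ (g ω) + dyadicSup p κ (r ω)) ∂μ ≤
      ∫ ω, (2 * dyadicSup p κ x + 2 * κ * ‖g ω - x‖ ^ p) ∂μ := by
    refine integral_mono ((hsup g hg).add (hsup r hrm))
      ((integrable_const _).add ((hfint _ hd).const_mul _)) fun ω => ?_
    have := dyadicSup_add_dyadicSup_le hval x (g ω - x)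
    rwa [add_sub_cancel] at this
  rw [integral_add (hsup g hg) (hsup r hrm), integral_add (integrable_const _)
    ((hfint _ hd).const_mul _), integral_const, integral_const_mul (2 * κ)] at hmid
  simp only [probReal_univ, one_smul] at hmid
  linarith

end DyadicSup

/-- A bound for the functionals of all dyadic martingales implies the upper estimate for all
martingales. -/
theorem AtomicFiltration.upperEstimate_of_val_le {Ω X : Type*} [NormedAddCommGroup X]
    [NormedSpace ℝ X] [CompleteSpace X] [MeasurableSpace Ω] {P : Measure Ω}
    [IsProbabilityMeasure P] (F : AtomicFiltration P) {p : ℝ} (hp : 1 < p) {κ M : ℝ≥0}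
    (hval : ∀ (t : DyadicTree X) (x : X), t.val p κ x ≤ M * ‖x‖ ^ p) :
    F.UpperEstimate p X ((M + 2 * κ) ^ (1 / p)) := by
  have hp0 : 0 < p := by linarith
  refine F.upperEstimate_of_potential hp (fun _ _ x => ENNReal.ofReal (dyadicSup p κ x)) ?_ ?_ ?_
  · intro _ _ _ x
    rw [enorm_rpow_eq_ofReal _ hp0.le]
    exact ENNReal.ofReal_le_ofReal (norm_rpow_le_dyadicSup hval x)
  · intro x
    refine (ENNReal.ofReal_le_ofReal (dyadicSup_le hval x)).trans ?_
    rw [ENNReal.ofReal_mul M.coe_nonneg, ENNReal.ofReal_coe_nnreal, enorm_rpow_eq_ofReal _ hp0.le]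
    gcongr
    exact le_self_add
  · intro n A hA g hg _
    have hA0 := (F.measure_atoms_pos n A hA).ne'
    have hAtop := measure_ne_top P A
    -- On the normalized atom the one-step inequality is exactly `integral_dyadicSup_le`.
    set μ : Measure Ω := (P A)⁻¹ • P.restrict A with hμ
    have hprob : IsProbabilityMeasure μ := ⟨by
      rw [hμ, Measure.smul_apply, Measure.restrict_apply_univ, smul_eq_mul,
        ENNReal.inv_mul_cancel hA0 hAtop]⟩
    have hgμ : MemLp g (ENNReal.ofReal p) μ :=
      (hg.restrict A).smul_measure (ENNReal.inv_ne_top.2 hA0)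
    obtain ⟨hi, hle⟩ := integral_dyadicSup_le hval μ hp.le M.coe_nonneg hgμ
    have hav : ∫ ω, g ω ∂μ = ⨍ ω in A, g ω ∂P := by
      rw [hμ, average, Measure.restrict_apply_univ]
    rw [hav] at hle
    set x := ⨍ ω in A, g ω ∂P
    have hlint : ∀ h : Ω → ℝ≥0∞, ∫⁻ ω in A, h ω ∂P = P A * ∫⁻ ω, h ω ∂μ := by
      intro h
      rw [hμ, lintegral_smul_measure, smul_eq_mul, ← mul_assoc, ENNReal.mul_inv_cancel hA0 hAtop,
        one_mul]
    have hd : MemLp (fun ω => g ω - x) (ENNReal.ofReal p) μ := hgμ.sub (memLp_const x)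
    have hdint : Integrable (fun ω => ‖g ω - x‖ ^ p) μ := by
      have := hd.integrable_norm_rpow (by simpa using hp0) ENNReal.ofReal_ne_top
      rwa [ENNReal.toReal_ofReal hp0.le] at this
    have hsup0 : ∀ x : X, 0 ≤ dyadicSup p κ x := fun x =>
      (by positivity : (0 : ℝ) ≤ ‖x‖ ^ p).trans (norm_rpow_le_dyadicSup hval x)
    rw [hlint, hlint, mul_left_comm, ← mul_add]
    gcongr
    simp only [enorm_rpow_eq_ofReal _ hp0.le]
    rw [← ofReal_integral_eq_lintegral_ofReal hi (ae_of_all _ fun ω => hsup0 _),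
      ← ofReal_integral_eq_lintegral_ofReal hdint (ae_of_all _ fun ω => by positivity)]
    refine (ENNReal.ofReal_le_ofReal hle).trans ?_
    rw [ENNReal.ofReal_add (hsup0 x) (by positivity), ENNReal.ofReal_mul (by positivity)]
    gcongr
    rw [← ENNReal.ofReal_coe_nnreal]
    refine ENNReal.ofReal_le_ofReal ?_
    push_cast
    linarith [M.coe_nonneg]

/-- If the Carleson constant is infinite, then the upper estimate on the given filtered space
implies martingale type `p`. -/
theorem AtomicFiltration.determinesMartingaleType_of_carlesonConstant_eq_top {Ω : Type*}
    [MeasurableSpace Ω] {P : Measure Ω} [IsProbabilityMeasure P] (F : AtomicFiltration P)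
    {star : ℕ → Set Ω → Set Ω} (hstar : F.IsLargestChildSelection star) {p : ℝ} (hp1 : 1 < p)
    (hp2 : p ≤ 2) (hinf : carlesonConstant P (F.nonLargest star) = ∞) :
    DeterminesMartingaleType F p := by
  rintro X _ _ _ ⟨C, _, hC⟩
  refine ⟨(2 + 2 * (18 * (2 * C ^ p))) ^ (1 / p), by positivity, fun Ω' _ P' _ F' => ?_⟩
  refine F'.upperEstimate_of_val_le hp1 fun t x => ?_
  have h := AtomicFiltration.val_le_of_upperEstimate hp1 hp2 hstar hinf hC t x
  simpa using h

/-! ### The space `ℓ¹` has no martingale type `p > 1` -/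

namespace RademacherSpace

/-- The space of `N` signs. -/
abbrev Space (N : ℕ) : Type w := ULift.{w} (Fin N → Bool)

variable {N : ℕ}

instance : MeasurableSpace (Space.{w} N) := ⊤

instance : DiscreteMeasurableSpace (Space.{w} N) := ⟨fun _ => trivial⟩

/-- The uniform probability measure on the space of `N` signs. -/
noncomputable def unif (N : ℕ) : Measure (Space.{w} N) :=
  (Fintype.card (Space.{w} N) : ℝ≥0∞)⁻¹ • Measure.count

instance : IsProbabilityMeasure (unif.{w} N) := ⟨by
  rw [unif, Measure.smul_apply, Measure.count_univ, ENat.card_eq_coe_fintype_card, smul_eq_mul]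
  exact ENNReal.inv_mul_cancel (by simp) (by simp)⟩

lemma unif_pos {A : Set (Space.{w} N)} (hA : A.Nonempty) : 0 < unif N A := by
  rw [unif, Measure.smul_apply, smul_eq_mul]
  refine ENNReal.mul_pos (by simp) ?_
  rw [Ne, Measure.count_eq_zero_iff]
  exact hA.ne_empty

/-- The set of all sequences of signs that agree with `ω` in the first `n` places. -/
def cylinder (n : ℕ) (ω : Space.{w} N) : Set (Space.{w} N) :=
  {ω' | ∀ i : Fin N, i.1 < n → ω'.down i = ω.down i}

lemma mem_cylinder_self (n : ℕ) (ω : Space.{w} N) : ω ∈ cylinder n ω := fun _ _ => rfl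

lemma cylinder_eq {n : ℕ} {ω ω' : Space.{w} N} (h : ω' ∈ cylinder n ω) :
    cylinder n ω' = cylinder n ω := by
  ext x
  exact ⟨fun hx i hi => (hx i hi).trans (h i hi), fun hx i hi => (hx i hi).trans (h i hi).symm⟩

lemma cylinder_anti {n k : ℕ} (hnk : n ≤ k) (ω : Space.{w} N) : cylinder k ω ⊆ cylinder n ω :=
  fun _ hx i hi => hx i (hi.trans_le hnk)

lemma measurableSet_cylinder {n k : ℕ} (hnk : n ≤ k) (ω : Space.{w} N) :
    MeasurableSet[MeasurableSpace.generateFrom (Set.range (cylinder (N := N) k))]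
      (cylinder n ω) := by
  have h : cylinder n ω = ⋃ x ∈ cylinder n ω, cylinder k x := by
    ext x
    simp only [Set.mem_iUnion, exists_prop]
    constructor
    · exact fun hx => ⟨x, hx, mem_cylinder_self k x⟩
    · rintro ⟨y, hy, hx⟩
      rw [← cylinder_eq hy]
      exact cylinder_anti hnk y hx
  rw [h]
  exact MeasurableSet.biUnion (Set.to_countable _) fun x _ =>
    MeasurableSpace.measurableSet_generateFrom ⟨x, rfl⟩

/-- The filtration generated by the successive signs. -/
noncomputable def filtration (N : ℕ) : AtomicFiltration (unif.{w} N) where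
  seq n := MeasurableSpace.generateFrom (Set.range (cylinder n))
  mono' n k hnk := MeasurableSpace.generateFrom_le <| by
    rintro _ ⟨ω, rfl⟩
    exact measurableSet_cylinder hnk ω
  le' n := fun _ _ => trivial
  atoms n := Set.range (cylinder n)
  countable_atoms n := Set.countable_range _
  pairwiseDisjoint_atoms n := by
    rintro _ ⟨ω, rfl⟩ _ ⟨ω', rfl⟩ hne
    refine Set.disjoint_left.2 fun x hx hx' => hne ?_
    rw [← cylinder_eq hx, ← cylinder_eq hx']
  sUnion_atoms n := Set.eq_univ_of_forall fun ω => ⟨_, ⟨ω, rfl⟩, mem_cylinder_self n ω⟩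
  measure_atoms_pos n := by
    rintro _ ⟨ω, rfl⟩
    exact unif_pos ⟨ω, mem_cylinder_self n ω⟩
  seq_eq_generateFrom _ := rfl
  atoms_zero := by
    have h : ∀ ω : Space.{w} N, cylinder 0 ω = Set.univ := fun ω =>
      Set.eq_univ_of_forall fun x i hi => absurd hi (Nat.not_lt_zero _)
    rw [funext h, Set.range_const]
  iSup_seq := by
    refine le_antisymm (iSup_le fun n _ _ => trivial) ?_
    -- Cylinders of length `N` are single points, so level `N` already contains every set.
    refine le_trans ?_ (le_iSup _ N)
    intro s _
    have h : s = ⋃ x ∈ s, cylinder N x := by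
      ext x
      simp only [Set.mem_iUnion, exists_prop]
      constructor
      · exact fun hx => ⟨x, hx, mem_cylinder_self N x⟩
      · rintro ⟨y, hy, hx⟩
        have : x = y := ULift.ext _ _ (funext fun i => hx i i.2)
        rwa [this]
    rw [h]
    exact MeasurableSet.biUnion (Set.to_countable _) fun x _ =>
      MeasurableSpace.measurableSet_generateFrom ⟨x, rfl⟩

/-- The `k`-th sign. -/
def sign (k : Fin N) (ω : Space.{w} N) : ℝ := if ω.down k then 1 else -1

lemma abs_sign (k : Fin N) (ω : Space.{w} N) : |sign k ω| = 1 := by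
  unfold sign
  split_ifs <;> simp

/-- Flipping the `k`-th sign preserves the cylinder when `n ≤ k` and changes the sign of the
integrand. -/
lemma setIntegral_sign {n : ℕ} {k : Fin N} (hk : n ≤ k.1) (ω : Space.{w} N) :
    ∫ x in cylinder n ω, sign k x ∂(unif N) = 0 := by
  classical
  rw [← integral_indicator (MeasurableSet.of_discrete), unif, integral_smul_measure, integral_count]
  have : ∑ x, (cylinder n ω).indicator (sign k) x = 0 := by
    refine Finset.sum_involution
      (fun x _ => (⟨Function.update x.down k (!x.down k)⟩ : Space.{w} N)) ?_ ?_ ?_ ?_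
    · intro x _
      have hmem : (⟨Function.update x.down k (!x.down k)⟩ : Space.{w} N) ∈ cylinder n ω ↔
          x ∈ cylinder n ω := by
        refine forall₂_congr fun i hi => ?_
        have : i ≠ k := fun h => by omega
        simp [Function.update_of_ne this]
      by_cases hx : x ∈ cylinder n ω
      · rw [Set.indicator_of_mem hx, Set.indicator_of_mem (hmem.2 hx)]
        cases h : x.down k <;> simp [sign, h]
      · rw [Set.indicator_of_notMem hx, Set.indicator_of_notMem (mt hmem.1 hx), add_zero]
    · intro x _ _ h
      have := congrFun (congrArg ULift.down h) k
      simp at this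
    · simp
    · intro x _
      ext i
      simp
  rw [this, smul_zero]

/-- The space `ℓ¹` in an arbitrary universe. -/
abbrev EllOne : Type v := lp (fun _ : ULift.{v} ℕ => ℝ) 1

/-- The `ℓ¹`-valued Rademacher sum. -/
noncomputable def radSum (N : ℕ) (ω : Space.{w} N) : EllOne.{v} :=
  ∑ k : Fin N, sign k ω • lp.single 1 (ULift.up k.1) (1 : ℝ)

lemma norm_radSum (ω : Space.{w} N) : ‖(radSum N ω : EllOne.{v})‖ = N := by
  let e : Fin N ↪ ULift.{v} ℕ := ⟨fun k => ⟨k.1⟩, fun k l h => Fin.ext (congrArg ULift.down h)⟩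
  let f : ULift.{v} ℕ → ℝ := fun i => if h : i.down < N then sign ⟨i.down, h⟩ ω else 0
  have hf : ∀ k : Fin N, f (e k) = sign k ω := fun k => dif_pos k.2
  have hsum : (radSum N ω : EllOne.{v}) = ∑ i ∈ Finset.univ.map e, lp.single 1 i (f i) := by
    rw [Finset.sum_map]
    refine Finset.sum_congr rfl fun k _ => ?_
    rw [← lp.single_smul, hf, smul_eq_mul, mul_one]
    rfl
  have h := lp.norm_sum_single (p := 1) (E := fun _ : ULift.{v} ℕ => ℝ) (by simp) f
    (Finset.univ.map e)
  rw [← hsum, Finset.sum_map] at h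
  simpa [hf, abs_sign] using h

lemma condExp_radSum (n : ℕ) (ω : Space.{w} N) :
    ((unif N)[(radSum N : Space.{w} N → EllOne.{v}) | (filtration N).seq n]) ω =
      ∑ k : Fin N, if k.1 < n then sign k ω • lp.single 1 (ULift.up k.1) (1 : ℝ) else 0 := by
  have hA : cylinder n ω ∈ (filtration N).atoms n := ⟨ω, rfl⟩
  have hApos := (filtration N).measureReal_pos hA
  rw [(filtration N).condExp_eq_setAverage .of_finite hA (mem_cylinder_self n ω), setAverage_eq]
  unfold radSum
  rw [integral_finsetSum _ fun k _ => Integrable.of_finite.integrableOn, Finset.smul_sum]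
  refine Finset.sum_congr rfl fun k _ => ?_
  rw [integral_smul_const]
  split_ifs with hk
  · rw [setIntegral_congr_fun (g := fun _ => sign k ω) MeasurableSet.of_discrete
      fun x hx => by simp only [sign, hx k hk], setIntegral_const, smul_eq_mul, smul_smul,
      inv_mul_cancel_left₀ hApos.ne']
  · rw [setIntegral_sign (not_lt.1 hk), zero_smul, smul_zero]

lemma enorm_condExp_radSum_sub (n : ℕ) (ω : Space.{w} N) :
    ‖((unif N)[(radSum N : Space.{w} N → EllOne.{v}) | (filtration N).seq (n + 1)]) ω -
      ((unif N)[(radSum N : Space.{w} N → EllOne.{v}) | (filtration N).seq n]) ω‖ₑ =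
        if n < N then 1 else 0 := by
  rw [condExp_radSum, condExp_radSum, ← Finset.sum_sub_distrib]
  split_ifs with hn
  · rw [Finset.sum_eq_single_of_mem (⟨n, hn⟩ : Fin N) (Finset.mem_univ _)]
    · simp only [Nat.lt_succ_self, lt_irrefl, if_true, if_false, sub_zero]
      rw [← ofReal_norm, norm_smul, lp.norm_single (by simp), Real.norm_eq_abs, abs_sign]
      simp
    · intro k _ hk
      have hkn : k.1 ≠ n := fun h => hk (Fin.ext h)
      have : k.1 < n + 1 ↔ k.1 < n := by omega
      simp only [this, sub_self]
  · rw [Finset.sum_eq_zero, enorm_zero]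
    intro k _
    have h1 : k.1 < n := by omega
    have h2 : k.1 < n + 1 := by omega
    simp only [h1, h2, if_true, sub_self]

/-- The space `ℓ¹` does not have martingale type `p > 1`. -/
theorem not_hasMartingaleType_ellOne {p : ℝ} (hp : 1 < p) :
    ¬ HasMartingaleType.{w, v} p EllOne.{v} := by
  rintro ⟨C, _, hC⟩
  have hp0 : 0 < p := by linarith
  -- The Rademacher sum has norm `N` everywhere, while each of its `N` increments has norm one; for
  -- `p > 1` this fails for large `N`.
  have key : ∀ N : ℕ, (N : ℝ) ^ p ≤ (C : ℝ) ^ p * N := by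
    intro N
    have h := ((filtration.{w} N).upperEstimate_iff hp C).1 (hC (Space.{w} N) (unif N) (filtration N))
      (radSum N) (MemLp.of_discrete)
    have hmean : ∫ ω, (radSum N ω : EllOne.{v}) ∂(unif.{w} N) = 0 := by
      rw [← (filtration N).condExp_zero_eq .of_finite ⟨fun _ => true⟩, condExp_radSum]
      simp
    have henergy : (filtration.{w} N).energy p (radSum N : Space.{w} N → EllOne.{v}) = N := by
      simp only [AtomicFiltration.energy, enorm_condExp_radSum_sub, lintegral_const, measure_univ,
        mul_one]
      rw [tsum_eq_sum (s := Finset.range N)]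
      · rw [Finset.sum_congr rfl (g := fun _ => 1) fun n hn => by simp [Finset.mem_range.1 hn]]
        simp
      · intro n hn
        rw [if_neg (by simpa using hn), ENNReal.zero_rpow_of_pos hp0]
    have hnorm : ∫⁻ ω, ‖(radSum N ω : EllOne.{v})‖ₑ ^ p ∂(unif.{w} N) =
        ENNReal.ofReal ((N : ℝ) ^ p) := by
      simp only [enorm_rpow_eq_ofReal _ hp0.le, norm_radSum, lintegral_const, measure_univ, mul_one]
    rw [hmean, enorm_zero, ENNReal.zero_rpow_of_pos hp0, zero_add, henergy, hnorm] at h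
    have h2 : ENNReal.ofReal ((N : ℝ) ^ p) ≤ ENNReal.ofReal ((C : ℝ) ^ p * N) := by
      refine h.trans_eq ?_
      rw [ENNReal.ofReal_mul (by positivity), ← ENNReal.ofReal_rpow_of_nonneg C.coe_nonneg hp0.le,
        ENNReal.ofReal_coe_nnreal, ENNReal.ofReal_natCast]
    exact (ENNReal.ofReal_le_ofReal_iff (by positivity)).1 h2
  have htend := (tendsto_rpow_atTop (sub_pos.2 hp)).comp (tendsto_natCast_atTop_atTop (R := ℝ))
  obtain ⟨N, hN1, hN2⟩ := ((htend.eventually_gt_atTop ((C : ℝ) ^ p)).and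
    (Filter.eventually_gt_atTop 0)).exists
  have hN0 : (0 : ℝ) < N := by exact_mod_cast hN2
  have h := key N
  simp only [Function.comp_apply] at hN1
  rw [Real.rpow_sub_one hN0.ne', lt_div_iff₀ hN0] at hN1
  linarith

end RademacherSpace

/-! ### The dichotomy -/

theorem theorem1 {Ω : Type u} [MeasurableSpace Ω] (P : Measure Ω)
    [IsProbabilityMeasure P] (F : AtomicFiltration P) (p : ℝ) (hp1 : 1 < p) (hp2 : p ≤ 2) :
    ((EstimateForAll.{v, u} F p ∨ DeterminesMartingaleType.{w, v, u} F p) ∧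
      ¬ (EstimateForAll.{v, u} F p ∧ DeterminesMartingaleType.{w, v, u} F p)) ∧
    ∀ star : ℕ → Set Ω → Set Ω, F.IsLargestChildSelection star →
      (EstimateForAll.{v, u} F p ↔ carlesonConstant P (F.nonLargest star) < ∞) ∧
      (DeterminesMartingaleType.{w, v, u} F p ↔ carlesonConstant P (F.nonLargest star) = ∞) := by
  -- With this exclusion, the implications for finite and for infinite Carleson constant become
  -- equivalences, for each selection of largest children.
  have hnot : ¬ (EstimateForAll.{v, u} F p ∧ DeterminesMartingaleType.{w, v, u} F p) := by
    rintro ⟨⟨C, hC, ha⟩, hb⟩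
    exact RademacherSpace.not_hasMartingaleType_ellOne hp1
      (hb RademacherSpace.EllOne.{v} ⟨C, hC, ha _⟩)
  have ha : ∀ star, F.IsLargestChildSelection star →
      carlesonConstant P (F.nonLargest star) < ∞ → EstimateForAll.{v, u} F p :=
    fun star hstar h => F.estimateForAll_of_carlesonConstant_lt_top hstar hp1 hp2 h
  have hb : ∀ star, F.IsLargestChildSelection star →
      carlesonConstant P (F.nonLargest star) = ∞ → DeterminesMartingaleType.{w, v, u} F p :=
    fun star hstar h => F.determinesMartingaleType_of_carlesonConstant_eq_top hstar hp1 hp2 h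
  refine ⟨⟨?_, hnot⟩, fun star hstar => ⟨⟨fun h => ?_, ha star hstar⟩, ⟨fun h => ?_, hb star hstar⟩⟩⟩
  · obtain ⟨star, hstar⟩ := F.exists_isLargestChildSelection
    rcases (le_top (a := carlesonConstant P (F.nonLargest star))).lt_or_eq with h | h
    · exact Or.inl (ha star hstar h)
    · exact Or.inr (hb star hstar h)
  · exact lt_top_iff_ne_top.2 fun htop => hnot ⟨h, hb star hstar htop⟩
  · by_contra htop
    exact hnot ⟨ha star hstar (lt_top_iff_ne_top.2 htop), h⟩
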